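/- Theorem 3 (2 bits of advice). A tadpole graph $T_{i,j}$ ($i\ge 3$, $j\ge 1$) consists of a cycle with $i$ vertices and a path with $j$ vertices (the stem), an endpoint of which is joined by an edge to one vertex of the cycle. Every vertex carries a unique identifier and every edge a positive real weight. A searcher starts at an arbitrary vertex $s$ of an unknown weighted graph; whenever it arrives at a vertex, it learns the identifier of that vertex, the identifiers of all adjacent vertices and the weights of all incident edges. It then either moves to an adjacent vertex, paying the weight of the traversed edge (even if this edge was traversed before), or stops. A deterministic online algorithm with $b$ bits of advice makes each of these decisions as a function of what the searcher has learned so far and of a string in $\{0,1\}^b$ that an oracle, knowing the algorithm, the weighted graph and $s$, provides in advance. The algorithm explores the graph if the searcher's walk stops at $s$ after visiting all vertices; its competitive ratio on a class of weighted graphs is the supremum, over all graphs of the class and all starting vertices $s$, of the cost of its walk divided by the minimum cost of a closed walk from $s$ that visits all vertices. There is a deterministic online algorithm with $2$ bits of advice that explores all weighted tadpole graphs, from every starting vertex, with competitive ratio at most $\frac{1+\sqrt{3}}{2}$. -/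

import Mathlib

open scoped ENNReal

namespace TadpoleExploration

/-- A finite connected simple undirected graph with positive edge weights. Vertices are identified
with their unique identifiers, which are elements of `ι`. -/
structure WeightedGraph (ι : Type*) where
  /-- the finite vertex set -/
  verts : Finset ι
  /-- the adjacency relation -/
  graph : SimpleGraph ι
  /-- edges only join vertices of the graph -/
  mem_verts_of_adj : ∀ u v : ι, graph.Adj u v → u ∈ verts
  /-- the graph is connected -/
  connected : (graph.induce (verts : Set ι)).Connected
  /-- the edge weights (values on pairs that are not edges are irrelevant) -/
  weight : Sym2 ι → ℝ
  /-- edge weights are positive -/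
  weight_pos : ∀ e ∈ graph.edgeSet, 0 < weight e

/-- The tadpole graph `T_{i,j}`: a cycle on `i` vertices and a path (the stem) on `j` vertices,
joined by an edge between a vertex of the cycle (the junction) and an endpoint of the path. -/
def tadpoleGraph (i j : ℕ) [NeZero i] [NeZero j] : SimpleGraph (Fin i ⊕ Fin j) :=
  (SimpleGraph.cycleGraph i ⊕g SimpleGraph.pathGraph j) ⊔
    SimpleGraph.edge (Sum.inl 0) (Sum.inr 0)

/-- What the searcher perceives on arriving at a vertex. -/
structure Observation (ι : Type*) where
  /-- identifier of the vertex -/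
  vertex : ι
  /-- identifiers of the adjacent vertices, each with the weight of the connecting edge -/
  incident : Set (ι × ℝ)

/-- A deterministic online algorithm: from the chronological list of all observations made so far
(one per arrival at a vertex, the first one at the starting vertex) it computes the vertex to move
to next, or `none` in order to stop. -/
abbrev Algorithm (ι : Type*) : Type _ := List (Observation ι) → Option ι

/-- A deterministic online algorithm that receives a string of `b` advice bits beforehand. -/
abbrev AdviceAlgorithm (ι : Type*) (b : ℕ) : Type _ := (Fin b → Bool) → Algorithm ι

namespace WeightedGraph

variable {ι : Type*} (G : WeightedGraph ι)

/-- `G` is (isomorphic to) a tadpole graph `T_{i,j}` with `i ≥ 3` and `j ≥ 1`. -/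
def IsTadpole : Prop :=
  ∃ i j : ℕ, Nonempty (tadpoleGraph (i + 3) (j + 1) ≃g G.graph.induce (G.verts : Set ι))

/-- The observation made at the vertex `v`. -/
def observe (v : ι) : Observation ι where
  vertex := v
  incident := {p | G.graph.Adj v p.1 ∧ p.2 = G.weight s(v, p.1)}

/-- The cost of a walk: every traversal of an edge is paid for. -/
def walkCost {u v : ι} (p : G.graph.Walk u v) : ℝ :=
  (p.edges.map G.weight).sum

/-- A tour from `s`: a closed walk from `s` that visits all vertices. -/
def IsTour {s : ι} (p : G.graph.Walk s s) : Prop :=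
  ∀ v ∈ G.verts, v ∈ p.support

/-- The walk `p` is exactly what the searcher does when it runs `A` from the first vertex of `p`:
after each arrival, `A` names the next vertex of `p`, and at the end of `p` it stops. -/
def IsRun (A : Algorithm ι) {u v : ι} (p : G.graph.Walk u v) : Prop :=
  ∀ k ≤ p.length, A ((p.support.take (k + 1)).map G.observe) = p.support[k + 1]?

/-- The cost of an optimal tour from `s`. -/
noncomputable def optCost (s : ι) : ℝ≥0∞ :=
  ⨅ (p : G.graph.Walk s s) (_ : G.IsTour p), ENNReal.ofReal (G.walkCost p)

/-- The cost of `A` when started at `s`: the cost of its run if this run stops and is a tour (there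
is at most one such run), and `∞` otherwise. -/
noncomputable def algCost (A : Algorithm ι) (s : ι) : ℝ≥0∞ :=
  ⨅ (p : G.graph.Walk s s) (_ : G.IsRun A p ∧ G.IsTour p), ENNReal.ofReal (G.walkCost p)

end WeightedGraph

/-- The competitive ratio of an algorithm with `b` bits of advice on a class `𝒢` of weighted graphs:
the supremum, over all graphs in the class and all starting vertices, of the ratio between its cost
and the optimal cost, where an oracle that knows the algorithm, the graph and the starting vertex
picks the best advice string. -/
noncomputable def competitiveRatio {ι : Type*} {b : ℕ} (A : AdviceAlgorithm ι b)
    (𝒢 : Set (WeightedGraph ι)) : ℝ≥0∞ :=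
  ⨆ (G ∈ 𝒢) (s ∈ G.verts), (⨅ a : Fin b → Bool, G.algCost (A a) s) / G.optCost s

end TadpoleExploration

/-! A closed walk through all vertices either uses every edge of the cycle, and then costs at least
R, the cycle plus twice the stem; or it omits a cycle edge, and then parity of crossings of cuts
forces it to use every edge of the remaining spanning tree at least twice (`Tadpole.lower_bound`).
The lightest of these trees, of weight T, omits a heaviest cycle edge. Hence it suffices to find,
for each start, advice under which the cost is at most R and at most (1+√3)T
(`Tadpole.exists_tours`).

If R ≤ (1+√3)T, the first bit makes the searcher go round the cycle at cost exactly R. The second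
bit supplies a direction for which the stem is traversed only twice (`Tadpole.tours_around`).

If R > (1+√3)T, the heaviest cycle edge is to be avoided (`Layout.tours_heavy`). Without it the
graph is a spider with three legs, of total length T. The second bit brings the searcher to the
junction inside the spider, or names the legs if it starts there; from a start on the stem, the rest
of the stem is explored before. From then on the searcher extends the leg it is on unless the next
edge is blocked, that is, too heavy compared with what is known about the other legs; then it
changes legs. The removed edge stays blocked while the cycle is unfinished
(`Layout.lt_len_of_not_blocked`), but never are all unfinished legs blocked
(`not_blocked_of_blocked_first`), so the whole spider gets explored.

A depth-first search would cost 2T; each return to an abandoned leg adds a detour. With detours of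
total length 2E the cost is 2T + 2E, so E ≤ (√3-1)/2 · T is needed. Two families of inequalities,
`Layout.InvSide` and `Layout.InvFirst`, are maintained (`Layout.completesIn_of_inv`). They hold
because a leg is abandoned only in front of an edge so heavy that its weight, counted in T, pays for
the detour. The constants fit since (√3-1)/2 is the inverse of 1+√3 and (√3-1)/2 + (3-√3)/2 = 1. -/

namespace TadpoleExploration

/-! ### Algorithms given by an automaton that commits to a list of vertices to be visited next -/

section Automaton

variable {ι K : Type*}

/-- The transition of an automaton with a queue: when the queue of planned vertices has been
worked off, `upd` computes a new state and a new queue from the last observation. -/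
def queueStep (upd : K → Observation ι → K × List ι) (σ : K × List ι) (o : Observation ι) :
    K × List ι :=
  -- The head of the queue is the vertex just reached. The empty initial queue also has an empty
  -- tail, so the first observation triggers `upd`.
  match σ.2.tail with
  | [] => upd σ.1 o
  | x :: q => (σ.1, x :: q)

/-- The algorithm carried out by an automaton with a queue. -/
def queueAlgorithm (upd : K → Observation ι → K × List ι) (k₀ : K) : Algorithm ι :=
  fun h => (h.foldl (queueStep upd) (k₀, [])).2.head?

/-- `Exec upd obs σ l`: from the configuration `σ`, the automaton visits the vertices of `l` and
then stops. -/
inductive Exec (upd : K → Observation ι → K × List ι) (obs : ι → Observation ι) :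
    K × List ι → List ι → Prop
  | halt (k : K) : Exec upd obs (k, []) []
  | pass (k : K) (v x : ι) (q l : List ι) : Exec upd obs (k, x :: q) l →
      Exec upd obs (k, v :: x :: q) (v :: l)
  | arrive (k : K) (v : ι) (l : List ι) : Exec upd obs (upd k (obs v)) l →
      Exec upd obs (k, [v]) (v :: l)

/-- Observations made on the way through a queue leave the state unchanged; only the arrival at its
last vertex matters. -/
theorem Exec.queue {upd : K → Observation ι → K × List ι} {obs : ι → Observation ι} {k : K}
    {v : ι} {l : List ι} (h : Exec upd obs (upd k (obs v)) l) (q : List ι) :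
    Exec upd obs (k, q ++ [v]) (q ++ v :: l) := by
  induction q with
  | nil => exact .arrive k v l h
  | cons x q ih =>
    cases q with
    | nil => exact .pass _ _ _ _ _ ih
    | cons y q => exact .pass _ _ _ _ _ ih

theorem Exec.head?_foldl {upd : K → Observation ι → K × List ι} {obs : ι → Observation ι}
    {σ : K × List ι} {l : List ι} (h : Exec upd obs σ l) :
    ∀ k ≤ l.length, (((l.take k).map obs).foldl (queueStep upd) σ).2.head? = l[k]? := by
  induction h with
  | halt k => intro m hm; simp
  | pass k v x q l h ih =>
    rintro (_ | m) hm
    · simp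
    · simpa [queueStep] using ih m (by simpa using hm)
  | arrive k v l h ih =>
    rintro (_ | m) hm
    · simp
    · simpa [queueStep] using ih m (by simpa using hm)

end Automaton

/-! ### Walks as lists of vertices with a cost -/

namespace WeightedGraph

variable {ι : Type*} (G : WeightedGraph ι)

/-- The vertices of `l` form, in this order and after `v`, a walk from `v` to `u` of cost `c`. -/
def Trek (v : ι) (l : List ι) (u : ι) (c : ℝ) : Prop :=
  ∃ p : G.graph.Walk v u, p.support = v :: l ∧ G.walkCost p = c

variable {G}

theorem Trek.nil (v : ι) : G.Trek v [] v 0 := ⟨.nil, by simp, by simp [walkCost]⟩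

theorem Trek.cons {v x u : ι} {l : List ι} {c c' : ℝ} (h : G.graph.Adj v x)
    (ht : G.Trek x l u c) (hc : c' = G.weight s(v, x) + c) : G.Trek v (x :: l) u c' := by
  obtain ⟨p, hp, rfl⟩ := ht
  exact ⟨.cons h p, by simp [hp], by simp [walkCost, hc]⟩

theorem Trek.append {v u w : ι} {l l' : List ι} {c c' : ℝ} (h : G.Trek v l u c)
    (h' : G.Trek u l' w c') : G.Trek v (l ++ l') w (c + c') := by
  obtain ⟨p, hp, rfl⟩ := h
  obtain ⟨q, hq, rfl⟩ := h'
  exact ⟨p.append q, by simp [SimpleGraph.Walk.support_append, hp, hq], by simp [walkCost]⟩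

theorem Trek.of_eq {v u : ι} {l : List ι} {c c' : ℝ} (h : G.Trek v l u c) (hc : c = c') :
    G.Trek v l u c' := hc ▸ h

theorem Trek.single {v x : ι} (h : G.graph.Adj v x) : G.Trek v [x] x (G.weight s(v, x)) :=
  .cons h (.nil x) (by simp)

theorem algCost_le_of_exec {K : Type*} (upd : K → Observation ι → K × List ι) (k₀ : K) {s : ι}
    {l : List ι} {c : ℝ} (he : Exec upd G.observe (upd k₀ (G.observe s)) l)
    (ht : G.Trek s l s c) (hv : ∀ v ∈ G.verts, v = s ∨ v ∈ l) :
    G.algCost (queueAlgorithm upd k₀) s ≤ ENNReal.ofReal c := by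
  obtain ⟨p, hp, rfl⟩ := ht
  refine iInf₂_le_of_le p ⟨fun k hk => ?_, fun v h => ?_⟩ le_rfl
  · have hlen : p.length = l.length := by
      have := congrArg List.length hp
      simpa [SimpleGraph.Walk.length_support] using this
    rw [hp]
    simpa [queueAlgorithm, queueStep] using he.head?_foldl k (hlen ▸ hk)
  · rw [hp]
    simpa using hv v h

end WeightedGraph

/-! ### Spider layouts of a tadpole -/

variable {ι : Type*}

/-- A layout of a tadpole graph: after the removal of one edge of the cycle it becomes a spider with
three legs. The vertex `P i k` has distance `k` from the junction on the leg `i`. The leg `st` is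
the stem, and the removed edge joins the tips of the other two legs. -/
structure Layout (G : WeightedGraph ι) where
  /-- the vertices on the legs -/
  P : Fin 3 → ℕ → ι
  /-- the lengths of the legs -/
  len : Fin 3 → ℕ
  /-- the leg that is the stem -/
  st : Fin 3
  root : ∀ i j, P i 0 = P j 0
  -- Different legs share the junction and nothing else.
  inj : ∀ i j k l, k ≤ len i → l ≤ len j → P i k = P j l → (i = j ∧ k = l) ∨ (k = 0 ∧ l = 0)
  mem_iff : ∀ v, v ∈ G.verts ↔ ∃ i k, k ≤ len i ∧ P i k = v
  adj_iff : ∀ u v, G.graph.Adj u v ↔ (∃ i k, k < len i ∧ s(u, v) = s(P i k, P i (k + 1))) ∨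
    ∃ i j, i ≠ j ∧ i ≠ st ∧ j ≠ st ∧ s(u, v) = s(P i (len i), P j (len j))
  len_st : 1 ≤ len st
  -- A cycle leg may have length 0; then the removed edge is incident with the junction.
  len_cy : ∀ i j, i ≠ j → i ≠ st → j ≠ st → 2 ≤ len i + len j

namespace Layout

variable {G : WeightedGraph ι} (L : Layout G)

/-- The other leg that belongs to the cycle. -/
def oth (i : Fin 3) : Fin 3 := -(i + L.st)

/-- The three elements of `Fin 3` add up to 0, so the negated sum of two distinct ones is the third.
-/
theorem oth_ne {i : Fin 3} (hi : i ≠ L.st) : L.oth i ≠ i ∧ L.oth i ≠ L.st := by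
  have : ∀ i j : Fin 3, i ≠ j → -(i + j) ≠ i ∧ -(i + j) ≠ j := by decide
  exact this i L.st hi

theorem eq_oth {i j : Fin 3} (hi : i ≠ L.st) (hj : j ≠ L.st) (hij : i ≠ j) : j = L.oth i := by
  have : ∀ i j k : Fin 3, i ≠ k → j ≠ k → i ≠ j → j = -(i + k) := by decide
  exact this i j L.st hi hj hij

theorem oth_oth {i : Fin 3} : L.oth (L.oth i) = i := by
  have : ∀ i j : Fin 3, -(-(i + j) + j) = i := by decide
  exact this i L.st

/-- The junction. -/
def J : ι := L.P 0 0

theorem P_zero (i : Fin 3) : L.P i 0 = L.J := L.root i 0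

/-- The edge of the tree from `P i k` to `P i (k + 1)` has this weight. -/
def ew (i : Fin 3) (k : ℕ) : ℝ := G.weight s(L.P i k, L.P i (k + 1))

/-- The distance of `P i k` from the junction in the tree. -/
def dep (i : Fin 3) (k : ℕ) : ℝ := ∑ t ∈ Finset.range k, L.ew i t

/-- The vertex that follows `P i k` on the leg `i`, seen from the junction. -/
def nx (i : Fin 3) (k : ℕ) : Option ι :=
  if k < L.len i then some (L.P i (k + 1)) else
    if i = L.st then none else some (L.P (L.oth i) (L.len (L.oth i)))

theorem nx_of_lt {i : Fin 3} {k : ℕ} (h : k < L.len i) : L.nx i k = some (L.P i (k + 1)) := by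
  simp [nx, h]

theorem nx_st : L.nx L.st (L.len L.st) = none := by simp [nx]

theorem nx_len {i : Fin 3} (h : i ≠ L.st) :
    L.nx i (L.len i) = some (L.P (L.oth i) (L.len (L.oth i))) := by simp [nx, h]

theorem adj_succ {i : Fin 3} {k : ℕ} (h : k < L.len i) :
    G.graph.Adj (L.P i k) (L.P i (k + 1)) := (L.adj_iff _ _).2 (.inl ⟨i, k, h, rfl⟩)

theorem adj_nx {i : Fin 3} {k : ℕ} {u : ι} (hk : k ≤ L.len i) (h : L.nx i k = some u) :
    G.graph.Adj (L.P i k) u := by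
  unfold nx at h
  split_ifs at h with h1 h2
  · rw [← Option.some.inj h]; exact L.adj_succ h1
  · rw [← Option.some.inj h]
    have := L.oth_ne h2
    obtain rfl : k = L.len i := by omega
    exact (L.adj_iff _ _).2 (.inr ⟨i, L.oth i, this.1.symm, h2, this.2, rfl⟩)

theorem ew_pos {i : Fin 3} {k : ℕ} (h : k < L.len i) : 0 < L.ew i k :=
  G.weight_pos _ (L.adj_succ h)

theorem dep_zero (i : Fin 3) : L.dep i 0 = 0 := by simp [dep]

theorem dep_succ (i : Fin 3) (k : ℕ) : L.dep i (k + 1) = L.dep i k + L.ew i k := by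
  simp [dep, Finset.sum_range_succ]

theorem dep_mono {i : Fin 3} {k l : ℕ} (h : k ≤ l) (hl : l ≤ L.len i) :
    L.dep i k ≤ L.dep i l := by
  induction l, h using Nat.le_induction with
  | base => exact le_rfl
  | succ l hl' ih =>
    rw [L.dep_succ]
    have := L.ew_pos (i := i) (k := l) (by omega)
    linarith [ih (by omega)]

theorem dep_nonneg {i : Fin 3} {k : ℕ} (h : k ≤ L.len i) : 0 ≤ L.dep i k := by
  have := L.dep_mono (Nat.zero_le k) h
  rwa [L.dep_zero] at this

theorem P_inj {i : Fin 3} {k l : ℕ} (hk : k ≤ L.len i) (hl : l ≤ L.len i)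
    (h : L.P i k = L.P i l) : k = l := by
  rcases L.inj i i k l hk hl h with h | h <;> omega

theorem P_ne {i j : Fin 3} {k l : ℕ} (hk : k ≤ L.len i) (hl : l ≤ L.len j) (hij : i ≠ j)
    (h : L.P i k = L.P j l) : k = 0 ∧ l = 0 := by
  rcases L.inj i j k l hk hl h with h | h
  · exact absurd h.1 hij
  · exact h

/-- The neighbours of a vertex. -/
theorem adj_P_iff {i : Fin 3} {k : ℕ} (hk : k ≤ L.len i) (u : ι) :
    G.graph.Adj (L.P i k) u ↔ (1 ≤ k ∧ u = L.P i (k - 1)) ∨ L.nx i k = some u ∨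
      (k = 0 ∧ ∃ j, L.nx j 0 = some u) := by
  constructor
  · intro h
    rcases (L.adj_iff _ _).1 h with ⟨j, t, ht, he⟩ | ⟨j, j', hjj, hj, hj', he⟩
    · rw [Sym2.eq_iff] at he
      rcases he with ⟨h1, h2⟩ | ⟨h1, h2⟩
      · rcases L.inj _ _ _ _ hk ht.le h1 with ⟨rfl, rfl⟩ | ⟨rfl, rfl⟩
        · right; left; rw [L.nx_of_lt ht, h2]
        · right; right; exact ⟨rfl, j, by rw [L.nx_of_lt ht, h2]⟩
      · rcases L.inj _ _ _ _ hk ht h1 with ⟨rfl, rfl⟩ | ⟨rfl, h⟩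
        · left; exact ⟨by omega, by simpa using h2⟩
        · omega
    · have key : ∀ j j', j ≠ j' → j ≠ L.st → j' ≠ L.st → L.P i k = L.P j (L.len j) →
          u = L.P j' (L.len j') → L.nx i k = some u ∨ (k = 0 ∧ ∃ j, L.nx j 0 = some u) := by
        intro j j' hjj hj hj' h1 h2
        rcases L.inj _ _ _ _ hk le_rfl h1 with ⟨rfl, rfl⟩ | ⟨rfl, h0⟩
        · left; rw [L.nx_len hj, h2, ← L.eq_oth hj hj' hjj]
        · right; refine ⟨rfl, j, ?_⟩
          have := L.nx_len hj
          rw [h0] at this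
          rw [this, h2, ← L.eq_oth hj hj' hjj]
      right
      rw [Sym2.eq_iff] at he
      rcases he with ⟨h1, h2⟩ | ⟨h1, h2⟩
      · exact key j j' hjj hj hj' h1 h2
      · exact key j' j hjj.symm hj' hj h1 h2
  · rintro (⟨h1, rfl⟩ | h | ⟨rfl, j, h⟩)
    · have := L.adj_succ (i := i) (k := k - 1) (by omega)
      rw [Nat.sub_add_cancel h1] at this
      exact this.symm
    · exact L.adj_nx hk h
    · rw [L.root i j]; exact L.adj_nx (Nat.zero_le _) h

/-- This makes the way ahead recognizable: it is the only edge that does not lead back to the vertex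
just left. -/
theorem nx_ne_pred {i : Fin 3} {k : ℕ} (hk : k ≤ L.len i) (h1 : 1 ≤ k) :
    L.nx i k ≠ some (L.P i (k - 1)) := by
  intro h
  unfold nx at h
  split_ifs at h with h2 h3
  · have := L.P_inj (by omega) (by omega) (Option.some.inj h); omega
  · have hne := L.oth_ne h3
    have := L.P_ne (by omega) (by omega) hne.1 (Option.some.inj h)
    have := L.len_cy i (L.oth i) hne.1.symm h3 hne.2
    omega

/-- The junction therefore has three distinct neighbours, even if one of the cycle legs is empty. -/
theorem nx_zero_ne {i j : Fin 3} (hij : i ≠ j) : L.nx i 0 ≠ L.nx j 0 := by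
  intro h
  have key : ∀ i j : Fin 3, i ≠ j → L.nx i 0 = L.nx j 0 → 0 < L.len i → False := by
    intro i j hij h hi
    rw [L.nx_of_lt hi] at h
    unfold nx at h
    split_ifs at h with h1 h2
    · have := L.P_ne hi h1 hij (Option.some.inj h); omega
    · rcases L.inj _ _ _ _ hi le_rfl (Option.some.inj h) with h3 | h3
      · have hne := L.oth_ne h2
        have := L.len_cy j (L.oth j) hne.1.symm h2 hne.2
        have h4 : L.len i = L.len (L.oth j) := by rw [← h3.1]
        omega
      · omega
  by_cases hi : 0 < L.len i
  · exact key i j hij h hi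
  · by_cases hj : 0 < L.len j
    · exact key j i hij.symm h.symm hj
    · have hi' : i ≠ L.st := by rintro rfl; exact hi L.len_st
      have hj' : j ≠ L.st := by rintro rfl; exact hj L.len_st
      have := L.len_cy i j hij hi' hj'
      omega

theorem nx_zero_isSome (i : Fin 3) : (L.nx i 0).isSome := by
  unfold nx
  split_ifs with h1 h2
  · rfl
  · subst h2; exact absurd L.len_st (by omega)
  · rfl

/-! ### Walks along the legs -/

/-- The vertices met when walking from `P i n` to the junction. -/
def down (i : Fin 3) : ℕ → List ι
  | 0 => []
  | n + 1 => L.P i n :: down i n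

/-- The vertices met when walking from the junction to `P i n`. -/
def up (i : Fin 3) : ℕ → List ι
  | 0 => []
  | n + 1 => up i n ++ [L.P i (n + 1)]

theorem reverse_down (i : Fin 3) (n : ℕ) :
    (L.P i n :: L.down i n).reverse = L.J :: L.up i n := by
  induction n with
  | zero => simp [down, up, L.P_zero]
  | succ n ih =>
    rw [down, List.reverse_cons, ih]
    simp [up]

theorem mem_down {i : Fin 3} {n : ℕ} {v : ι} : v ∈ L.down i n ↔ ∃ k < n, L.P i k = v := by
  induction n with
  | zero => simp [down]
  | succ n ih =>
    simp only [down, List.mem_cons, ih]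
    constructor
    · rintro (rfl | ⟨k, hk, rfl⟩)
      exacts [⟨n, by omega, rfl⟩, ⟨k, by omega, rfl⟩]
    · rintro ⟨k, hk, rfl⟩
      rcases Nat.lt_succ_iff_lt_or_eq.1 hk with h | rfl
      exacts [.inr ⟨k, h, rfl⟩, .inl rfl]

theorem mem_up {i : Fin 3} {n : ℕ} {v : ι} :
    v ∈ L.up i n ↔ ∃ k, 1 ≤ k ∧ k ≤ n ∧ L.P i k = v := by
  induction n with
  | zero => simp only [up, List.not_mem_nil, false_iff]; omega
  | succ n ih =>
    simp only [up, List.mem_append, ih, List.mem_singleton]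
    constructor
    · rintro (⟨k, hk, hk', rfl⟩ | rfl)
      exacts [⟨k, hk, by omega, rfl⟩, ⟨n + 1, by omega, by omega, rfl⟩]
    · rintro ⟨k, hk, hk', rfl⟩
      rcases Nat.le_succ_iff.1 hk' with h | rfl
      exacts [.inl ⟨k, hk, h, rfl⟩, .inr rfl]

theorem trek_down {i : Fin 3} {n : ℕ} (hn : n ≤ L.len i) :
    G.Trek (L.P i n) (L.down i n) L.J (L.dep i n) := by
  induction n with
  | zero => rw [L.P_zero, L.dep_zero]; exact .nil _
  | succ n ih =>
    refine .cons (L.adj_succ hn).symm (ih (by omega)) ?_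
    rw [L.dep_succ, Sym2.eq_swap, add_comm]; rfl

theorem trek_up {i : Fin 3} {n : ℕ} (hn : n ≤ L.len i) :
    G.Trek L.J (L.up i n) (L.P i n) (L.dep i n) := by
  induction n with
  | zero => rw [L.P_zero, L.dep_zero]; exact .nil _
  | succ n ih =>
    rw [L.dep_succ]
    exact (ih (by omega)).append (.single (L.adj_succ hn))

end Layout

open Classical in
/-- The initial segment of a list up to and including the first occurrence of `s`. -/
noncomputable def cutAt (s : ι) : List ι → List ι
  | [] => []
  | x :: l => if x = s then [x] else x :: cutAt s l

theorem cutAt_cons_self (s : ι) (l : List ι) : cutAt s (s :: l) = [s] := by simp [cutAt]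

theorem cutAt_cons_ne {s x : ι} (h : x ≠ s) (l : List ι) :
    cutAt s (x :: l) = x :: cutAt s l := by simp [cutAt, h]

theorem cutAt_append {s : ι} {l : List ι} (h : s ∉ l) (l' : List ι) :
    cutAt s (l ++ l') = l ++ cutAt s l' := by
  induction l with
  | nil => rfl
  | cons x l ih =>
    rw [List.mem_cons, not_or] at h
    rw [List.cons_append, cutAt_cons_ne (Ne.symm h.1), ih h.2, List.cons_append]

theorem cutAt_cutAt (s : ι) (l : List ι) : cutAt s (cutAt s l) = cutAt s l := by
  induction l with
  | nil => rfl
  | cons x l ih =>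
    by_cases h : x = s
    · subst h; simp [cutAt]
    · simp [cutAt_cons_ne h, ih]

namespace Layout

variable {G : WeightedGraph ι} (L : Layout G)

theorem trek_cutAt_down {i : Fin 3} {k n : ℕ} (hk : k < n) (hn : n ≤ L.len i) (l : List ι) :
    G.Trek (L.P i n) (cutAt (L.P i k) (L.down i n ++ l)) (L.P i k) (L.dep i n - L.dep i k) := by
  induction n, hk using Nat.le_induction with
  | base =>
    rw [down, List.cons_append, cutAt_cons_self, L.dep_succ, add_sub_cancel_left]
    exact (WeightedGraph.Trek.single (L.adj_succ hn).symm).of_eq (by rw [Sym2.eq_swap]; rfl)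
  | succ n hkn ih =>
    have hne : L.P i n ≠ L.P i k := fun h => by
      have := L.P_inj (by omega) (by omega) h
      omega
    rw [down, List.cons_append, cutAt_cons_ne hne]
    refine .cons (L.adj_succ hn).symm (ih (by omega)) ?_
    rw [L.dep_succ, Sym2.eq_swap]; unfold ew; ring

end Layout

/-! ### The algorithm -/

/-- What the searcher knows about one of a leg: the vertices visited so far (from the tip to
the junction), their total length, and the edge that leads beyond the tip. -/
structure Arm (ι : Type*) where
  /-- the visited vertices, from the tip to the junction -/
  path : List ι
  /-- the length of the explored part -/
  d : ℝ
  /-- the next vertex and the weight of the edge to it -/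
  bd : Option (ι × ℝ)

namespace Arm

/-- The weight of the boundary edge, and `0` at a dead end. -/
def w (A : Arm ι) : ℝ := A.bd.elim 0 Prod.snd

/-- The length of a leg, including its boundary edge. -/
def full (A : Arm ι) : ℝ := A.d + A.w

/-- The list consisting of the next vertex. -/
def next (A : Arm ι) : List ι := A.bd.elim [] fun p => [p.1]

end Arm

/-- The searcher's memory. -/
inductive State (ι : Type*)
  | start
  /-- walking straight ahead from `s`, before the junction is known -/
  | walk (s : ι) (trail : List ι) (d : ℝ) (next : ι × ℝ) (behind : Option (ι × ℝ))
  /-- crossing the boundary edge of the leg `tgt` -/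
  | main (s : ι) (home : List ι) (arm : Fin 3 → Arm ι) (tgt : Fin 3)
  | fin

/-- The boundary edge of the leg leads to an unvisited vertex. -/
def IsOpen (arm : Fin 3 → Arm ι) (i : Fin 3) : Prop :=
  ∃ p ∈ (arm i).bd, ∀ k, p.1 ∉ (arm k).path

/-- The boundary edge of the leg is too heavy to be crossed without further knowledge. -/
def Blocked (arm : Fin 3 → Arm ι) (i : Fin 3) : Prop :=
  -- A blocked leg with explored length d has full length exceeding (1+√3)d plus a multiple of the
  -- other known lengths, so (√3-1)/2 times its full length pays for walking along d once more. The
  -- threshold of a side leg involves leg 0 but not the other side leg, so extending one side leg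
  -- does not affect the status of the other.
  if i = 0 then √3 * (arm 0).d + (√3 - 1) * ((arm 1).full + (arm 2).full) < (arm 0).w
  else √3 * ((arm i).d + (arm 0).full) < (arm i).w

/-- The boundary edge of the leg may be crossed. -/
def Ok (heavy : Bool) (arm : Fin 3 → Arm ι) (i : Fin 3) : Prop :=
  IsOpen arm i ∧ (heavy = false ∨ ¬ Blocked arm i ∨ ∀ j ≠ i, ¬ IsOpen arm j)

open Classical in
/-- The leg to be extended next, when the searcher is at the tip of the leg `cur`. -/
noncomputable def pick (heavy : Bool) (arm : Fin 3 → Arm ι) (cur : Fin 3) : Option (Fin 3) :=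
  -- The searcher stays on its leg if it can, and enters leg 0 only when both sides are unavailable.
  -- For the tour around the cycle it matters that leg 1 precedes leg 2.
  if Ok heavy arm cur then some cur else
  if Ok heavy arm 1 then some 1 else
  if Ok heavy arm 2 then some 2 else
  if Ok heavy arm 0 then some 0 else none

open Classical in
/-- The way from the tip of the leg `cur` to the junction. -/
noncomputable def back (heavy : Bool) (arm : Fin 3 → Arm ι) (cur : Fin 3) : List ι :=
  -- Here the cycle is complete, and the way to the junction continues over the boundary edge and
  -- down leg 0.
  if heavy = false ∧ cur ≠ 0 ∧ ∃ p ∈ (arm cur).bd, p.1 ∈ (arm 0).path then (arm 0).path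
  else (arm cur).path.tail

/-- The decision at the tip of the leg `cur`. -/
noncomputable def decideMain (heavy : Bool) (s : ι) (home : List ι) (arm : Fin 3 → Arm ι)
    (cur : Fin 3) : State ι × List ι :=
  match pick heavy arm cur with
  | some j => (.main s home arm j, if j = cur then (arm j).next else
      (back heavy arm cur ++ (arm j).path.reverse.tail) ++ (arm j).next)
  | none => (.fin, cutAt s (back heavy arm cur ++ home))

open Classical in
/-- An element whose first component is not `prev`, if there is one. -/
noncomputable def other (I : Set (ι × ℝ)) (prev : Option ι) : Option (ι × ℝ) :=
  if h : ∃ p ∈ I, some p.1 ≠ prev then some h.choose else none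

/-- `e` lists the elements of `I`. -/
def Lists {n : ℕ} (e : Fin n → ι × ℝ) (I : Set (ι × ℝ)) : Prop :=
  Function.Injective e ∧ Set.range e = I

open Classical in
/-- The position at which the vertex `v` occurs in the list `e`. -/
noncomputable def position (e : Fin 3 → ι × ℝ) (v : Option ι) : Fin 3 :=
  if h : ∃ i, some (e i).1 = v then h.choose else 0

/-- A leg of which only the junction and the first edge are known. -/
def newArm (J : ι) (p : ι × ℝ) : Arm ι := ⟨[J], 0, some p⟩

/-- The legs as known when the junction `J` with the incident edges `e` is entered via `e i`. -/
def initialArms (J : ι) (e : Fin 3 → ι × ℝ) (i : Fin 3) (trail : List ι) (d : ℝ)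
    (behind : Option (ι × ℝ)) : Fin 3 → Arm ι :=
  -- With nothing left behind, the searcher comes from the fully explored stem, which becomes leg 2;
  -- otherwise the leg with the start becomes leg 0. In both cases the legs follow the cyclic order
  -- of `e`.
  match behind with
  | none => ![newArm J (e (i + 1)), newArm J (e (i + 2)), ⟨(J :: trail).reverse, d, none⟩]
  | some p =>
    ![⟨(J :: trail).reverse, d, some p⟩, newArm J (e (i + 1)), newArm J (e (i + 2))]

open Classical in
/-- The way from the junction to `s`. -/
noncomputable def homeList (heavy : Bool) (s : ι) (I : Set (ι × ℝ)) (trail : List ι) : List ι :=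
  -- The direct edge to `s` is needed when it is the edge that closes the cycle.
  if heavy = false ∧ ∃ p ∈ I, p.1 = s then [s] else cutAt s trail

open Classical in
/-- The reaction to an observation while walking straight ahead. -/
noncomputable def updWalk (heavy : Bool) (s : ι) (trail : List ι) (d : ℝ)
    (behind : Option (ι × ℝ)) (o : Observation ι) : State ι × List ι :=
  if h : ∃ e : Fin 3 → ι × ℝ, Lists e o.incident then
    decideMain heavy s (homeList heavy s o.incident trail)
      (initialArms o.vertex h.choose (position h.choose trail.head?) trail d behind) 1
  else match other o.incident trail.head?, behind with
    | some p, _ => (.walk s (o.vertex :: trail) d p behind, [p.1])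
    -- At the dead end the searcher turns: the queue leads back to `s` and one edge beyond. The
    -- reversed trail begins with `s`, as if the walk had come straight from the dead end, and
    -- nothing remains behind.
    | none, some p => (.walk s (o.vertex :: trail).reverse d p none, trail ++ [p.1])
    | none, none => (.fin, [])

open Classical in
/-- The reaction to the first observation. -/
noncomputable def updStart (heavy b : Bool) (o : Observation ι) : State ι × List ι :=
  if h : ∃ e : Fin 3 → ι × ℝ, Lists e o.incident then
    -- At the junction the second bit decides which leg plays the role of leg 0.
    let i : Fin 3 := if b then 1 else 0
    decideMain heavy o.vertex [] ![newArm o.vertex (h.choose i), newArm o.vertex (h.choose (i + 1)),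
      newArm o.vertex (h.choose (i + 2))] 1
  else if h : ∃ e : Fin 2 → ι × ℝ, Lists e o.incident then
    let i : Fin 2 := if b then 1 else 0
    (.walk o.vertex [o.vertex] 0 (h.choose i) (some (h.choose (i + 1))), [(h.choose i).1])
  else match other o.incident none with
    | some p => (.walk o.vertex [o.vertex] 0 p none, [p.1])
    | none => (.fin, [])

/-- The reaction to an observation. -/
noncomputable def upd (heavy b : Bool) : State ι → Observation ι → State ι × List ι
  | .start, o => updStart heavy b o
  | .walk s trail d p behind, o => updWalk heavy s trail (d + p.2) behind o
  | .main s home arm j, o => decideMain heavy s home (Function.update arm j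
      ⟨o.vertex :: (arm j).path, (arm j).full, other o.incident (arm j).path.head?⟩) j
  | .fin, _ => (.fin, [])

/-- The algorithm: the first advice bit tells whether some edge of the cycle is so heavy that it has
to be avoided, the second one is used for the choice of a direction. -/
noncomputable def tadpoleAlgorithm (ι : Type*) : AdviceAlgorithm ι 2 :=
  fun a => queueAlgorithm (upd (a 0) (a 1)) .start

/-! ### Simulation on a layout -/

theorem other_eq_some {I : Set (ι × ℝ)} {prev : Option ι} {p : ι × ℝ} (hp : p ∈ I)
    (hne : some p.1 ≠ prev) (h : ∀ q ∈ I, some q.1 ≠ prev → q = p) :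
    other I prev = some p := by
  have hex : ∃ p ∈ I, some p.1 ≠ prev := ⟨p, hp, hne⟩
  rw [other, dif_pos hex, h _ hex.choose_spec.1 hex.choose_spec.2]

theorem other_eq_none {I : Set (ι × ℝ)} {prev : Option ι} (h : ∀ q ∈ I, some q.1 = prev) :
    other I prev = none := by
  rw [other, dif_neg]
  rintro ⟨p, hp, hne⟩
  exact hne (h p hp)

namespace Layout

variable {G : WeightedGraph ι} (L : Layout G)

/-- The edge by which the leg `i` is continued beyond `P i k`. -/
def bdAt (i : Fin 3) (k : ℕ) : Option (ι × ℝ) :=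
  (L.nx i k).map fun u => (u, G.weight s(L.P i k, u))

/-- The knowledge about the leg `i` after the vertices up to `P i k` have been visited. -/
def armAt (i : Fin 3) (k : ℕ) : Arm ι := ⟨L.P i k :: L.down i k, L.dep i k, L.bdAt i k⟩

/-- The knowledge about all legs. -/
def arms (n : Fin 3 → ℕ) (i : Fin 3) : Arm ι := L.armAt i (n i)

theorem mem_observe {i : Fin 3} {k : ℕ} (hk : k ≤ L.len i) (p : ι × ℝ) :
    p ∈ (G.observe (L.P i k)).incident ↔ ((1 ≤ k ∧ p.1 = L.P i (k - 1)) ∨ L.nx i k = some p.1 ∨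
      (k = 0 ∧ ∃ j, L.nx j 0 = some p.1)) ∧ p.2 = G.weight s(L.P i k, p.1) := by
  rw [← L.adj_P_iff hk]; rfl

theorem other_forward {i : Fin 3} {k : ℕ} (hk : k + 1 ≤ L.len i) :
    other (G.observe (L.P i (k + 1))).incident (some (L.P i k)) = L.bdAt i (k + 1) := by
  have hne := L.nx_ne_pred hk (by omega)
  unfold bdAt
  cases hx : L.nx i (k + 1) with
  | none =>
    refine other_eq_none fun q hq => ?_
    rw [L.mem_observe hk] at hq
    simp [hx] at hq
    simp [hq.1]
  | some u =>
    rw [hx] at hne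
    refine other_eq_some ((L.mem_observe hk _).2 ⟨by simp [hx], rfl⟩) (by simpa using hne) ?_
    intro q hq hqne
    rw [L.mem_observe hk] at hq
    simp [hx] at hq hqne
    obtain ⟨h1 | h1, h2⟩ := hq
    · exact absurd h1 hqne
    · rw [← h1] at h2
      exact Prod.ext h1.symm h2

theorem other_backward {i : Fin 3} {k : ℕ} (hk : k + 1 < L.len i) :
    other (G.observe (L.P i (k + 1))).incident (some (L.P i (k + 2))) =
      some (L.P i k, L.ew i k) := by
  have hne : L.P i k ≠ L.P i (k + 2) := fun h => by
    have := L.P_inj (by omega) (by omega) h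
    omega
  refine other_eq_some ((L.mem_observe hk.le _).2 ⟨by simp, ?_⟩) (by simpa using hne) ?_
  · rw [Sym2.eq_swap]; rfl
  · intro q hq hqne
    rw [L.mem_observe hk.le, L.nx_of_lt hk] at hq
    simp at hq hqne
    obtain ⟨h1 | h1, h2⟩ := hq
    · rw [h1, Sym2.eq_swap] at h2
      exact Prod.ext h1 h2
    · exact absurd h1.symm hqne

/-- Apart from the junction, all vertices have degree at most two; so an incidence list of length
three identifies the junction. -/
theorem not_lists_three {i : Fin 3} {k : ℕ} (h1 : 1 ≤ k) (hk : k ≤ L.len i) :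
    ¬ ∃ e : Fin 3 → ι × ℝ, Lists e (G.observe (L.P i k)).incident := by
  rintro ⟨e, he, hr⟩
  have hmem : ∀ j, (e j).1 = L.P i (k - 1) ∨ L.nx i k = some (e j).1 := by
    intro j
    have : e j ∈ (G.observe (L.P i k)).incident := hr ▸ Set.mem_range_self j
    rw [L.mem_observe hk] at this
    rcases this.1 with h | h | h
    exacts [.inl h.2, .inr h, absurd h.1 (by omega)]
  have hinj : ∀ j j', (e j).1 = (e j').1 → j = j' := by
    intro j j' h
    have h1 : e j ∈ (G.observe (L.P i k)).incident := hr ▸ Set.mem_range_self j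
    have h2 : e j' ∈ (G.observe (L.P i k)).incident := hr ▸ Set.mem_range_self j'
    exact he (Prod.ext h (by rw [h1.2, h2.2, h]))
  have h01 := hinj 0 1
  have h02 := hinj 0 2
  have h12 := hinj 1 2
  have ss : ∀ a b : ι, L.nx i k = some a → L.nx i k = some b → a = b := by
    intro a b ha hb; rw [ha] at hb; exact Option.some.inj hb
  rcases hmem 0 with h0 | h0 <;> rcases hmem 1 with h1 | h1 <;> rcases hmem 2 with h2 | h2
  · exact absurd (h01 (h0.trans h1.symm)) (by decide)
  · exact absurd (h01 (h0.trans h1.symm)) (by decide)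
  · exact absurd (h02 (h0.trans h2.symm)) (by decide)
  · exact absurd (h12 (ss _ _ h1 h2)) (by decide)
  · exact absurd (h12 (h1.trans h2.symm)) (by decide)
  · exact absurd (h02 (ss _ _ h0 h2)) (by decide)
  · exact absurd (h01 (ss _ _ h0 h1)) (by decide)
  · exact absurd (h01 (ss _ _ h0 h1)) (by decide)

/-- The next vertex on the leg `i` exists and is unvisited. -/
def Op (n : Fin 3 → ℕ) (i : Fin 3) : Prop :=
  -- At the tip of a cycle leg, the next vertex is the tip of the other cycle leg, across the
  -- removed edge.
  n i < L.len i ∨ (i ≠ L.st ∧ n (L.oth i) < L.len (L.oth i))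

theorem mem_path {n : Fin 3 → ℕ} {i : Fin 3} {v : ι} :
    v ∈ (L.arms n i).path ↔ ∃ k ≤ n i, L.P i k = v := by
  simp only [arms, armAt, List.mem_cons, mem_down]
  constructor
  · rintro (rfl | ⟨k, hk, rfl⟩)
    exacts [⟨_, le_rfl, rfl⟩, ⟨k, hk.le, rfl⟩]
  · rintro ⟨k, hk, rfl⟩
    rcases hk.lt_or_eq with h | rfl
    exacts [.inr ⟨k, h, rfl⟩, .inl rfl]

theorem isOpen_arms {n : Fin 3 → ℕ} (hn : ∀ i, n i ≤ L.len i) (i : Fin 3) :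
    IsOpen (L.arms n) i ↔ L.Op n i := by
  have key : IsOpen (L.arms n) i ↔ ∃ u, L.nx i (n i) = some u ∧
      ∀ j, ∀ k ≤ n j, L.P j k ≠ u := by
    simp only [IsOpen, L.mem_path]
    simp only [arms, armAt, bdAt, Option.mem_map, not_exists, not_and]
    constructor
    · rintro ⟨p, ⟨u, hu, rfl⟩, h⟩
      exact ⟨u, hu, h⟩
    · rintro ⟨u, hu, h⟩
      exact ⟨_, ⟨u, hu, rfl⟩, h⟩
  rw [key]
  unfold Op
  by_cases h1 : n i < L.len i
  · simp only [L.nx_of_lt h1, h1, true_or, iff_true]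
    refine ⟨_, rfl, fun j k hk he => ?_⟩
    rcases L.inj _ _ _ _ (hk.trans (hn j)) h1 he with ⟨rfl, h⟩ | h <;> omega
  · have h2 : n i = L.len i := le_antisymm (hn i) (by omega)
    by_cases h3 : i = L.st
    · rw [h2, h3, L.nx_st]; simp
    · rw [h2, L.nx_len h3]
      simp only [lt_irrefl, false_or, ne_eq, h3, not_false_eq_true, true_and, Option.some.injEq]
      have hne := L.oth_ne h3
      constructor
      · rintro ⟨u, rfl, h⟩
        by_contra h4
        exact h _ _ (by omega) rfl
      · intro h4
        refine ⟨_, rfl, fun j k hk he => ?_⟩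
        rcases L.inj _ _ _ _ (hk.trans (hn j)) le_rfl he with ⟨rfl, h⟩ | h <;> omega

theorem back_arms_true (n : Fin 3 → ℕ) (i : Fin 3) :
    back true (L.arms n) i = L.down i (n i) := by
  simp [back, arms, armAt]

theorem next_arms {n : Fin 3 → ℕ} {j : Fin 3} (h : n j < L.len j) :
    (L.arms n j).next = [L.P j (n j + 1)] := by
  simp [Arm.next, arms, armAt, bdAt, L.nx_of_lt h]

theorem w_arms {n : Fin 3 → ℕ} {j : Fin 3} (h : n j < L.len j) :
    (L.arms n j).w = L.ew j (n j) := by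
  simp [Arm.w, arms, armAt, bdAt, L.nx_of_lt h, ew]

theorem d_arms (n : Fin 3 → ℕ) (j : Fin 3) : (L.arms n j).d = L.dep j (n j) := rfl

theorem full_arms {n : Fin 3 → ℕ} {j : Fin 3} (h : n j < L.len j) :
    (L.arms n j).full = L.dep j (n j + 1) := by
  rw [Arm.full, L.w_arms h, L.d_arms, L.dep_succ]

theorem w_st {n : Fin 3 → ℕ} (h : n L.st = L.len L.st) : (L.arms n L.st).w = 0 := by
  simp [Arm.w, arms, armAt, bdAt, h, L.nx_st]

/-- The edge that was removed from the cycle. -/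
def cutEdge (i : Fin 3) : Sym2 ι := s(L.P i (L.len i), L.P (L.oth i) (L.len (L.oth i)))

theorem w_cut {n : Fin 3 → ℕ} {i : Fin 3} (hi : i ≠ L.st) (h : n i = L.len i) :
    (L.arms n i).w = G.weight (L.cutEdge i) := by
  simp [Arm.w, arms, armAt, bdAt, h, L.nx_len hi, cutEdge]

theorem w_nonneg {n : Fin 3 → ℕ} (hn : ∀ i, n i ≤ L.len i) (j : Fin 3) :
    0 ≤ (L.arms n j).w := by
  simp only [Arm.w, arms, armAt, bdAt]
  cases h : L.nx j (n j) with
  | none => simp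
  | some u => exact (G.weight_pos _ (L.adj_nx (hn j) h)).le

theorem update_arms {n : Fin 3 → ℕ} {j : Fin 3} (h : n j < L.len j) :
    Function.update (L.arms n) j ⟨L.P j (n j + 1) :: (L.arms n j).path, (L.arms n j).full,
      other (G.observe (L.P j (n j + 1))).incident (L.arms n j).path.head?⟩ =
    L.arms (Function.update n j (n j + 1)) := by
  funext i
  by_cases hi : i = j
  · subst hi
    rw [L.full_arms h]
    simp only [Function.update_self, arms, armAt, List.head?_cons, L.other_forward h, down]
  · simp [Function.update_of_ne hi, arms]

/-- From the tip of the leg `i`, the algorithm completes the tour at a cost of `c`, if the vertices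
up to `P k (n k)` have been visited on each leg `k`. -/
def Completes (heavy b : Bool) (s : ι) (home : List ι) (n : Fin 3 → ℕ) (i : Fin 3) (c : ℝ) :
    Prop :=
  ∃ l, Exec (upd heavy b) G.observe (decideMain heavy s home (L.arms n) i) l ∧
    G.Trek (L.P i (n i)) l s c ∧ ∀ v ∈ G.verts, (∃ k, ∃ t ≤ n k, L.P k t = v) ∨ v ∈ l

variable {L}

theorem Completes.of_eq {heavy b : Bool} {s : ι} {home : List ι} {n : Fin 3 → ℕ} {i : Fin 3}
    {c c' : ℝ} (h : L.Completes heavy b s home n i c) (hc : c = c') :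
    L.Completes heavy b s home n i c' := hc ▸ h

theorem Completes.of_pick {heavy b : Bool} {s : ι} {home : List ι} {n : Fin 3 → ℕ} {i j : Fin 3}
    {c c₁ : ℝ} (hp : pick heavy (L.arms n) i = some j) (hj : n j < L.len j) {q : List ι}
    (hq : (if j = i then [] else back heavy (L.arms n) i ++ L.up j (n j)) = q)
    (ht : G.Trek (L.P i (n i)) q (L.P j (n j)) c₁)
    (hc : L.Completes heavy b s home (Function.update n j (n j + 1)) j c) :
    L.Completes heavy b s home n i (c₁ + (L.ew j (n j) + c)) := by
  obtain ⟨l, hl, htl, hcov⟩ := hc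
  rw [Function.update_self] at htl
  refine ⟨q ++ L.P j (n j + 1) :: l, ?_, ht.append (.cons (L.adj_succ hj) htl rfl), ?_⟩
  · have : decideMain heavy s home (L.arms n) i =
        (.main s home (L.arms n) j, q ++ [L.P j (n j + 1)]) := by
      rw [decideMain, hp, ← hq]
      have h2 : (L.arms n j).path.reverse.tail = L.up j (n j) := by
        simp only [arms, armAt, L.reverse_down, List.tail_cons]
      simp only [L.next_arms hj, h2]
      split_ifs <;> rfl
    rw [this]
    refine Exec.queue ?_ q
    rw [upd, ← L.update_arms hj] at *
    exact hl
  · intro v hv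
    rcases hcov v hv with ⟨k, t, ht, rfl⟩ | h
    · by_cases hk : k = j
      · subst hk
        rw [Function.update_self] at ht
        rcases Nat.le_succ_iff.1 ht with h | rfl
        · exact .inl ⟨k, t, h, rfl⟩
        · right; simp
      · rw [Function.update_of_ne hk] at ht
        exact .inl ⟨k, t, ht, rfl⟩
    · right; simp [h]

theorem Completes.cross {heavy b : Bool} {s : ι} {home : List ι} {n : Fin 3 → ℕ} {i : Fin 3}
    {c : ℝ} (hp : pick heavy (L.arms n) i = some i) (hi : n i < L.len i)
    (hc : L.Completes heavy b s home (Function.update n i (n i + 1)) i c) :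
    L.Completes heavy b s home n i (L.ew i (n i) + c) :=
  (Completes.of_pick hp hi (if_pos rfl) (.nil _) hc).of_eq (zero_add _)

theorem Completes.move {heavy b : Bool} {s : ι} {home : List ι} {n : Fin 3 → ℕ} {i j : Fin 3}
    {c c₁ : ℝ} (hn : ∀ i, n i ≤ L.len i) (hij : j ≠ i)
    (hp : pick heavy (L.arms n) i = some j) (hj : n j < L.len j)
    (hb : G.Trek (L.P i (n i)) (back heavy (L.arms n) i) L.J c₁)
    (hc : L.Completes heavy b s home (Function.update n j (n j + 1)) j c) :
    L.Completes heavy b s home n i (c₁ + L.dep j (n j) + (L.ew j (n j) + c)) :=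
  Completes.of_pick hp hj (if_neg hij) (hb.append (L.trek_up (hn j))) hc

theorem Completes.home {heavy b : Bool} {s : ι} {home : List ι} {n : Fin 3 → ℕ} {i : Fin 3}
    {c : ℝ} (hp : pick heavy (L.arms n) i = none) (hn : ∀ i, n i = L.len i)
    (ht : G.Trek (L.P i (n i)) (cutAt s (back heavy (L.arms n) i ++ home)) s c) :
    L.Completes heavy b s home n i c := by
  refine ⟨_, ?_, ht, fun v hv => ?_⟩
  · rw [decideMain, hp]
    rcases List.eq_nil_or_concat (cutAt s (back heavy (L.arms n) i ++ home)) with hq | ⟨q, x, hq⟩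
    · simp only [hq]
      exact .halt _
    · rw [hq, List.concat_eq_append]
      exact Exec.queue (upd := upd heavy b) (k := .fin) (l := []) (.halt _) q
  · obtain ⟨k, t, ht, rfl⟩ := (L.mem_iff v).1 hv
    exact .inl ⟨k, t, by rw [hn]; exact ht, rfl⟩

end Layout

theorem pick_cases (heavy : Bool) (arm : Fin 3 → Arm ι) (cur : Fin 3) :
    (Ok heavy arm cur ∧ pick heavy arm cur = some cur) ∨
    (¬ Ok heavy arm cur ∧ Ok heavy arm 1 ∧ pick heavy arm cur = some 1) ∨
    (¬ Ok heavy arm cur ∧ ¬ Ok heavy arm 1 ∧ Ok heavy arm 2 ∧ pick heavy arm cur = some 2) ∨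
    (¬ Ok heavy arm cur ∧ ¬ Ok heavy arm 1 ∧ ¬ Ok heavy arm 2 ∧ Ok heavy arm 0 ∧
      pick heavy arm cur = some 0) ∨
    ((∀ i, ¬ Ok heavy arm i) ∧ pick heavy arm cur = none) := by
  unfold pick
  by_cases h : Ok heavy arm cur <;> by_cases h1 : Ok heavy arm 1 <;>
    by_cases h2 : Ok heavy arm 2 <;> by_cases h0 : Ok heavy arm 0 <;>
    simp [h, h1, h2, h0, Fin.forall_fin_succ]

theorem pick_unique {heavy : Bool} {arm : Fin 3 → Arm ι} {k : Fin 3}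
    (h : ∀ i, Ok heavy arm i ↔ i = k) (cur : Fin 3) : pick heavy arm cur = some k := by
  rcases pick_cases heavy arm cur with ⟨h1, h2⟩ | ⟨-, h1, h2⟩ | ⟨-, -, h1, h2⟩ |
    ⟨-, -, -, h1, h2⟩ | ⟨h1, -⟩
  · rw [h2, (h _).1 h1]
  · rw [h2, (h _).1 h1]
  · rw [h2, (h _).1 h1]
  · rw [h2, (h _).1 h1]
  · exact absurd ((h k).2 rfl) (h1 k)

/-! ### What a blocked edge pays for: inequalities with √3 -/

section Real

theorem sqrt_three_bounds : (1.7 : ℝ) < √3 ∧ √3 < 1.74 :=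
  ⟨Real.lt_sqrt_of_sq_lt (by norm_num), (Real.sqrt_lt' (by norm_num)).2 (by norm_num)⟩

theorem sqrt_three_sq : √3 * √3 = (3 : ℝ) := Real.mul_self_sqrt (by norm_num)

/-- Being blocked means d + w > (1+√3)d + √3 A; multiply by (√3-1)/2, the inverse of 1+√3. -/
theorem blocked_leg {d A w : ℝ} (h : √3 * (d + A) < w) :
    d + (3 - √3) / 2 * A ≤ (√3 - 1) / 2 * (d + w) := by
  have h1 := sqrt_three_bounds
  have h2 := sqrt_three_sq
  have h3 := mul_nonneg (by linarith : (0 : ℝ) ≤ (√3 - 1) / 2) (sub_nonneg.2 h.le)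
  have h4 : √3 * √3 * (d + A) = 3 * (d + A) := by rw [h2]
  nlinarith

/-- The factor (3-√3)/2 turns (1+√3)d + √3 A into √3 d + (3√3-3)/2 · A, where both coefficients
exceed 1. -/
theorem blocked_leg' {d A w : ℝ} (hd : 0 ≤ d) (hA : 0 ≤ A) (h : √3 * (d + A) < w) :
    d + A ≤ (3 - √3) / 2 * (d + w) := by
  have h1 := sqrt_three_bounds
  have h2 := sqrt_three_sq
  have h3 := mul_nonneg (by linarith : (0 : ℝ) ≤ (3 - √3) / 2) (sub_nonneg.2 h.le)
  have h4 : √3 * √3 * (d + A) = 3 * (d + A) := by rw [h2]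
  have h5 := mul_nonneg (sub_nonneg.2 h1.1.le) hd
  have h6 := mul_nonneg (sub_nonneg.2 h1.1.le) hA
  nlinarith

/-- As for a side leg, with (√3-1)²/2 = 2-√3 as the coefficient of S. -/
theorem blocked_first {d S w : ℝ} (h : √3 * d + (√3 - 1) * S < w) :
    d + (2 - √3) * S ≤ (√3 - 1) / 2 * (d + w) := by
  have h1 := sqrt_three_bounds
  have h2 := sqrt_three_sq
  have h3 := mul_nonneg (by linarith : (0 : ℝ) ≤ (√3 - 1) / 2) (sub_nonneg.2 h.le)
  have h4 : √3 * √3 * d = 3 * d := by rw [h2]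
  have h5 : √3 * √3 * S = 3 * S := by rw [h2]
  nlinarith

theorem blocked_first' {d S w : ℝ} (hd : 0 ≤ d) (hS : 0 ≤ S)
    (h : √3 * d + (√3 - 1) * S < w) :
    (√3 - 1) / 2 * S ≤ (3 - √3) / 2 * (d + w) := by
  have h1 := sqrt_three_bounds
  have h2 := sqrt_three_sq
  have h3 := mul_nonneg (by linarith : (0 : ℝ) ≤ (3 - √3) / 2) (sub_nonneg.2 h.le)
  have h4 : √3 * √3 * d = 3 * d := by rw [h2]
  have h5 : √3 * √3 * S = 3 * S := by rw [h2]
  have h6 := mul_nonneg (sub_nonneg.2 h1.1.le) hd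
  have h7 := mul_nonneg (sub_nonneg.2 h1.1.le) hS
  nlinarith

/-- If the first leg is blocked, then the other two are not. -/
theorem not_blocked_of_blocked_first {d₀ w₀ d d' w w' : ℝ} (hd₀ : 0 ≤ d₀) (hd : 0 ≤ d)
    (hd' : 0 ≤ d') (hw : 0 ≤ w) (hw' : 0 ≤ w')
    (h : √3 * d₀ + (√3 - 1) * ((d + w) + (d' + w')) < w₀) :
    ¬ √3 * (d + (d₀ + w₀)) < w := by
  intro h'
  -- If both were blocked, then w > √3 w₀ ≥ √3(√3-1)w = (3-√3)w, although 3-√3 > 1. The bound 1.7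
  -- for √3 is precise enough, as 1.7 · 0.7 > 1.
  have h1 := sqrt_three_bounds
  have a1 := mul_nonneg (sub_nonneg.2 h1.1.le) hd₀
  have a2 := mul_nonneg (sub_nonneg.2 h1.1.le) hd
  have a3 := mul_nonneg (sub_nonneg.2 h1.1.le) hd'
  have a4 := mul_nonneg (sub_nonneg.2 h1.1.le) hw
  have a5 := mul_nonneg (sub_nonneg.2 h1.1.le) hw'
  have a6 : 0 ≤ w₀ := by nlinarith
  have a7 := mul_nonneg (sub_nonneg.2 h1.1.le) a6
  nlinarith

end Real

/-! ### Accounting for detours, and the end of the exploration -/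

namespace Layout

variable {G : WeightedGraph ι} (L : Layout G)

/-- The total length of the explored part. -/
def tot (n : Fin 3 → ℕ) : ℝ := L.dep 0 (n 0) + L.dep 1 (n 1) + L.dep 2 (n 2)

theorem tot_update (n : Fin 3 → ℕ) (j : Fin 3) :
    L.tot (Function.update n j (n j + 1)) = L.tot n + L.ew j (n j) := by
  unfold tot
  fin_cases j <;> simp [L.dep_succ] <;> ring

theorem tot_mono {n : Fin 3 → ℕ} (hn : ∀ i, n i ≤ L.len i) : L.tot n ≤ L.tot L.len := by
  unfold tot
  have := L.dep_mono (hn 0) le_rfl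
  have := L.dep_mono (hn 1) le_rfl
  have := L.dep_mono (hn 2) le_rfl
  linarith

theorem update_le {n : Fin 3 → ℕ} (hn : ∀ i, n i ≤ L.len i) {j : Fin 3} (hj : n j < L.len j) :
    ∀ i, Function.update n j (n j + 1) i ≤ L.len i := by
  intro i
  by_cases h : i = j
  · subst h; simpa using hj
  · simpa [h] using hn i

theorem sum_update_lt {n : Fin 3 → ℕ} {j : Fin 3} (hj : n j < L.len j) :
    ∑ i, (L.len i - Function.update n j (n j + 1) i) < ∑ i, (L.len i - n i) := by
  refine Finset.sum_lt_sum (fun i _ => ?_) ⟨j, Finset.mem_univ _, ?_⟩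
  · by_cases h : i = j
    · subst h; rw [Function.update_self]; omega
    · simp [h]
  · rw [Function.update_self]; omega

theorem ok_isOpen {heavy : Bool} {n : Fin 3 → ℕ} (hn : ∀ i, n i ≤ L.len i) {i : Fin 3}
    (h : Ok heavy (L.arms n) i) : L.Op n i := (L.isOpen_arms hn i).1 h.1

/-- The distance from `P i k` to the starting vertex, which has distance `h` from the junction and
lies on the leg `0` if `a = h`, but not if `a = 0`. -/
def ret (h a : ℝ) (i : Fin 3) (k : ℕ) : ℝ := L.dep i k + h - if i = 0 then 2 * a else 0

/-- `Completes`, with an upper bound on the cost. -/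
def CompletesIn (b : Bool) (s : ι) (home : List ι) (n : Fin 3 → ℕ) (i : Fin 3) (c : ℝ) : Prop :=
  ∃ c' ≤ c, L.Completes true b s home n i c'

/-- The bound on the remaining cost if the walk so far contained detours of total length `2 * E`. -/
noncomputable def budget (h a : ℝ) (n : Fin 3 → ℕ) (i : Fin 3) (E : ℝ) : ℝ :=
  -- The cost so far is 2 `tot n` - `ret` + 2E: a closed walk around the explored tree, without the
  -- way home, plus the detours. This is subtracted from the target (1+√3) `tot len`.
  (1 + √3) * L.tot L.len + L.ret h a i (n i) - 2 * L.tot n - 2 * E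

variable {L}
variable {b : Bool} {s : ι} {home : List ι} {n : Fin 3 → ℕ} {i j : Fin 3} {h a E : ℝ}

theorem CompletesIn.cross (hp : pick true (L.arms n) i = some i) (hi : n i < L.len i)
    (hc : L.CompletesIn b s home (Function.update n i (n i + 1)) i
      (L.budget h a (Function.update n i (n i + 1)) i E)) :
    L.CompletesIn b s home n i (L.budget h a n i E) := by
  obtain ⟨c, hc, hC⟩ := hc
  refine ⟨_, ?_, hC.cross hp hi⟩
  simp only [budget, ret, Function.update_self, L.dep_succ, L.tot_update] at hc ⊢
  linarith

/-- Reaching the tip of leg `j` again costs its explored length on the way out and once more on the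
way back. The terms with `a` compensate for the part of leg 0 between the junction and the start, on
which `ret` counts the way home differently. -/
theorem CompletesIn.move (hn : ∀ i, n i ≤ L.len i) (hij : j ≠ i)
    (hp : pick true (L.arms n) i = some j) (hj : n j < L.len j) {E' : ℝ}
    (hE : E' = E + L.dep j (n j) + (if i = 0 then a else 0) - if j = 0 then a else 0)
    (hc : L.CompletesIn b s home (Function.update n j (n j + 1)) j
      (L.budget h a (Function.update n j (n j + 1)) j E')) :
    L.CompletesIn b s home n i (L.budget h a n i E) := by
  obtain ⟨c, hc, hC⟩ := hc
  refine ⟨_, ?_, hC.move hn hij hp hj (L.back_arms_true n i ▸ L.trek_down (hn i))⟩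
  simp only [budget, ret, Function.update_self, L.dep_succ, L.tot_update, hE] at hc ⊢
  split_ifs at hc ⊢ <;> linarith

/-- The case that the cycle has been explored. -/
theorem completesIn_of_cycle_explored (hst : L.st ≠ 0) {o : Fin 3 → Prop}
    -- The predicate `o` marks the legs on which the exploration may end. On a leg completed before
    -- the junction was entered, the way home need not have length `ret`.
    (hret : ∀ i, o i → G.Trek (L.P i (L.len i)) (cutAt s (L.down i (L.len i) ++ home)) s
      (L.ret h a i (L.len i))) (N : ℕ) :
    ∀ (n : Fin 3 → ℕ) (i : Fin 3) (E : ℝ), L.len L.st - n L.st = N → (∀ i, n i ≤ L.len i) →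
      (∀ i ≠ L.st, n i = L.len i) → o i → (∀ j, n j < L.len j → o j) →
      -- One more detour is possible: the way to the tip of the unfinished stem.
      E + (if n L.st < L.len L.st ∧ i ≠ L.st then
        L.dep L.st (n L.st) + (if i = 0 then a else 0) else 0) ≤ (√3 - 1) / 2 * L.tot L.len →
      L.CompletesIn b s home n i (L.budget h a n i E) := by
  induction N with
  | zero =>
    intro n i E hN hn hcy hi ho hE
    have hall : n = L.len := by
      funext k
      by_cases hk : k = L.st
      · subst hk; exact le_antisymm (hn _) (by omega)
      · exact hcy k hk
    subst hall
    have hno : ∀ k, ¬ Ok true (L.arms L.len) k := fun k hk => by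
      rcases L.ok_isOpen hn hk with h | ⟨-, h⟩ <;> omega
    have hp : pick true (L.arms L.len) i = none := by
      rcases pick_cases true (L.arms L.len) i with ⟨h1, h2⟩ | ⟨-, h1, h2⟩ | ⟨-, -, h1, h2⟩ |
        ⟨-, -, -, h1, h2⟩ | ⟨-, h1⟩
      exacts [absurd h1 (hno _), absurd h1 (hno _), absurd h1 (hno _), absurd h1 (hno _), h1]
    refine ⟨L.ret h a i (L.len i), ?_, .home hp (fun _ => rfl) ?_⟩
    · simp only [lt_irrefl, false_and, if_false, add_zero] at hE
      unfold budget
      linarith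
    · rw [L.back_arms_true]; exact hret i hi
  | succ N ih =>
    intro n i E hN hn hcy hi ho hE
    have hlt : n L.st < L.len L.st := by omega
    have hop : ∀ k, L.Op n k ↔ k = L.st := by
      intro k
      constructor
      · rintro (h1 | ⟨h1, h2⟩)
        · by_contra hk
          have := hcy k hk; omega
        · have := hcy _ (L.oth_ne h1).2; omega
      · rintro rfl; exact .inl hlt
    have hok : ∀ k, Ok true (L.arms n) k ↔ k = L.st := by
      intro k
      constructor
      · intro hk; exact (hop k).1 (L.ok_isOpen hn hk)
      · rintro rfl
        refine ⟨(L.isOpen_arms hn _).2 ((hop _).2 rfl), .inr (.inr fun j hj hj' => ?_)⟩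
        exact hj ((hop j).1 ((L.isOpen_arms hn _).1 hj'))
    have hp := pick_unique hok i
    have hnext : ∀ E', E' ≤ (√3 - 1) / 2 * L.tot L.len →
        L.CompletesIn b s home (Function.update n L.st (n L.st + 1)) L.st
          (L.budget h a (Function.update n L.st (n L.st + 1)) L.st E') := by
      intro E' hE'
      refine ih _ _ _ ?_ (L.update_le hn hlt) ?_ (ho _ hlt) ?_ ?_
      · rw [Function.update_self]; omega
      · intro k hk; rw [Function.update_of_ne hk]; exact hcy k hk
      · intro k hk
        by_cases hks : k = L.st
        · subst hks; exact ho _ hlt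
        · rw [Function.update_of_ne hks] at hk; exact ho _ hk
      · simpa using hE'
    by_cases his : i = L.st
    · subst his
      refine .cross hp hlt (hnext E ?_)
      simpa using hE
    · refine .move hn (Ne.symm his) hp hlt rfl (hnext _ ?_)
      simp only [hlt, ne_eq, his, not_false_eq_true, and_self, if_true, hst, if_false] at hE ⊢
      linarith

end Layout

/-! ### The invariants of the exploration that avoids the heavy edge -/

namespace Layout

variable {G : WeightedGraph ι} (L : Layout G)

/-- The leg `k` is not a completely explored stem. -/
def Live (n : Fin 3 → ℕ) (k : Fin 3) : Prop := k ≠ L.st ∨ n L.st < L.len L.st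

/-- The cycle has not been explored completely. -/
def CycleOpen (n : Fin 3 → ℕ) : Prop := n 0 < L.len 0 ∨ n (L.oth 0) < L.len (L.oth 0)

open Classical in
/-- The length of the explored part of a leg that is about to be extended. -/
noncomputable def pend (n : Fin 3 → ℕ) (j : Fin 3) : ℝ :=
  if L.Live n j ∧ ¬ Blocked (L.arms n) j then L.dep j (n j) else 0

open Classical in
/-- The length that will be explored on a leg as soon as it is extended, if this is about to
happen. -/
noncomputable def reach (n : Fin 3 → ℕ) (j : Fin 3) : ℝ :=
  if L.Live n j ∧ ¬ Blocked (L.arms n) j then (L.arms n j).full else L.dep j (n j)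

open Classical in
/-- The length of the explored part of a leg that has to be extended at some time. -/
noncomputable def liveDep (n : Fin 3 → ℕ) (j : Fin 3) : ℝ :=
  if L.Live n j then L.dep j (n j) else 0

/-- The invariant while the searcher is on the leg `i`, where `i` and `j` are the legs `1`, `2`. -/
structure InvSide (a : ℝ) (n : Fin 3 → ℕ) (i j : Fin 3) (E : ℝ) : Prop where
  -- The term `pend` charges in advance for the move to leg `j`, and `reach` counts what that move
  -- explores. `first` and `second` prepare the move to leg 0, after which the detours are E + d₀ -
  -- a. `third` is the target inequality for the explored part. `fourth` is a reserve for a final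
  -- move to a blocked stem, to be combined with `blocked_leg`.
  first : E + L.pend n j + L.dep 0 (n 0) ≤ (L.arms n 0).full
  second : E + L.pend n j + L.dep 0 (n 0) - a ≤
    (√3 - 1) / 2 * ((L.arms n 0).full + L.dep i (n i) + L.reach n j)
  third : E + L.pend n j ≤ (√3 - 1) / 2 * (L.dep 0 (n 0) + L.dep i (n i) + L.reach n j)
  fourth : n L.st < L.len L.st → E + L.pend n j ≤ (3 - √3) / 2 * (L.arms n 0).full

/-- The invariant while the searcher is on the leg `0`. -/
structure InvFirst (a : ℝ) (n : Fin 3 → ℕ) (E : ℝ) : Prop where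
  -- On leg 0, the returns to all unfinished side legs are charged in advance. `fourth` and `fifth`
  -- serve the case that the cycle is completed on leg 0: with the stem finished, or with a return
  -- to the stem alone.
  first : E + a + L.liveDep n 1 + L.liveDep n 2 ≤
    (√3 - 1) / 2 * (L.dep 0 (n 0) + (L.arms n 1).full + (L.arms n 2).full)
  second : E + a + L.liveDep n 1 + L.liveDep n 2 ≤
    (3 - √3) / 2 * ((L.arms n 1).full + (L.arms n 2).full)
  third : n L.st < L.len L.st → E + a + L.liveDep n 1 + L.liveDep n 2 ≤
    (√3 - 1) / 2 * ((L.arms n 1).full + (L.arms n 2).full)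
  fourth : E ≤ (√3 - 1) / 2 * (L.dep 0 (n 0) + L.dep 1 (n 1) + L.dep 2 (n 2))
  fifth : n L.st < L.len L.st → E + a + L.dep L.st (n L.st) ≤ (√3 - 1) / 2 *
    (L.dep 0 (n 0) + (L.arms n L.st).full + L.dep (L.oth 0) (n (L.oth 0)))

variable {L}
variable {n : Fin 3 → ℕ} {i j : Fin 3} {a E : ℝ}

/-- While the cycle has an unvisited vertex, both cycle legs lead to one, possibly across the
removed edge. -/
theorem op_iff_live (hst : L.st ≠ 0) (hc : L.CycleOpen n) (k : Fin 3) :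
    L.Op n k ↔ L.Live n k := by
  by_cases hk : k = L.st
  · subst hk; simp [Op, Live]
  · simp only [Op, Live, hk, ne_eq, not_false_eq_true, true_and, true_or, iff_true]
    by_cases h0 : k = 0
    · subst h0; exact hc
    · have := L.eq_oth hk (Ne.symm hst) h0
      rw [← this, ← L.oth_oth (i := k), ← this]
      exact hc.symm

theorem blocked_zero (n : Fin 3 → ℕ) : Blocked (L.arms n) 0 ↔ √3 * L.dep 0 (n 0) +
    (√3 - 1) * ((L.arms n 1).full + (L.arms n 2).full) < (L.arms n 0).w := by
  simp [Blocked, d_arms]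

theorem blocked_side (n : Fin 3 → ℕ) {k : Fin 3} (hk : k ≠ 0) : Blocked (L.arms n) k ↔
    √3 * (L.dep k (n k) + (L.arms n 0).full) < (L.arms n k).w := by
  simp [Blocked, hk, d_arms]

theorem full_eq (n : Fin 3 → ℕ) (k : Fin 3) :
    (L.arms n k).full = L.dep k (n k) + (L.arms n k).w := rfl

theorem w_of_not_live (hn : ∀ i, n i ≤ L.len i) {k : Fin 3} (h : ¬ L.Live n k) :
    (L.arms n k).w = 0 := by
  simp only [Live, not_or, not_not, not_lt] at h
  obtain ⟨rfl, h⟩ := h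
  exact L.w_st (le_antisymm (hn _) h)

theorem exists_live (hst : L.st ≠ 0) (n : Fin 3 → ℕ) : L.Live n (L.oth 0) :=
  .inl (L.oth_ne (Ne.symm hst)).2

theorem oth_zero_cases (hst : L.st ≠ 0) :
    (L.oth 0 = 1 ∧ L.st = 2) ∨ (L.oth 0 = 2 ∧ L.st = 1) := by
  have : ∀ t : Fin 3, t ≠ 0 → (-(0 + t) = 1 ∧ t = 2) ∨ (-(0 + t) = 2 ∧ t = 1) := by decide
  exact this _ hst

/-- While the cycle is open, a leg may be extended if it is live and not blocked. -/
theorem ok_iff (hn : ∀ i, n i ≤ L.len i) (hst : L.st ≠ 0) (hc : L.CycleOpen n) (k : Fin 3) :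
    Ok true (L.arms n) k ↔ L.Live n k ∧ ¬ Blocked (L.arms n) k := by
  unfold Ok
  simp only [L.isOpen_arms hn, op_iff_live hst hc, Bool.true_eq_false, false_or]
  refine and_congr_right fun _ => ⟨?_, .inl⟩
  rintro (h | h)
  · exact h
  · exfalso
    have h0 : L.Live n 0 := .inl (Ne.symm hst)
    by_cases hk : k = 0
    · subst hk
      exact h _ (L.oth_ne (Ne.symm hst)).1 (exists_live hst n)
    · exact h 0 (Ne.symm hk) h0

theorem full_le_dep_len (hn : ∀ i, n i ≤ L.len i) {k : Fin 3}
    (h : n k < L.len k ∨ k = L.st) : (L.arms n k).full ≤ L.dep k (L.len k) := by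
  by_cases h1 : n k < L.len k
  · rw [L.full_arms h1]; exact L.dep_mono h1 le_rfl
  · obtain rfl : k = L.st := by tauto
    rw [full_eq, L.w_st (le_antisymm (hn _) (by omega)), add_zero]
    exact L.dep_mono (hn _) le_rfl

/-- The removed edge is so heavy that crossing it would be too expensive. -/
def Heavy (L : Layout G) : Prop :=
  -- This is (1+√3) `tot len` < `around`, solved for the weight of the removed edge; see
  -- `heavy_of_lt`.
  √3 * (L.dep 0 (L.len 0) + L.dep (L.oth 0) (L.len (L.oth 0))) +
    (√3 - 1) * L.dep L.st (L.len L.st) < G.weight (L.cutEdge 0)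

theorem cutEdge_oth (i : Fin 3) : L.cutEdge (L.oth i) = L.cutEdge i := by
  rw [cutEdge, oth_oth, cutEdge, Sym2.eq_swap]

/-- The removed edge is never crossed. -/
theorem lt_len_of_not_blocked (hn : ∀ i, n i ≤ L.len i) (hst : L.st ≠ 0) (hc : L.CycleOpen n)
    (hh : L.Heavy) {k : Fin 3} (hl : L.Live n k) (hb : ¬ Blocked (L.arms n) k) :
    n k < L.len k := by
  by_contra hlt
  have hk : n k = L.len k := le_antisymm (hn k) (by omega)
  have hks : k ≠ L.st := by
    rintro rfl
    rcases hl with h | h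
    · exact h rfl
    · omega
  have hr := sqrt_three_bounds
  -- At the tip of a cycle leg the boundary edge is the removed edge. All known full lengths on the
  -- right of the threshold are at most the lengths of the legs, so `Heavy` exceeds the threshold.
  apply hb
  unfold Heavy at hh
  by_cases h0 : k = 0
  · subst h0
    rw [blocked_zero, L.w_cut hks hk, hk]
    have h1 : (L.arms n (L.oth 0)).full ≤ L.dep (L.oth 0) (L.len (L.oth 0)) :=
      full_le_dep_len hn (.inl (by rcases hc with h | h; exacts [absurd h hlt, h]))
    have h2 : (L.arms n L.st).full ≤ L.dep L.st (L.len L.st) := full_le_dep_len hn (.inr rfl)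
    have h3 : (L.arms n 1).full + (L.arms n 2).full =
        (L.arms n (L.oth 0)).full + (L.arms n L.st).full := by
      rcases oth_zero_cases hst with ⟨h4, h5⟩ | ⟨h4, h5⟩
      · rw [h4, h5]
      · rw [h4, h5, add_comm]
    rw [h3]
    have h4 : 0 ≤ L.dep (L.oth 0) (L.len (L.oth 0)) := L.dep_nonneg le_rfl
    have h5 := mul_le_mul_of_nonneg_left (add_le_add h1 h2) (by linarith : 0 ≤ √3 - 1)
    linarith
  · obtain rfl : k = L.oth 0 := L.eq_oth (Ne.symm hst) hks (Ne.symm h0)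
    rw [blocked_side n h0, L.w_cut hks hk, cutEdge_oth, hk]
    have h1 : (L.arms n 0).full ≤ L.dep 0 (L.len 0) :=
      full_le_dep_len hn (.inl (by rcases hc with h | h; exacts [h, absurd h hlt]))
    have h2 : 0 ≤ L.dep L.st (L.len L.st) := L.dep_nonneg le_rfl
    have h3 := mul_le_mul_of_nonneg_left h1 (by linarith : 0 ≤ √3)
    have h4 := mul_nonneg (by linarith : 0 ≤ √3 - 1) h2
    linarith

theorem arms_update_of_ne {k : Fin 3} (h : k ≠ j) (m : ℕ) :
    L.arms (Function.update n j m) k = L.arms n k := by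
  simp [arms, Function.update_of_ne h]

/-- The pair consists of the legs `1` and `2`. -/
def Sides (i j : Fin 3) : Prop := (i = 1 ∧ j = 2) ∨ (i = 2 ∧ j = 1)

theorem Sides.ne {i j : Fin 3} (h : Sides i j) : i ≠ 0 ∧ j ≠ 0 ∧ i ≠ j := by
  rcases h with ⟨rfl, rfl⟩ | ⟨rfl, rfl⟩ <;> decide

theorem Sides.symm {i j : Fin 3} (h : Sides i j) : Sides j i := by
  rcases h with ⟨rfl, rfl⟩ | ⟨rfl, rfl⟩
  exacts [.inr ⟨rfl, rfl⟩, .inl ⟨rfl, rfl⟩]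

theorem Sides.sum {i j : Fin 3} (h : Sides i j) (f : Fin 3 → ℝ) : f i + f j = f 1 + f 2 := by
  rcases h with ⟨rfl, rfl⟩ | ⟨rfl, rfl⟩
  exacts [rfl, add_comm _ _]

theorem sum_sides (hst : L.st ≠ 0) (f : Fin 3 → ℝ) : f 1 + f 2 = f (L.oth 0) + f L.st := by
  rcases oth_zero_cases hst with ⟨h4, h5⟩ | ⟨h4, h5⟩
  · rw [h4, h5]
  · rw [h4, h5, add_comm]

theorem live_update_of_ne {k : Fin 3} (h : k ≠ j) :
    L.Live (Function.update n j (n j + 1)) k ↔ L.Live n k := by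
  unfold Live
  by_cases hs : L.st = j
  · subst hs; simp [h]
  · rw [Function.update_of_ne hs]

/-- The threshold of a side leg depends on this leg and on leg 0 only. -/
theorem blocked_update_of_ne {k : Fin 3} (h : k ≠ j) (hk : k ≠ 0) (hj : j ≠ 0) :
    Blocked (L.arms (Function.update n j (n j + 1))) k ↔ Blocked (L.arms n) k := by
  rw [blocked_side _ hk, blocked_side _ hk, arms_update_of_ne h, arms_update_of_ne hj.symm,
    Function.update_of_ne h]

theorem lt_of_update_lt (hj : n j < L.len j)
    (h : Function.update n j (n j + 1) L.st < L.len L.st) : n L.st < L.len L.st := by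
  by_cases hs : L.st = j
  · rw [hs]; exact hj
  · rwa [Function.update_of_ne hs] at h

theorem full_update (hj : n j < L.len j) :
    L.dep j (n j + 1) = (L.arms n j).full := (L.full_arms hj).symm

/-- Only the explored lengths on the right-hand sides grow; `pend` and `reach` of the other side leg
are unaffected. -/
theorem InvSide.cross (h : L.InvSide a n i j E) (hij : Sides i j) (hi : n i < L.len i) :
    L.InvSide a (Function.update n i (n i + 1)) i j E := by
  have hne := hij.ne
  have hp : L.pend (Function.update n i (n i + 1)) j = L.pend n j := by
    unfold pend
    rw [live_update_of_ne hne.2.2.symm, blocked_update_of_ne hne.2.2.symm hne.2.1 hne.1,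
      Function.update_of_ne hne.2.2.symm]
  have hr : L.reach (Function.update n i (n i + 1)) j = L.reach n j := by
    unfold reach
    rw [live_update_of_ne hne.2.2.symm, blocked_update_of_ne hne.2.2.symm hne.2.1 hne.1,
      Function.update_of_ne hne.2.2.symm, arms_update_of_ne hne.2.2.symm]
  have h1 := L.ew_pos hi
  have hs := sqrt_three_bounds
  have h2 := mul_nonneg (by linarith : 0 ≤ (√3 - 1) / 2) h1.le
  have h3 := h.second
  have h4 := h.third
  constructor
  all_goals rw [hp]
  all_goals try rw [hr]
  all_goals try rw [arms_update_of_ne hne.1.symm]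
  all_goals try rw [Function.update_of_ne hne.1.symm]
  all_goals try rw [Function.update_self, L.dep_succ]
  · exact h.first
  · linarith
  · linarith
  · intro h5
    exact h.fourth (lt_of_update_lt hi h5)

/-- The detour was already charged as `pend`, so the left-hand sides keep their values; the leg just
left is blocked or finished, and nothing is pending there. -/
theorem InvSide.move (h : L.InvSide a n i j E) (hij : Sides i j)
    (hi : ¬ (L.Live n i ∧ ¬ Blocked (L.arms n) i)) (hl : L.Live n j)
    (hb : ¬ Blocked (L.arms n) j) (hj : n j < L.len j) :
    L.InvSide a (Function.update n j (n j + 1)) j i (E + L.dep j (n j)) := by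
  have hne := hij.ne
  have hp : L.pend (Function.update n j (n j + 1)) i = 0 := by
    unfold pend
    rw [live_update_of_ne hne.2.2, blocked_update_of_ne hne.2.2 hne.1 hne.2.1, if_neg hi]
  have hr : L.reach (Function.update n j (n j + 1)) i = L.dep i (n i) := by
    unfold reach
    rw [live_update_of_ne hne.2.2, blocked_update_of_ne hne.2.2 hne.1 hne.2.1, if_neg hi,
      Function.update_of_ne hne.2.2]
  have hp' : L.pend n j = L.dep j (n j) := if_pos ⟨hl, hb⟩
  have hr' : L.reach n j = (L.arms n j).full := if_pos ⟨hl, hb⟩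
  have h1 := h.first
  have h2 := h.second
  have h3 := h.third
  have h4 := h.fourth
  rw [hp'] at h1 h2 h3 h4
  rw [hr'] at h2 h3
  constructor
  all_goals rw [hp]
  all_goals try rw [hr]
  all_goals try rw [arms_update_of_ne hne.2.1.symm]
  all_goals try rw [Function.update_of_ne hne.2.1.symm]
  all_goals try rw [Function.update_self, full_update hj]
  · linarith
  · linarith
  · linarith
  · intro h5
    have := h4 (lt_of_update_lt hj h5)
    linarith

theorem dep_facts (hn : ∀ i, n i ≤ L.len i) (k : Fin 3) :
    0 ≤ L.dep k (n k) ∧ 0 ≤ (L.arms n k).w := ⟨L.dep_nonneg (hn k), L.w_nonneg hn k⟩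

/-- Every unfinished side leg is blocked, so by `blocked_leg` its explored length is at most
(√3-1)/2 times its full length minus (3-√3)/2 · A, where A is the full length of leg 0. As E + d₀ ≤
A, the sum works out; with only one unfinished side leg it does so exactly, because (3-√3)/2 +
(√3-1)/2 = 1. -/
theorem InvSide.toFirst (h : L.InvSide a n i j E) (hij : Sides i j) (hn : ∀ i, n i ≤ L.len i)
    (hst : L.st ≠ 0)
    (hi : ¬ (L.Live n i ∧ ¬ Blocked (L.arms n) i)) (hj : ¬ (L.Live n j ∧ ¬ Blocked (L.arms n) j))
    (h0 : n 0 < L.len 0) :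
    L.InvFirst a (Function.update n 0 (n 0 + 1)) (E + L.dep 0 (n 0) - a) := by
  have hne := hij.ne
  have hblk : ∀ k : Fin 3, k ≠ 0 → L.Live n k →
      √3 * (L.dep k (n k) + (L.arms n 0).full) < (L.arms n k).w := by
    intro k hk hl
    rw [← blocked_side n hk]
    by_contra hb
    rcases hij with ⟨rfl, rfl⟩ | ⟨rfl, rfl⟩ <;> fin_cases k <;> tauto
  have hp : L.pend n j = 0 := if_neg hj
  have hr : L.reach n j = L.dep j (n j) := if_neg hj
  have h1 := h.first
  have h2 := h.second
  rw [hp] at h1 h2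
  rw [hr] at h2
  have hs := sqrt_three_bounds
  have A0 : 0 ≤ (L.arms n 0).full := by
    have := dep_facts hn 0; rw [full_eq]; linarith
  have hcl := exists_live hst n
  have ho : L.oth 0 ≠ 0 := (L.oth_ne (Ne.symm hst)).1
  have hc := hblk _ ho hcl
  have hcf := dep_facts hn (L.oth 0)
  have htf := dep_facts hn L.st
  have c1 := blocked_leg hc
  have c2 := blocked_leg' hcf.1 A0 hc
  rw [← full_eq] at c1 c2
  have e1 : L.liveDep n (L.oth 0) = L.dep (L.oth 0) (n (L.oth 0)) := if_pos hcl
  have m1 := mul_nonneg (sub_nonneg.2 hs.1.le) hcf.1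
  have m4 := mul_nonneg (sub_nonneg.2 hs.2.le) A0
  have hu : ∀ k : Fin 3, k ≠ 0 → L.liveDep (Function.update n 0 (n 0 + 1)) k = L.liveDep n k := by
    intro k hk
    unfold liveDep
    rw [live_update_of_ne hk, Function.update_of_ne hk]
  have hA : ∀ k : Fin 3, k ≠ 0 → (L.arms (Function.update n 0 (n 0 + 1)) k).full =
      (L.arms n k).full := fun k hk => by rw [arms_update_of_ne hk]
  have h01 : (1 : Fin 3) ≠ 0 := by decide
  have h02 : (2 : Fin 3) ≠ 0 := by decide
  have hsl := sum_sides hst (L.liveDep n)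
  have hsA := sum_sides hst (fun k => (L.arms n k).full)
  have hd := hij.sum (fun k => L.dep k (n k))
  have hle : (n L.st < L.len L.st ∧ L.liveDep n L.st = L.dep L.st (n L.st) ∧
      √3 * (L.dep L.st (n L.st) + (L.arms n 0).full) < (L.arms n L.st).w) ∨
      (¬ n L.st < L.len L.st ∧ L.liveDep n L.st = 0 ∧ (L.arms n L.st).w = 0) := by
    by_cases hlt : n L.st < L.len L.st
    · exact .inl ⟨hlt, if_pos (.inr hlt), hblk _ hst (.inr hlt)⟩
    · have htl : ¬ L.Live n L.st := by simp [Live, hlt]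
      exact .inr ⟨hlt, if_neg htl, w_of_not_live hn htl⟩
  constructor
  all_goals simp only [hu _ h01, hu _ h02, hA _ h01, hA _ h02, Function.update_self,
    full_update h0, Function.update_of_ne h01, Function.update_of_ne h02, hA _ hst,
    Function.update_of_ne hst, Function.update_of_ne ho]
  · rw [add_assoc _ (L.liveDep n 1), hsl, add_assoc _ (L.arms n 1).full, hsA, e1]
    rcases hle with ⟨hlt, e2, ht⟩ | ⟨hlt, e2, hw⟩
    · have t1 := blocked_leg ht
      rw [← full_eq] at t1
      linarith
    · have m2 := mul_nonneg (sub_nonneg.2 hs.1.le) htf.1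
      rw [full_eq n L.st, hw]
      linarith
  · rw [add_assoc _ (L.liveDep n 1), hsl, hsA, e1]
    rcases hle with ⟨hlt, e2, ht⟩ | ⟨hlt, e2, hw⟩
    · have t2 := blocked_leg' htf.1 A0 ht
      rw [← full_eq] at t2
      linarith
    · have m3 := mul_nonneg (sub_nonneg.2 hs.2.le) htf.1
      rw [full_eq n L.st, hw]
      linarith
  · intro hlt
    rw [add_assoc _ (L.liveDep n 1), hsl, hsA, e1]
    rcases hle with ⟨-, e2, ht⟩ | ⟨hlt', -⟩
    · have t1 := blocked_leg ht
      rw [← full_eq] at t1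
      linarith
    · exact absurd hlt hlt'
  · have : (L.arms n 0).full + L.dep 1 (n 1) + L.dep 2 (n 2) =
      (L.arms n 0).full + L.dep i (n i) + L.dep j (n j) := by linarith
    rw [this]; linarith
  · intro hlt
    rcases hle with ⟨-, e2, ht⟩ | ⟨hlt', -⟩
    · have t1 := blocked_leg ht
      rw [← full_eq] at t1
      linarith
    · exact absurd hlt hlt'

theorem InvFirst.cross (h : L.InvFirst a n E) (hst : L.st ≠ 0) (h0 : n 0 < L.len 0) :
    L.InvFirst a (Function.update n 0 (n 0 + 1)) E := by
  have hu : ∀ k : Fin 3, k ≠ 0 → L.liveDep (Function.update n 0 (n 0 + 1)) k = L.liveDep n k := by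
    intro k hk
    unfold liveDep
    rw [live_update_of_ne hk, Function.update_of_ne hk]
  have hA : ∀ k : Fin 3, k ≠ 0 → (L.arms (Function.update n 0 (n 0 + 1)) k).full =
      (L.arms n k).full := fun k hk => by rw [arms_update_of_ne hk]
  have h01 : (1 : Fin 3) ≠ 0 := by decide
  have h02 : (2 : Fin 3) ≠ 0 := by decide
  have ho : L.oth 0 ≠ 0 := (L.oth_ne (Ne.symm hst)).1
  have h1 := L.ew_pos h0
  have hs := sqrt_three_bounds
  have h2 := mul_nonneg (by linarith : 0 ≤ (√3 - 1) / 2) h1.le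
  have f1 := h.first
  have f4 := h.fourth
  constructor
  all_goals simp only [hu _ h01, hu _ h02, hA _ h01, hA _ h02, Function.update_self,
    L.dep_succ, Function.update_of_ne h01, Function.update_of_ne h02, hA _ hst,
    Function.update_of_ne hst, Function.update_of_ne ho]
  · linarith
  · exact h.second
  · exact h.third
  · linarith
  · intro hlt
    have := h.fifth hlt
    linarith

/-- Since leg 0 is blocked, neither side leg is, so the other side leg becomes pending if
unfinished. Its charge is contained in `InvFirst`. The inequality `second` uses `blocked_first` and
(3-√3)/2 - (2-√3) = (√3-1)/2; `fourth` uses `blocked_first'`. -/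
theorem InvFirst.toSide (h : L.InvFirst a n E) (ha : 0 ≤ a) (hij : Sides i j)
    (hn : ∀ i, n i ≤ L.len i)
    (hb : Blocked (L.arms n) 0) (hl : L.Live n j) (hj : n j < L.len j) :
    L.InvSide a (Function.update n j (n j + 1)) j i (E + L.dep j (n j) + a) := by
  have hne := hij.ne
  have hs := sqrt_three_bounds
  have d0 := dep_facts hn 0
  have di := dep_facts hn i
  have dj := dep_facts hn j
  have hsl := hij.sum (L.liveDep n)
  have hsA := hij.sum (fun k => (L.arms n k).full)
  rw [blocked_zero, ← hsA, full_eq n i, full_eq n j] at hb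
  have hnb := not_blocked_of_blocked_first d0.1 di.1 dj.1 di.2 dj.2 hb
  rw [← full_eq, ← blocked_side n hne.1] at hnb
  rw [← full_eq, ← full_eq] at hb
  have b1 := blocked_first hb
  have b2 := blocked_first' d0.1 (by rw [full_eq, full_eq]; linarith) hb
  rw [← full_eq] at b1 b2
  have ej : L.liveDep n j = L.dep j (n j) := if_pos hl
  have hpr : L.pend (Function.update n j (n j + 1)) i = L.liveDep n i ∧
      L.reach (Function.update n j (n j + 1)) i = (L.arms n i).full := by
    unfold pend reach liveDep
    rw [live_update_of_ne hne.2.2, blocked_update_of_ne hne.2.2 hne.1 hne.2.1,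
      Function.update_of_ne hne.2.2, arms_update_of_ne hne.2.2]
    by_cases hli : L.Live n i
    · simp [hli, hnb]
    · rw [full_eq, w_of_not_live hn hli]; simp [hli]
  have f1 := h.first
  have f2 := h.second
  have f3 := h.third
  have m1 : 0 ≤ (√3 - 1.7) * L.dep 0 (n 0) := mul_nonneg (sub_nonneg.2 hs.1.le) d0.1
  have hS : 0 ≤ (L.arms n i).full + (L.arms n j).full := by rw [full_eq, full_eq]; linarith
  have m2 := mul_nonneg (sub_nonneg.2 hs.1.le) hS
  have m3 := mul_nonneg (sub_nonneg.2 hs.2.le) hS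
  rw [add_assoc _ (L.liveDep n 1), ← hsl, ej] at f1 f2 f3
  rw [add_assoc _ (L.arms n 1).full, ← hsA] at f1
  rw [← hsA] at f2 f3
  have hb' : √3 * L.dep 0 (n 0) + (√3 - 1) * ((L.arms n i).full + (L.arms n j).full) +
      L.dep 0 (n 0) < (L.arms n 0).full := by rw [full_eq n 0]; linarith
  constructor
  all_goals rw [hpr.1]
  all_goals try rw [hpr.2]
  all_goals try rw [arms_update_of_ne hne.2.1.symm]
  all_goals try rw [Function.update_of_ne hne.2.1.symm]
  all_goals try rw [Function.update_self, full_update hj]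
  · linarith
  · linarith
  · linarith
  · intro hlt
    have := f3 (lt_of_update_lt hj hlt)
    linarith

/-- Here `j` is the stem. If it is blocked, `fourth` and `blocked_leg` pay for the last detour; if
it is not, that detour is pending in `third`; if the stem is finished, `third` is the claim up to
monotonicity. -/
theorem InvSide.explored (h : L.InvSide a n i j E) (hij : Sides i j) (hn : ∀ i, n i ≤ L.len i)
    (hi : i ≠ L.st) (hst : L.st ≠ 0) :
    E + (if n L.st < L.len L.st ∧ i ≠ L.st then
        L.dep L.st (n L.st) + (if i = 0 then a else 0) else 0) ≤ (√3 - 1) / 2 * L.tot L.len := by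
  have hne := hij.ne
  have hj : L.st = j := by
    rcases hij with ⟨rfl, rfl⟩ | ⟨rfl, rfl⟩ <;> revert hi hst <;> generalize L.st = t <;>
      revert t <;> decide
  have hs := sqrt_three_bounds
  have hd := hij.sum (fun k => L.dep k (n k))
  have hm := mul_le_mul_of_nonneg_left (L.tot_mono hn) (by linarith : 0 ≤ (√3 - 1) / 2)
  unfold tot at hm
  have dj := dep_facts hn j
  have di := dep_facts hn i
  have d0 := dep_facts hn 0
  have f3 := h.third
  by_cases hlt : n L.st < L.len L.st
  · simp only [hlt, hi, hne.1, ne_eq, not_false_eq_true, and_self, if_true, if_false, add_zero]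
    have hl : L.Live n j := .inr hlt
    have htot : L.dep 0 (n 0) + L.dep i (n i) + (L.arms n j).full ≤ L.tot L.len := by
      have h1 := L.tot_mono (L.update_le hn hlt)
      rw [L.tot_update, hj, ← L.w_arms (hj ▸ hlt)] at h1
      rw [full_eq]
      unfold tot at h1 ⊢
      linarith
    have hm' := mul_le_mul_of_nonneg_left htot (by linarith : 0 ≤ (√3 - 1) / 2)
    have f4 := h.fourth hlt
    rw [hj]
    by_cases hb : Blocked (L.arms n) j
    · have hp : L.pend n j = 0 := if_neg (by tauto)
      rw [hp] at f4
      rw [blocked_side n hne.2.1] at hb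
      have := blocked_leg hb
      rw [← full_eq] at this
      have := mul_nonneg (by linarith : 0 ≤ (√3 - 1) / 2) (add_nonneg d0.1 di.1)
      linarith
    · have hp : L.pend n j = L.dep j (n j) := if_pos ⟨hl, hb⟩
      have hr : L.reach n j = (L.arms n j).full := if_pos ⟨hl, hb⟩
      rw [hp, hr] at f3
      linarith
  · have hl : ¬ L.Live n j := by rw [← hj]; simp [Live, hlt]
    have hp : L.pend n j = 0 := if_neg (by tauto)
    have hr : L.reach n j = L.dep j (n j) := if_neg (by tauto)
    simp only [hlt, false_and, if_false]
    rw [hp, hr] at f3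
    unfold tot
    have : L.dep 0 (n 0) + L.dep i (n i) + L.dep j (n j) =
      L.dep 0 (n 0) + L.dep 1 (n 1) + L.dep 2 (n 2) := by linarith
    rw [this] at f3
    linarith

theorem InvFirst.explored (h : L.InvFirst a n E) (hn : ∀ i, n i ≤ L.len i) (hst : L.st ≠ 0) :
    E + (if n L.st < L.len L.st ∧ (0 : Fin 3) ≠ L.st then
        L.dep L.st (n L.st) + (if (0 : Fin 3) = 0 then a else 0) else 0) ≤
      (√3 - 1) / 2 * L.tot L.len := by
  have hs := sqrt_three_bounds
  by_cases hlt : n L.st < L.len L.st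
  · simp only [hlt, hst.symm, ne_eq, not_false_eq_true, and_self, if_true]
    have h1 := L.tot_mono (L.update_le hn hlt)
    rw [L.tot_update, ← L.w_arms hlt] at h1
    have hsd := sum_sides hst (fun k => L.dep k (n k))
    have f5 := h.fifth hlt
    rw [full_eq] at f5
    have hm := mul_le_mul_of_nonneg_left h1 (by linarith : 0 ≤ (√3 - 1) / 2)
    have : L.dep 0 (n 0) + (L.dep L.st (n L.st) + (L.arms n L.st).w) +
        L.dep (L.oth 0) (n (L.oth 0)) = L.tot n + (L.arms n L.st).w := by unfold tot; linarith
    rw [this] at f5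
    linarith
  · simp only [hlt, false_and, if_false]
    have f4 := h.fourth
    have hm := mul_le_mul_of_nonneg_left (L.tot_mono hn) (by linarith : 0 ≤ (√3 - 1) / 2)
    unfold tot at hm ⊢
    linarith

/-- If the removed edge is heavy, then the total length of the detours is small. -/
theorem completesIn_of_inv {b : Bool} {s : ι} {home : List ι} {h : ℝ} (ha : 0 ≤ a)
    (hst : L.st ≠ 0) (hh : L.Heavy) {o : Fin 3 → Prop}
    (hret : ∀ i, o i → G.Trek (L.P i (L.len i)) (cutAt s (L.down i (L.len i) ++ home)) s
      (L.ret h a i (L.len i))) (N : ℕ) :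
    ∀ (n : Fin 3 → ℕ) (i : Fin 3) (E : ℝ), ∑ k, (L.len k - n k) = N → (∀ i, n i ≤ L.len i) →
      o i → (∀ j, n j < L.len j → o j) → (L.CycleOpen n ∨ i ≠ L.st) →
      ((i = 0 ∧ L.InvFirst a n E) ∨ ∃ j, Sides i j ∧ L.InvSide a n i j E) →
      L.CompletesIn b s home n i (L.budget h a n i E) := by
  induction N using Nat.strong_induction_on with
  | _ N ih =>
  intro n i E hN hn hi ho hci hinv
  by_cases hc : L.CycleOpen n
  swap
  -- The cycle is explored, and at most the stem remains.
  · have his := hci.resolve_left hc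
    refine completesIn_of_cycle_explored hst hret _ n i E rfl hn ?_ hi ho ?_
    · intro k hk
      have := hn k
      simp only [CycleOpen, not_or, not_lt] at hc
      by_cases h0 : k = 0
      · subst h0; exact le_antisymm this hc.1
      · obtain rfl := L.eq_oth (Ne.symm hst) hk (Ne.symm h0)
        exact le_antisymm this hc.2
    · rcases hinv with ⟨rfl, hF⟩ | ⟨j, hij, hS⟩
      · exact hF.explored hn hst
      · exact hS.explored hij hn his hst
  have hlt : ∀ k, Ok true (L.arms n) k → n k < L.len k := fun k hk =>
    lt_len_of_not_blocked hn hst hc hh ((ok_iff hn hst hc k).1 hk).1 ((ok_iff hn hst hc k).1 hk).2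
  have next : ∀ (k : Fin 3) (E' : ℝ), n k < L.len k →
      ((k = 0 ∧ L.InvFirst a (Function.update n k (n k + 1)) E') ∨
        ∃ j, Sides k j ∧ L.InvSide a (Function.update n k (n k + 1)) k j E') →
      L.CompletesIn b s home (Function.update n k (n k + 1)) k
        (L.budget h a (Function.update n k (n k + 1)) k E') := by
    intro k E' hk hinv'
    refine ih _ (hN ▸ L.sum_update_lt hk) _ _ _ rfl (L.update_le hn hk) (ho k hk) ?_ ?_ hinv'
    · intro m hm
      by_cases hmk : m = k
      · subst hmk; exact ho m hk
      · rw [Function.update_of_ne hmk] at hm; exact ho m hm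
    · by_cases hks : k = L.st
      · left
        have hne := L.oth_ne (Ne.symm hst)
        subst hks
        unfold CycleOpen
        rw [Function.update_of_ne (Ne.symm hst), Function.update_of_ne hne.2]
        exact hc
      · exact .inr hks
  have hok := ok_iff hn hst hc
  have hsides : ∀ k : Fin 3, k ≠ 0 → ∃ j, Sides j k := by
    unfold Sides; decide
  rcases pick_cases true (L.arms n) i with ⟨h1, hp⟩ | ⟨hi', h1, hp⟩ | ⟨hi', h1', h1, hp⟩ |
    ⟨hi', h1', h2', h1, hp⟩ | ⟨h1, -⟩
  · refine .cross hp (hlt _ h1) (next _ _ (hlt _ h1) ?_)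
    rcases hinv with ⟨rfl, hF⟩ | ⟨j, hij, hS⟩
    · exact .inl ⟨rfl, hF.cross hst (hlt _ h1)⟩
    · exact .inr ⟨j, hij, hS.cross hij (hlt _ h1)⟩
  · have hne : (1 : Fin 3) ≠ i := by rintro rfl; exact hi' h1
    rcases hinv with ⟨rfl, hF⟩ | ⟨j, hij, hS⟩
    · obtain ⟨k, hk⟩ := hsides 1 (by decide)
      have hb : Blocked (L.arms n) 0 := by
        by_contra hb; exact hi' ((hok 0).2 ⟨.inl (Ne.symm hst), hb⟩)
      refine .move hn hne hp (hlt _ h1) (E' := E + L.dep 1 (n 1) + a) (by simp)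
        (next _ _ (hlt _ h1) (.inr ⟨k, hk.symm, ?_⟩))
      exact hF.toSide ha hk hn hb ((hok 1).1 h1).1 (hlt _ h1)
    · obtain rfl : j = 1 := by
        rcases hij with ⟨rfl, rfl⟩ | ⟨rfl, rfl⟩
        · exact absurd rfl hne
        · rfl
      refine .move hn hne hp (hlt _ h1) (E' := E + L.dep 1 (n 1)) (by simp [hij.ne.1])
        (next _ _ (hlt _ h1) (.inr ⟨i, hij.symm, ?_⟩))
      exact hS.move hij (fun hx => hi' ((hok i).2 hx)) ((hok 1).1 h1).1 ((hok 1).1 h1).2 (hlt _ h1)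
  · have hne : (2 : Fin 3) ≠ i := by rintro rfl; exact hi' h1
    rcases hinv with ⟨rfl, hF⟩ | ⟨j, hij, hS⟩
    · obtain ⟨k, hk⟩ := hsides 2 (by decide)
      have hb : Blocked (L.arms n) 0 := by
        by_contra hb; exact hi' ((hok 0).2 ⟨.inl (Ne.symm hst), hb⟩)
      refine .move hn hne hp (hlt _ h1) (E' := E + L.dep 2 (n 2) + a) (by simp)
        (next _ _ (hlt _ h1) (.inr ⟨k, hk.symm, ?_⟩))
      exact hF.toSide ha hk hn hb ((hok 2).1 h1).1 (hlt _ h1)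
    · obtain rfl : j = 2 := by
        rcases hij with ⟨rfl, rfl⟩ | ⟨rfl, rfl⟩
        · rfl
        · exact absurd rfl hne
      refine .move hn hne hp (hlt _ h1) (E' := E + L.dep 2 (n 2)) (by simp [hij.ne.1])
        (next _ _ (hlt _ h1) (.inr ⟨i, hij.symm, ?_⟩))
      exact hS.move hij (fun hx => hi' ((hok i).2 hx)) ((hok 2).1 h1).1 ((hok 2).1 h1).2 (hlt _ h1)
  · have hne : (0 : Fin 3) ≠ i := by rintro rfl; exact hi' h1
    rcases hinv with ⟨rfl, hF⟩ | ⟨j, hij, hS⟩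
    · exact absurd rfl hne
    · refine .move hn hne hp (hlt _ h1) (E' := E + L.dep 0 (n 0) - a) (by simp [hij.ne.1])
        (next _ _ (hlt _ h1) (.inl ⟨rfl, ?_⟩))
      refine hS.toFirst hij hn hst (fun hx => hi' ((hok i).2 hx)) (fun hx => ?_) (hlt _ h1)
      have := (hok j).2 hx
      rcases hij with ⟨rfl, rfl⟩ | ⟨rfl, rfl⟩
      exacts [h2' this, h1' this]
  -- Leg 0 and the other cycle leg are unfinished as long as the cycle is, and they cannot both be
  -- blocked.
  · exfalso
    have hblk : ∀ k, L.Live n k → Blocked (L.arms n) k := fun k hk => by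
      by_contra hb; exact h1 k ((hok k).2 ⟨hk, hb⟩)
    have hb0 := hblk 0 (.inl (Ne.symm hst))
    have hbc := hblk _ (exists_live hst n)
    rw [blocked_side n (L.oth_ne (Ne.symm hst)).1] at hbc
    obtain ⟨k, hk⟩ := hsides _ (L.oth_ne (Ne.symm hst)).1
    have hsA := hk.symm.sum (fun k => (L.arms n k).full)
    rw [blocked_zero, ← hsA, full_eq n k, full_eq n (L.oth 0)] at hb0
    rw [full_eq n 0] at hbc
    have d0 := dep_facts hn 0
    have di := dep_facts hn k
    have dj := dep_facts hn (L.oth 0)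
    exact not_blocked_of_blocked_first d0.1 dj.1 di.1 dj.2 di.2 hb0 hbc

end Layout

/-! ### Going around the cycle -/

namespace Layout

variable {G : WeightedGraph ι} {L : Layout G}
variable {b : Bool} {s : ι} {home : List ι} {n : Fin 3 → ℕ} {i j : Fin 3} {c : ℝ}

theorem ok_false_iff (hn : ∀ i, n i ≤ L.len i) (k : Fin 3) :
    Ok false (L.arms n) k ↔ L.Op n k := by
  simp [Ok, L.isOpen_arms hn]

theorem pick_false_self (hn : ∀ i, n i ≤ L.len i) (h : L.Op n i) :
    pick false (L.arms n) i = some i := by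
  rcases pick_cases false (L.arms n) i with ⟨-, h2⟩ | ⟨h1, -⟩ | ⟨h1, -⟩ | ⟨h1, -⟩ | ⟨h1, -⟩
  · exact h2
  · exact absurd ((ok_false_iff hn i).2 h) h1
  · exact absurd ((ok_false_iff hn i).2 h) h1
  · exact absurd ((ok_false_iff hn i).2 h) h1
  · exact absurd ((ok_false_iff hn i).2 h) (h1 i)

theorem pick_false_len (i : Fin 3) : pick false (L.arms L.len) i = none := by
  have hno : ∀ k, ¬ Ok false (L.arms L.len) k := fun k hk => by
    rcases (ok_false_iff (fun _ => le_rfl) k).1 hk with h | ⟨-, h⟩ <;> omega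
  rcases pick_cases false (L.arms L.len) i with ⟨h1, -⟩ | ⟨-, h1, -⟩ | ⟨-, -, h1, -⟩ |
    ⟨-, -, -, h1, -⟩ | ⟨-, h1⟩
  exacts [absurd h1 (hno _), absurd h1 (hno _), absurd h1 (hno _), absurd h1 (hno _), h1]

theorem pick_false_two (hn : ∀ i, n i ≤ L.len i) (h1 : ¬ L.Op n 1) (h2 : L.Op n 2) :
    pick false (L.arms n) 1 = some 2 := by
  rw [← ok_false_iff hn] at h1 h2
  simp [pick, h1, h2]

/-- Walking on to the tip of a leg. -/
theorem Completes.run (hn : ∀ i, n i ≤ L.len i)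
    (hc : L.Completes false b s home (Function.update n i (L.len i)) i c) :
    L.Completes false b s home n i (L.dep i (L.len i) - L.dep i (n i) + c) := by
  obtain ⟨N, hN⟩ : ∃ N, L.len i - n i = N := ⟨_, rfl⟩
  induction N generalizing n with
  | zero =>
    have : n i = L.len i := le_antisymm (hn i) (by omega)
    rw [← this, Function.update_eq_self] at hc
    rw [this]
    exact hc.of_eq (by ring)
  | succ N ih =>
    have hi : n i < L.len i := by omega
    refine ((ih (L.update_le hn hi) ?_ ?_).cross (pick_false_self hn (.inl hi)) hi).of_eq ?_
    · rwa [Function.update_idem]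
    · rw [Function.update_self]; omega
    · rw [Function.update_self, L.dep_succ]; ring

theorem back_false_of_none (h : L.bdAt i (n i) = none) :
    back false (L.arms n) i = L.down i (n i) := by
  simp [back, arms, armAt, h]

theorem back_false_of_cut (hi : i ≠ 0) (his : i ≠ L.st) (hst : L.st ≠ 0)
    (h : n i = L.len i) (h0 : n 0 = L.len 0) :
    back false (L.arms n) i = L.P 0 (L.len 0) :: L.down 0 (L.len 0) := by
  have : L.oth i = 0 := (L.eq_oth his (Ne.symm hst) hi).symm
  have hbd : L.bdAt i (n i) = some (L.P 0 (L.len 0), G.weight s(L.P i (n i), L.P 0 (L.len 0))) := by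
    rw [bdAt, h, L.nx_len his, this]; rfl
  rw [back, if_pos]
  · simp [arms, armAt, h0]
  · exact ⟨rfl, hi, _, by simp only [arms, armAt]; exact hbd, by simp [arms, armAt, h0]⟩

theorem trek_cut (hi : i ≠ L.st) :
    G.Trek (L.P i (L.len i)) [L.P (L.oth i) (L.len (L.oth i))] (L.P (L.oth i) (L.len (L.oth i)))
      (G.weight (L.cutEdge i)) :=
  .single (L.adj_nx le_rfl (L.nx_len hi))

theorem eq_len {m : Fin 3 → ℕ} (h0 : m 0 = L.len 0) (h1 : m 1 = L.len 1) (h2 : m 2 = L.len 2) :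
    m = L.len := by
  funext k
  fin_cases k
  exacts [h0, h1, h2]

/-- Going around the cycle, when the stem is entered first. -/
theorem completes_of_stem_first (hst : L.st = 1) (hs : s = L.P 0 (L.len 0))
    (hhome : L.len 2 = 0 → home = [s]) (hn0 : n 0 = L.len 0) (hn1 : n 1 = 0) (hn2 : n 2 = 0) :
    L.Completes false b s home n 1
      (2 * L.dep 1 (L.len 1) + L.dep 2 (L.len 2) + G.weight (L.cutEdge 0)) := by
  have hn : ∀ i, n i ≤ L.len i := by
    intro k; fin_cases k
    · exact hn0.le
    · exact hn1.le.trans (Nat.zero_le _)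
    · exact hn2.le.trans (Nat.zero_le _)
  have ho0 : L.oth 0 = 2 := by rw [oth, hst]; decide
  have ho2 : L.oth 2 = 0 := by rw [oth, hst]; decide
  have hce : L.cutEdge 2 = L.cutEdge 0 := by rw [← ho0, cutEdge_oth]
  have h2s : (2 : Fin 3) ≠ L.st := by rw [hst]; decide
  have h0s : (0 : Fin 3) ≠ L.st := by rw [hst]; decide
  have h21 : (2 : Fin 3) ≠ 1 := by decide
  have h01 : (0 : Fin 3) ≠ 1 := by decide
  have h02 : (0 : Fin 3) ≠ 2 := by decide
  have hb1 : ∀ m : Fin 3 → ℕ, m 1 = L.len 1 → back false (L.arms m) 1 = L.down 1 (L.len 1) := by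
    intro m hm
    rw [← hm]
    refine back_false_of_none ?_
    rw [bdAt, hm]
    have := L.nx_st
    rw [hst] at this
    rw [this]; rfl
  have htc := L.trek_cut h2s
  rw [ho2, ← hs, hce] at htc
  suffices h : L.Completes false b s home (Function.update n 1 (L.len 1)) 1
      (L.dep 1 (L.len 1) + L.dep 2 (L.len 2) + G.weight (L.cutEdge 0)) by
    refine (h.run hn).of_eq ?_
    rw [hn1, L.dep_zero]; ring
  set m := Function.update n 1 (L.len 1) with hm
  have m0 : m 0 = L.len 0 := by rw [hm, Function.update_of_ne h01, hn0]
  have m1 : m 1 = L.len 1 := by rw [hm, Function.update_self]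
  have m2 : m 2 = 0 := by rw [hm, Function.update_of_ne h21, hn2]
  have hmle : ∀ i, m i ≤ L.len i := by
    intro k; fin_cases k
    · exact m0.le
    · exact m1.le
    · exact m2.le.trans (Nat.zero_le _)
  -- If leg 2 is empty, the removed edge joins the junction to `s`, and the tour closes directly
  -- after the stem by means of `hhome`.
  rcases Nat.eq_zero_or_pos (L.len 2) with h2 | h2
  · have hml : m = L.len := eq_len m0 m1 (m2.trans h2.symm)
    rw [hml]
    refine .home (pick_false_len 1) (fun _ => rfl) ?_
    have hc02 := L.len_cy 0 2 h02 h0s h2s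
    have hnd : s ∉ L.down 1 (L.len 1) := by
      rw [L.mem_down]
      rintro ⟨k, hk, he⟩
      rw [hs] at he
      have := L.P_ne hk.le le_rfl h01.symm he
      omega
    rw [hb1 _ rfl, hhome h2, cutAt_append hnd, cutAt_cons_self]
    refine ((L.trek_down le_rfl).append (c' := G.weight (L.cutEdge 0)) ?_).of_eq ?_
    · have := htc
      rw [h2, L.P_zero] at this
      exact this
    · rw [h2, L.dep_zero]; ring
  · have hop1 : ¬ L.Op m 1 := by
      rintro (h | ⟨h, -⟩)
      · omega
      · exact h hst.symm
    have hp := pick_false_two hmle hop1 (.inl (by omega))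
    refine (Completes.move (c₁ := L.dep 1 (L.len 1)) hmle h21 hp (by omega) ?_ (.run
      (L.update_le hmle (by omega)) (c := G.weight (L.cutEdge 0)) ?_)).of_eq ?_
    · rw [hb1 m m1, m1]; exact L.trek_down le_rfl
    · rw [Function.update_idem, eq_len (m := Function.update m 2 (L.len 2))
        (by rw [Function.update_of_ne h02, m0]) (by rw [Function.update_of_ne h21.symm, m1])
        (by rw [Function.update_self])]
      refine .home (pick_false_len 2) (fun _ => rfl) ?_
      rw [back_false_of_cut (by decide) h2s (Ne.symm h0s) rfl rfl, ← hs, List.cons_append,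
        cutAt_cons_self]
      exact htc
    · rw [Function.update_self, m2, L.dep_zero, L.dep_succ, L.dep_zero]; ring

/-- Going around the cycle, when the cycle is entered first: the start is the junction. -/
theorem completes_of_cycle_first (hst : L.st = 2) (h0 : L.len 0 = 0)
    (hn0 : n 0 = 0) (hn1 : n 1 = 0) (hn2 : n 2 = 0) :
    L.Completes false b L.J [] n 1
      (2 * L.dep 2 (L.len 2) + L.dep 1 (L.len 1) + G.weight (L.cutEdge 0)) := by
  have hn : ∀ i, n i ≤ L.len i := by
    intro k; fin_cases k
    · exact hn0.le.trans (Nat.zero_le _)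
    · exact hn1.le.trans (Nat.zero_le _)
    · exact hn2.le.trans (Nat.zero_le _)
  have ho0 : L.oth 0 = 1 := by rw [oth, hst]; decide
  have ho1 : L.oth 1 = 0 := by rw [oth, hst]; decide
  have hce : L.cutEdge 1 = L.cutEdge 0 := by rw [← ho0, cutEdge_oth]
  have h1s : (1 : Fin 3) ≠ L.st := by rw [hst]; decide
  have h0s : (0 : Fin 3) ≠ L.st := by rw [hst]; decide
  have h21 : (2 : Fin 3) ≠ 1 := by decide
  have h01 : (0 : Fin 3) ≠ 1 := by decide
  have h02 : (0 : Fin 3) ≠ 2 := by decide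
  have htc := L.trek_cut h1s
  rw [ho1, hce, h0, L.P_zero] at htc
  have hl2 : 0 < L.len 2 := by have := L.len_st; rw [hst] at this; exact this
  suffices h : L.Completes false b L.J [] (Function.update n 1 (L.len 1)) 1
      (2 * L.dep 2 (L.len 2) + G.weight (L.cutEdge 0)) by
    refine (h.run hn).of_eq ?_
    rw [hn1, L.dep_zero]; ring
  set m := Function.update n 1 (L.len 1) with hm
  have m0 : m 0 = L.len 0 := by rw [hm, Function.update_of_ne h01, hn0, h0]
  have m1 : m 1 = L.len 1 := by rw [hm, Function.update_self]
  have m2 : m 2 = 0 := by rw [hm, Function.update_of_ne h21, hn2]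
  have hmle : ∀ i, m i ≤ L.len i := by
    intro k; fin_cases k
    · exact m0.le
    · exact m1.le
    · exact m2.le.trans (Nat.zero_le _)
  have hop1 : ¬ L.Op m 1 := by
    rintro (h | ⟨-, h⟩)
    · omega
    · rw [ho1] at h; omega
  have hp := pick_false_two hmle hop1 (.inl (by omega))
  -- Leg 0 is empty, so the way back to the junction is the removed edge alone; the stem follows.
  refine (Completes.move (c₁ := G.weight (L.cutEdge 0)) hmle h21 hp (by omega) ?_ (.run
    (L.update_le hmle (by omega)) (c := L.dep 2 (L.len 2)) ?_)).of_eq ?_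
  · rw [back_false_of_cut (by decide) h1s (Ne.symm h0s) m1 m0, h0, m1, L.P_zero]
    exact htc
  · rw [Function.update_idem, eq_len (m := Function.update m 2 (L.len 2))
      (by rw [Function.update_of_ne h02, m0]) (by rw [Function.update_of_ne h21.symm, m1])
      (by rw [Function.update_self])]
    refine .home (pick_false_len 2) (fun _ => rfl) ?_
    have hb2 : back false (L.arms L.len) 2 = L.down 2 (L.len 2) := by
      refine back_false_of_none ?_
      have := L.nx_st
      rw [hst] at this
      rw [bdAt, this]; rfl
    rw [hb2]
    have := L.trek_cutAt_down hl2 le_rfl []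
    rw [L.P_zero, L.dep_zero, sub_zero] at this
    exact this
  · rw [Function.update_self, m2, L.dep_zero, L.dep_succ, L.dep_zero]; ring

/-- Going around the cycle, when the stem has already been explored. -/
theorem completes_of_stem_explored {h : ℝ} (hst : L.st = 2) (h0 : L.len 0 = 0) (hs : s ≠ L.J)
    (hhome : G.Trek L.J (cutAt s home) s h)
    (hn0 : n 0 = 0) (hn1 : n 1 = 0) (hn2 : n 2 = L.len 2) :
    L.Completes false b s home n 1 (L.dep 1 (L.len 1) + G.weight (L.cutEdge 0) + h) := by
  have hn : ∀ i, n i ≤ L.len i := by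
    intro k; fin_cases k
    · exact hn0.le.trans (Nat.zero_le _)
    · exact hn1.le.trans (Nat.zero_le _)
    · exact hn2.le
  have ho0 : L.oth 0 = 1 := by rw [oth, hst]; decide
  have ho1 : L.oth 1 = 0 := by rw [oth, hst]; decide
  have hce : L.cutEdge 1 = L.cutEdge 0 := by rw [← ho0, cutEdge_oth]
  have h1s : (1 : Fin 3) ≠ L.st := by rw [hst]; decide
  have h0s : (0 : Fin 3) ≠ L.st := by rw [hst]; decide
  have htc := L.trek_cut h1s
  rw [ho1, hce, h0, L.P_zero] at htc
  suffices h : L.Completes false b s home (Function.update n 1 (L.len 1)) 1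
      (G.weight (L.cutEdge 0) + h) by
    refine (h.run hn).of_eq ?_
    rw [hn1, L.dep_zero]; ring
  rw [eq_len (L := L) (m := Function.update n 1 (L.len 1)) (by simp [hn0, h0]) (by simp)
    (by simp [hn2])]
  refine .home (pick_false_len 1) (fun _ => rfl) ?_
  rw [back_false_of_cut (by decide) h1s (Ne.symm h0s) rfl rfl, h0, L.P_zero, List.cons_append,
    cutAt_cons_ne (Ne.symm hs)]
  exact (htc.append hhome)

end Layout

/-! ### The walk up to the arrival at the junction -/

theorem updWalk_of_some {heavy : Bool} {s : ι} {trail : List ι} {d : ℝ} {behind : Option (ι × ℝ)}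
    {o : Observation ι} {p : ι × ℝ} (h : ¬ ∃ e : Fin 3 → ι × ℝ, Lists e o.incident)
    (ho : other o.incident trail.head? = some p) :
    updWalk heavy s trail d behind o = (.walk s (o.vertex :: trail) d p behind, [p.1]) := by
  unfold updWalk
  rw [dif_neg h, ho]

theorem updWalk_of_none {heavy : Bool} {s : ι} {trail : List ι} {d : ℝ} {p : ι × ℝ}
    {o : Observation ι} (h : ¬ ∃ e : Fin 3 → ι × ℝ, Lists e o.incident)
    (ho : other o.incident trail.head? = none) :
    updWalk heavy s trail d (some p) o =
      (.walk s (o.vertex :: trail).reverse d p none, trail ++ [p.1]) := by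
  unfold updWalk
  rw [dif_neg h, ho]

namespace Layout

variable {G : WeightedGraph ι} (L : Layout G)

theorem bdAt_zero_isSome (i : Fin 3) : (L.bdAt i 0).isSome := by
  simp [bdAt, L.nx_zero_isSome i]

theorem exists_lists : ∃ e : Fin 3 → ι × ℝ, Lists e (G.observe L.J).incident := by
  refine ⟨fun i => (L.bdAt i 0).get (L.bdAt_zero_isSome i), fun i j h => ?_, ?_⟩
  · by_contra hij
    have h1 : L.bdAt i 0 = L.bdAt j 0 := by
      have h' : (L.bdAt i 0).get _ = (L.bdAt j 0).get _ := h
      rw [← Option.some_get (L.bdAt_zero_isSome i), h', Option.some_get]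
    apply L.nx_zero_ne hij
    have := congrArg (Option.map Prod.fst) h1
    simpa [bdAt, Option.map_map, Function.comp_def] using this
  · ext p
    rw [J, L.mem_observe (Nat.zero_le _)]
    constructor
    · rintro ⟨i, hi⟩
      have hi : L.bdAt i 0 = some p := by rw [← hi, Option.some_get]
      simp only [bdAt, Option.map_eq_some_iff] at hi
      obtain ⟨u, hu, rfl⟩ := hi
      exact ⟨.inr (.inr ⟨rfl, i, hu⟩), by rw [L.root i 0]⟩
    · rintro ⟨h, h2⟩
      have : ∃ j, L.nx j 0 = some p.1 := by
        rcases h with h | h | h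
        exacts [absurd h.1 (by omega), ⟨0, h⟩, h.2]
      obtain ⟨j, hj⟩ := this
      refine ⟨j, Option.some_injective _ ?_⟩
      rw [Option.some_get, bdAt, hj, Option.map_some, L.root j 0, ← h2]

/-- The list of the edges at the junction that the algorithm uses. -/
noncomputable def list : Fin 3 → ι × ℝ := L.exists_lists.choose

theorem list_spec : Lists L.list (G.observe L.J).incident := L.exists_lists.choose_spec

/-- The legs are numbered in the order of the list of the edges at the junction, starting at the
position `t`. -/
def Matches (t : Fin 3) : Prop := ∀ m, L.bdAt m 0 = some (L.list (t + m))

theorem list_fst_injective : Function.Injective fun i => (L.list i).1 := by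
  intro i j h
  have hl := L.list_spec
  have h1 : L.list i ∈ (G.observe L.J).incident := hl.2 ▸ Set.mem_range_self i
  have h2 : L.list j ∈ (G.observe L.J).incident := hl.2 ▸ Set.mem_range_self j
  refine hl.1 (Prod.ext h ?_)
  rw [h1.2, h2.2]
  simp only at h
  rw [h]

variable {L}

theorem Matches.position {t : Fin 3} (h : L.Matches t) {m : Fin 3} (hm : 1 ≤ L.len m) :
    position L.list (some (L.P m 1)) = t + m := by
  have h1 : (L.list (t + m)).1 = L.P m 1 := by
    have := h m
    rw [bdAt, L.nx_of_lt hm, Option.map_some, Option.some.injEq] at this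
    rw [← this]
  have hex : ∃ i, some (L.list i).1 = some (L.P m 1) := ⟨_, by rw [h1]⟩
  rw [TadpoleExploration.position, dif_pos hex]
  apply L.list_fst_injective
  have := Option.some.inj hex.choose_spec
  simp only
  rw [this, h1]

theorem arms_eq_newArm {t : Fin 3} (h : L.Matches t) (m : Fin 3) :
    L.armAt m 0 = newArm L.J (L.list (t + m)) := by
  simp [armAt, newArm, down, L.dep_zero, L.P_zero, h m]

theorem arms_eq_vec (n : Fin 3 → ℕ) :
    L.arms n = ![L.armAt 0 (n 0), L.armAt 1 (n 1), L.armAt 2 (n 2)] := by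
  funext k; fin_cases k <;> rfl

theorem reverse_up (i : Fin 3) (n : ℕ) :
    (L.J :: L.up i n).reverse = L.P i n :: L.down i n := by
  rw [← L.reverse_down, List.reverse_reverse]

theorem initialArms_of_isSome {t : Fin 3} (h : L.Matches t) {K : ℕ} (hK : (L.bdAt 0 K).isSome) :
    initialArms L.J L.list (t + 0) (L.up 0 K) (L.dep 0 K) (L.bdAt 0 K) = L.arms ![K, 0, 0] := by
  obtain ⟨p, hp⟩ := Option.isSome_iff_exists.1 hK
  rw [arms_eq_vec]
  simp only [Matrix.cons_val]
  rw [arms_eq_newArm h, arms_eq_newArm h, armAt, hp]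
  simp only [initialArms, reverse_up, add_zero]

theorem initialArms_of_none {t : Fin 3} (h : L.Matches t) {K : ℕ} (hK : L.bdAt 2 K = none) :
    initialArms L.J L.list (t + 2) (L.up 2 K) (L.dep 2 K) none = L.arms ![0, 0, K] := by
  rw [arms_eq_vec]
  simp only [Matrix.cons_val]
  rw [arms_eq_newArm h, arms_eq_newArm h, armAt, hK]
  have h1 : ∀ t : Fin 3, t + 2 + 1 = t + 0 := by decide
  have h2 : ∀ t : Fin 3, t + 2 + 2 = t + 1 := by decide
  simp only [initialArms, h1, h2, reverse_up]

theorem length_up (i : Fin 3) (n : ℕ) : (L.up i n).length = n := by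
  induction n with
  | zero => rfl
  | succ n ih => simp [up, ih]

theorem drop_up (i : Fin 3) {k n : ℕ} (h : k < n) :
    (L.up i n).drop k = L.P i (k + 1) :: (L.up i n).drop (k + 1) := by
  induction n, h using Nat.le_induction with
  | base =>
    rw [up, List.drop_append_of_le_length (by rw [length_up]),
      List.drop_eq_nil_of_le (by rw [length_up]), List.drop_eq_nil_of_le (by simp [length_up])]
    rfl
  | succ n hn ih =>
    rw [up, List.drop_append_of_le_length (by rw [length_up]; omega), ih,
      List.drop_append_of_le_length (by rw [length_up]; omega)]
    rfl

theorem drop_up_self (i : Fin 3) (n : ℕ) : (L.up i (n + 1)).drop n = [L.P i (n + 1)] := by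
  rw [drop_up i (Nat.lt_succ_self n), List.drop_eq_nil_of_le (by rw [length_up])]

/-- The configuration in which the junction is entered on the leg `i`. -/
noncomputable def enter (heavy : Bool) (s : ι) (L : Layout G) (i : Fin 3) (K : ℕ)
    (bh : Option (ι × ℝ)) : State ι × List ι :=
  decideMain heavy s (homeList heavy s (G.observe L.J).incident (L.up i K))
    (initialArms L.J L.list (position L.list (some (L.P i 1))) (L.up i K) (L.dep i K) bh) 1

theorem updWalk_junction (heavy : Bool) (s : ι) {i : Fin 3} {K : ℕ} (hK : 1 ≤ K)
    (bh : Option (ι × ℝ)) :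
    updWalk heavy s (L.up i K) (L.dep i K) bh (G.observe L.J) = L.enter heavy s i K bh := by
  have h : (L.up i K).head? = some (L.P i 1) := by
    have := L.drop_up i (k := 0) (n := K) hK
    rw [List.drop_zero] at this
    rw [this]; rfl
  unfold updWalk
  rw [dif_pos L.exists_lists, h]
  rfl

/-- Walking towards the junction. -/
theorem exec_inward {heavy b : Bool} {s : ι} {i : Fin 3} {K : ℕ} (hK : K ≤ L.len i)
    {bh : Option (ι × ℝ)} {l : List ι}
    (h : Exec (upd heavy b) G.observe (L.enter heavy s i K bh) l) (k : ℕ) :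
    -- The trail consists of `P i (k+1)`, …, `P i K`, which is `up i K` without its first `k`
    -- entries. The list `q` allows for a return from the end of the stem.
    ∀ q : List ι, k + 1 ≤ K → Exec (upd heavy b) G.observe
      (.walk s ((L.up i K).drop k) (L.dep i K - L.dep i (k + 1)) (L.P i k, L.ew i k) bh,
        q ++ [L.P i k]) (q ++ L.P i k :: (L.down i k ++ l)) := by
  induction k with
  | zero =>
    intro q hk
    refine Exec.queue ?_ q
    rw [upd, L.P_zero, L.dep_succ, L.dep_zero, zero_add, sub_add_cancel, List.drop_zero,
      updWalk_junction heavy s hk]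
    exact h
  | succ k ih =>
    intro q hk
    refine Exec.queue ?_ q
    have hnot := L.not_lists_three (i := i) (k := k + 1) (by omega) (by omega)
    have ho := L.other_backward (i := i) (k := k) (by omega)
    rw [drop_up i (by omega : k + 1 < K), upd,
      updWalk_of_some (trail := L.P i (k + 1 + 1) :: _) hnot ho]
    have h2 : L.dep i K - L.dep i (k + 1 + 1) + L.ew i (k + 1) = L.dep i K - L.dep i (k + 1) := by
      rw [L.dep_succ i (k + 1)]; ring
    have h3 : L.P i (k + 1) :: L.P i (k + 1 + 1) :: (L.up i K).drop (k + 1 + 1) =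
        (L.up i K).drop k := by
      rw [← drop_up i (by omega : k + 1 < K), ← drop_up i (by omega : k < K)]
    simp only [h2]
    have := ih [] (by omega)
    rw [← h3] at this
    exact this

/-- The vertices met when walking back from `P i (K + t)` to `P i K`, both included. -/
def out (L : Layout G) (i : Fin 3) (K : ℕ) : ℕ → List ι
  | 0 => [L.P i K]
  | t + 1 => L.P i (K + t + 1) :: out L i K t

theorem out_append_down (i : Fin 3) (K t : ℕ) :
    L.out i K t ++ L.down i K = L.down i (K + t + 1) := by
  induction t with
  | zero => rfl
  | succ t ih => rw [out, List.cons_append, ih]; rfl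

/-- After the turn at the end of the stem, the reversed trail is the one that an inward walk from
that end would have produced. -/
theorem out_reverse (i : Fin 3) (K t : ℕ) :
    (L.out i (K + 1) t).reverse = (L.up i (K + 1 + t)).drop K := by
  induction t with
  | zero => rw [out, add_zero, drop_up_self]; rfl
  | succ t ih =>
    rw [out, List.reverse_cons, ih, ← add_assoc, up,
      List.drop_append_of_le_length (by rw [length_up]; omega)]

/-- Walking along the stem to its end, and back to the junction. -/
theorem exec_outward {heavy b : Bool} {s : ι} {K : ℕ} {l : List ι}
    (h : Exec (upd heavy b) G.observe (L.enter heavy s L.st (L.len L.st) none) l) (r : ℕ) :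
    ∀ t, K + 1 + t + 1 + r = L.len L.st → ∃ l', Exec (upd heavy b) G.observe
      (.walk s (L.out L.st (K + 1) t) (L.dep L.st (K + 1 + t) - L.dep L.st (K + 1))
        (L.P L.st (K + 1 + t + 1), L.ew L.st (K + 1 + t)) (some (L.P L.st K, L.ew L.st K)),
        [L.P L.st (K + 1 + t + 1)]) l' ∧
      (∀ u c, G.Trek (L.P L.st (L.len L.st)) (L.down L.st (L.len L.st) ++ l) u c →
        G.Trek (L.P L.st (K + 1 + t)) l' u
          (L.dep L.st (L.len L.st) - L.dep L.st (K + 1 + t) + c)) ∧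
      ∀ v ∈ L.P L.st (L.len L.st) :: (L.down L.st (L.len L.st) ++ l), v ∈ l' := by
  induction r with
  | zero =>
    intro t ht
    have hnot := L.not_lists_three (i := L.st) (k := K + 1 + t + 1) (by omega) (by omega)
    have ho := L.other_forward (i := L.st) (k := K + 1 + t) (by omega)
    have hbd : L.bdAt L.st (K + 1 + t + 1) = none := by
      rw [add_zero] at ht
      rw [bdAt, ht, L.nx_st]; rfl
    rw [hbd] at ho
    have hhead : (L.out L.st (K + 1) t).head? = some (L.P L.st (K + 1 + t)) := by
      cases t <;> rfl
    have hi := exec_inward le_rfl h K (L.out L.st (K + 1) t) (by omega)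
    have hl : L.out L.st (K + 1) t ++ L.P L.st K :: (L.down L.st K ++ l) =
        L.down L.st (L.len L.st) ++ l := by
      have := L.out_append_down L.st (K + 1) t
      rw [← ht, add_zero, ← this, List.append_assoc]; rfl
    rw [hl] at hi
    refine ⟨L.P L.st (L.len L.st) :: (L.down L.st (L.len L.st) ++ l), ?_, ?_, fun v hv => hv⟩
    · rw [← ht, add_zero] at hi ⊢
      refine Exec.arrive _ _ _ ?_
      rw [upd, updWalk_of_none hnot (hhead ▸ ho)]
      have h2 : L.dep L.st (K + 1 + t) - L.dep L.st (K + 1) + L.ew L.st (K + 1 + t) =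
          L.dep L.st (K + 1 + t + 1) - L.dep L.st (K + 1) := by
        rw [L.dep_succ L.st (K + 1 + t)]; ring
      simp only [h2]
      have h3 : L.P L.st (K + 1 + t + 1) :: L.out L.st (K + 1) t = L.out L.st (K + 1) (t + 1) :=
        rfl
      have h4 : (G.observe (L.P L.st (K + 1 + t + 1))).vertex = L.P L.st (K + 1 + t + 1) := rfl
      rw [h4, h3, out_reverse]
      exact hi
    · intro u c hu
      rw [← ht, add_zero] at hu ⊢
      refine .cons (L.adj_succ (by omega)) hu ?_
      rw [L.dep_succ L.st (K + 1 + t)]; unfold ew; ring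
  | succ r ih =>
    intro t ht
    obtain ⟨l', hl', hT, hv⟩ := ih (t + 1) (by omega)
    have hnot := L.not_lists_three (i := L.st) (k := K + 1 + t + 1) (by omega) (by omega)
    have ho := L.other_forward (i := L.st) (k := K + 1 + t) (by omega)
    have hbd : L.bdAt L.st (K + 1 + t + 1) =
        some (L.P L.st (K + 1 + t + 1 + 1), L.ew L.st (K + 1 + t + 1)) := by
      rw [bdAt, L.nx_of_lt (by omega)]; rfl
    rw [hbd] at ho
    have hhead : (L.out L.st (K + 1) t).head? = some (L.P L.st (K + 1 + t)) := by
      cases t <;> rfl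
    refine ⟨L.P L.st (K + 1 + t + 1) :: l', Exec.arrive _ _ _ ?_, ?_,
      fun v h => List.mem_cons_of_mem _ (hv v h)⟩
    · rw [upd, updWalk_of_some hnot (hhead ▸ ho)]
      have h2 : L.dep L.st (K + 1 + t) - L.dep L.st (K + 1) + L.ew L.st (K + 1 + t) =
          L.dep L.st (K + 1 + t + 1) - L.dep L.st (K + 1) := by
        rw [L.dep_succ L.st (K + 1 + t)]; ring
      simp only [h2]
      exact hl'
    · intro u c hu
      refine .cons (L.adj_succ (by omega)) (hT u c hu) ?_
      have := L.dep_succ L.st (K + 1 + t)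
      rw [add_assoc (K + 1) t 1] at this
      rw [this]; unfold ew; ring

/-! ### The first decision -/

/-- The searcher lists the two edges in an order of its own; the bit translates the intended
direction into this order. -/
theorem exists_bool {x y : ι × ℝ} {I : Set (ι × ℝ)} (hI : ∀ p, p ∈ I ↔ p = x ∨ p = y)
    {e : Fin 2 → ι × ℝ} (he : Lists e I) :
    ∃ b : Bool, e (if b then 1 else 0) = x ∧ e ((if b then 1 else 0) + 1) = y := by
  have h0 : e 0 ∈ I := he.2 ▸ Set.mem_range_self 0
  have h1 : e 1 ∈ I := he.2 ▸ Set.mem_range_self 1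
  rw [hI] at h0 h1
  have hne : e 0 ≠ e 1 := fun h => absurd (he.1 h) (by decide)
  have hx : x ∈ Set.range e := he.2 ▸ (hI x).2 (.inl rfl)
  have hy : y ∈ Set.range e := he.2 ▸ (hI y).2 (.inr rfl)
  rcases h0 with h0 | h0
  · refine ⟨false, h0, ?_⟩
    rcases h1 with h1 | h1
    · exact absurd (h0.trans h1.symm) hne
    · exact h1
  · refine ⟨true, ?_, h0⟩
    rcases h1 with h1 | h1
    · exact h1
    · exact absurd (h0.trans h1.symm) hne

/-- At an inner vertex of a leg, the oracle can impose either direction, with one bit that serves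
both modes of the algorithm. -/
theorem exists_start {i : Fin 3} {K : ℕ} (hK : K + 1 ≤ L.len i) {p : ι × ℝ}
    (hp : L.bdAt i (K + 1) = some p) (x y : ι × ℝ)
    (hxy : (x = (L.P i K, L.ew i K) ∧ y = p) ∨ (x = p ∧ y = (L.P i K, L.ew i K))) :
    ∃ b, ∀ heavy, upd heavy b .start (G.observe (L.P i (K + 1))) =
      (.walk (L.P i (K + 1)) [L.P i (K + 1)] 0 x (some y), [x.1]) := by
  have hnot := L.not_lists_three (i := i) (k := K + 1) (by omega) hK
  have hI : ∀ q, q ∈ (G.observe (L.P i (K + 1))).incident ↔ q = x ∨ q = y := by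
    intro q
    have hI' : q ∈ (G.observe (L.P i (K + 1))).incident ↔ q = (L.P i K, L.ew i K) ∨ q = p := by
      rw [L.mem_observe hK]
      simp only [bdAt, Option.map_eq_some_iff] at hp
      obtain ⟨u, hu, rfl⟩ := hp
      simp only [hu, Option.some.injEq, Prod.ext_iff, Nat.add_sub_cancel]
      constructor
      · rintro ⟨⟨-, h⟩ | h | h, h2⟩
        · left; refine ⟨h, ?_⟩; rw [h2, h, Sym2.eq_swap]; rfl
        · right; exact ⟨h.symm, by rw [h2, h]⟩
        · omega
      · rintro (⟨h, h2⟩ | ⟨h, h2⟩)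
        · refine ⟨.inl ⟨by omega, h⟩, ?_⟩; rw [h2, h, Sym2.eq_swap]; rfl
        · exact ⟨.inr (.inl h.symm), by rw [h2, h]⟩
    rw [hI']
    rcases hxy with ⟨rfl, rfl⟩ | ⟨rfl, rfl⟩
    · exact Iff.rfl
    · exact or_comm
  have hne : x ≠ y := by
    have h1 := L.nx_ne_pred hK (by omega)
    have h2 : p ≠ (L.P i K, L.ew i K) := by
      rintro rfl
      simp only [bdAt, Option.map_eq_some_iff, Prod.mk.injEq] at hp
      obtain ⟨u, hu, rfl, -⟩ := hp
      exact h1 hu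
    rcases hxy with ⟨rfl, rfl⟩ | ⟨rfl, rfl⟩
    exacts [h2.symm, h2]
  have hex : ∃ e : Fin 2 → ι × ℝ, Lists e (G.observe (L.P i (K + 1))).incident := by
    refine ⟨![x, y], fun k m h => ?_, ?_⟩
    · fin_cases k <;> fin_cases m <;> simp_all
    · ext q
      rw [hI]
      simp [eq_comm, or_comm]
  obtain ⟨b, hb1, hb2⟩ := exists_bool hI hex.choose_spec
  refine ⟨b, fun heavy => ?_⟩
  rw [upd, updStart, dif_neg hnot, dif_pos hex]
  simp only [hb1, hb2]
  rfl

theorem start_leaf (hK : ∃ K, K + 1 = L.len L.st) (heavy b : Bool) :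
    upd heavy b .start (G.observe (L.P L.st (L.len L.st))) =
      (.walk (L.P L.st (L.len L.st)) [L.P L.st (L.len L.st)] 0
        (L.P L.st (L.len L.st - 1), L.ew L.st (L.len L.st - 1)) none,
        [L.P L.st (L.len L.st - 1)]) := by
  obtain ⟨K, hK⟩ := hK
  rw [← hK, Nat.add_sub_cancel]
  have hnot := L.not_lists_three (i := L.st) (k := K + 1) (by omega) hK.le
  have hnx : L.nx L.st (K + 1) = none := by rw [hK, L.nx_st]
  have hI : ∀ q, q ∈ (G.observe (L.P L.st (K + 1))).incident ↔ q = (L.P L.st K, L.ew L.st K) := by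
    intro q
    rw [L.mem_observe hK.le, hnx, Prod.ext_iff]
    constructor
    · rintro ⟨⟨-, h⟩ | h | h, h2⟩
      · refine ⟨h, ?_⟩; rw [h2, h, Sym2.eq_swap]; rfl
      · simp at h
      · omega
    · rintro ⟨h, h2⟩
      refine ⟨.inl ⟨by omega, h⟩, ?_⟩; rw [h2, h, Sym2.eq_swap]; rfl
  have hnot2 : ¬ ∃ e : Fin 2 → ι × ℝ, Lists e (G.observe (L.P L.st (K + 1))).incident := by
    rintro ⟨e, he⟩
    have h0 : e 0 ∈ (G.observe (L.P L.st (K + 1))).incident := he.2 ▸ Set.mem_range_self 0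
    have h1 : e 1 ∈ (G.observe (L.P L.st (K + 1))).incident := he.2 ▸ Set.mem_range_self 1
    rw [hI] at h0 h1
    exact absurd (he.1 (h0.trans h1.symm)) (by decide)
  have ho : other (G.observe (L.P L.st (K + 1))).incident none = some (L.P L.st K, L.ew L.st K) :=
    other_eq_some ((hI _).2 rfl) (by simp) fun q hq _ => (hI q).1 hq
  rw [upd, updStart, dif_neg hnot, dif_neg hnot2, ho]
  rfl

end Layout

/-- The algorithm with the advice bits `heavy` and `b` performs a tour from `s` of cost `c`. -/
def WeightedGraph.Tours (G : WeightedGraph ι) (heavy b : Bool) (s : ι) (c : ℝ) : Prop :=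
  ∃ l, Exec (upd heavy b) G.observe (upd heavy b .start (G.observe s)) l ∧ G.Trek s l s c ∧
    ∀ v ∈ G.verts, v = s ∨ v ∈ l

theorem cutAt_append_of_mem {s : ι} {l : List ι} (h : s ∈ l) (l' : List ι) :
    cutAt s (l ++ l') = cutAt s l := by
  induction l with
  | nil => simp at h
  | cons x l ih =>
    by_cases hx : x = s
    · subst hx; rw [List.cons_append, cutAt_cons_self, cutAt_cons_self]
    · rw [List.cons_append, cutAt_cons_ne hx, cutAt_cons_ne hx, ih]
      exact (List.mem_cons.1 h).resolve_left (Ne.symm hx)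

namespace Layout

variable {G : WeightedGraph ι} {L : Layout G}

theorem bdAt_isSome {i : Fin 3} (h : i ≠ L.st) (k : ℕ) : (L.bdAt i k).isSome := by
  unfold bdAt nx
  split_ifs <;> rfl

theorem cutAt_up {i : Fin 3} {K M : ℕ} (hK : 1 ≤ K) (hKM : K ≤ M) (hM : M ≤ L.len i) :
    cutAt (L.P i K) (L.up i M) = L.up i K := by
  induction M, hKM using Nat.le_induction with
  | base =>
    obtain ⟨k, rfl⟩ := Nat.exists_eq_add_of_le' hK
    rw [up, cutAt_append, cutAt_cons_self]
    rw [mem_up]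
    rintro ⟨t, -, ht, he⟩
    have := L.P_inj (by omega) (by omega) he
    omega
  | succ M hKM ih =>
    rw [up, cutAt_append_of_mem (L.mem_up.2 ⟨K, hK, hKM, rfl⟩), ih (by omega)]

theorem cutAt_down_append {i j : Fin 3} {K n : ℕ} (hij : i ≠ j) (hK : 1 ≤ K) (hKl : K ≤ L.len j)
    (hn : n ≤ L.len i) (l : List ι) :
    cutAt (L.P j K) (L.down i n ++ l) = L.down i n ++ cutAt (L.P j K) l := by
  refine cutAt_append ?_ _
  rw [mem_down]
  rintro ⟨t, ht, he⟩
  have := L.P_ne (by omega) (by omega) hij he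
  omega

theorem trek_home {i : Fin 3} {K M : ℕ} (hK : 1 ≤ K) (hKM : K ≤ M) (hM : M ≤ L.len i) :
    G.Trek L.J (cutAt (L.P i K) (cutAt (L.P i K) (L.up i M))) (L.P i K) (L.dep i K) := by
  rw [cutAt_cutAt, cutAt_up hK hKM hM]
  exact L.trek_up (by omega)

theorem trek_down_home {i j : Fin 3} {K M : ℕ} (hij : i ≠ j) (hK : 1 ≤ K) (hKM : K ≤ M)
    (hM : M ≤ L.len j) :
    G.Trek (L.P i (L.len i)) (cutAt (L.P j K) (L.down i (L.len i) ++ cutAt (L.P j K) (L.up j M)))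
      (L.P j K) (L.dep i (L.len i) + L.dep j K) := by
  rw [cutAt_down_append hij hK (by omega) le_rfl]
  exact (L.trek_down le_rfl).append (trek_home hK hKM hM)

theorem enter_first {t : Fin 3} (h : L.Matches t) {K : ℕ} (hK : 1 ≤ K) (hKl : K ≤ L.len 0)
    (hst : L.st ≠ 0) (heavy : Bool) (s : ι) :
    L.enter heavy s 0 K (L.bdAt 0 K) = decideMain heavy s
      (homeList heavy s (G.observe L.J).incident (L.up 0 K)) (L.arms ![K, 0, 0]) 1 := by
  rw [enter, h.position (by omega), initialArms_of_isSome h (bdAt_isSome (Ne.symm hst) K)]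

theorem enter_stem {t : Fin 3} (h : L.Matches t) (hst : L.st = 2) (heavy : Bool) (s : ι) :
    L.enter heavy s L.st (L.len L.st) none = decideMain heavy s
      (homeList heavy s (G.observe L.J).incident (L.up 2 (L.len 2)))
      (L.arms ![0, 0, L.len 2]) 1 := by
  have h1 := L.len_st
  have h2 := L.nx_st
  rw [hst] at h1 h2 ⊢
  rw [enter, h.position h1, initialArms_of_none h (by rw [bdAt, h2]; rfl)]

/-- The second bit sends the searcher towards the junction inside the tree, away from the removed
edge. -/
theorem tours_of_first {t : Fin 3} (h : L.Matches t) {K : ℕ} (hK : 1 ≤ K) (hKl : K ≤ L.len 0)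
    (hst : L.st ≠ 0) : ∃ b, ∀ heavy c, L.Completes heavy b (L.P 0 K)
      (homeList heavy (L.P 0 K) (G.observe L.J).incident (L.up 0 K)) ![K, 0, 0] 1 c →
        G.Tours heavy b (L.P 0 K) (L.dep 0 K + c) := by
  obtain ⟨p, hp⟩ := Option.isSome_iff_exists.1 (bdAt_isSome (Ne.symm hst) K)
  obtain ⟨k, rfl⟩ := Nat.exists_eq_add_of_le' hK
  obtain ⟨b, hb⟩ := exists_start hKl hp _ _ (.inl ⟨rfl, rfl⟩)
  refine ⟨b, fun heavy c hc => ?_⟩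
  obtain ⟨l, hl, ht, hv⟩ := hc
  rw [← enter_first h hK hKl hst, hp] at hl
  refine ⟨L.down 0 (k + 1) ++ l, ?_, (L.trek_down hKl).append (L.P_zero 1 ▸ ht), fun v hvv => ?_⟩
  · rw [hb heavy]
    have := exec_inward hKl hl k [] le_rfl
    rw [drop_up_self, sub_self] at this
    exact this
  · rcases hv v hvv with ⟨j, m, hm, rfl⟩ | h
    · have hJ : L.J ∈ L.down 0 (k + 1) := L.mem_down.2 ⟨0, by omega, L.P_zero 0⟩
      fin_cases j
      · rcases Nat.lt_or_eq_of_le hm with hm | hm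
        · exact .inr (List.mem_append_left _ (L.mem_down.2 ⟨m, hm, rfl⟩))
        · exact .inl (congrArg _ hm)
      · obtain rfl : m = 0 := Nat.le_zero.1 hm
        exact .inr (List.mem_append_left _ (by rw [L.P_zero]; exact hJ))
      · obtain rfl : m = 0 := Nat.le_zero.1 hm
        exact .inr (List.mem_append_left _ (by rw [L.P_zero]; exact hJ))
    · exact .inr (List.mem_append_right _ h)

/-- The second bit sends the searcher to the end of the stem first, so that the junction is entered
with the stem completely explored. At the end itself any bit will do. -/
theorem exec_stem {K : ℕ} (hK : 1 ≤ K) (hKl : K ≤ L.len L.st) : ∃ b, ∀ heavy l,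
    Exec (upd heavy b) G.observe (L.enter heavy (L.P L.st K) L.st (L.len L.st) none) l →
    ∃ l', Exec (upd heavy b) G.observe (upd heavy b .start (G.observe (L.P L.st K))) l' ∧
      (∀ u c, G.Trek (L.P L.st (L.len L.st)) (L.down L.st (L.len L.st) ++ l) u c →
        G.Trek (L.P L.st K) l' u (L.dep L.st (L.len L.st) - L.dep L.st K + c)) ∧
      ∀ v ∈ L.P L.st (L.len L.st) :: (L.down L.st (L.len L.st) ++ l), v = L.P L.st K ∨ v ∈ l' := by
  obtain ⟨k, rfl⟩ := Nat.exists_eq_add_of_le' hK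
  rcases hKl.eq_or_lt with hl | hlt
  · refine ⟨false, fun heavy l h => ⟨L.down L.st (L.len L.st) ++ l, ?_, ?_, ?_⟩⟩
    · have h1 := start_leaf (L := L) ⟨k, hl⟩ heavy false
      rw [← hl, Nat.add_sub_cancel] at h1
      rw [h1]
      rw [← hl] at h ⊢
      have := exec_inward hl.le h k [] le_rfl
      rw [drop_up_self, sub_self] at this
      exact this
    · intro u c hu
      rw [hl, sub_self, zero_add]
      exact hu
    · intro v hv
      rw [hl]
      exact List.mem_cons.1 hv
  · have hp : L.bdAt L.st (k + 1) = some (L.P L.st (k + 1 + 1), L.ew L.st (k + 1)) := by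
      rw [bdAt, L.nx_of_lt hlt]; rfl
    obtain ⟨b, hb⟩ := exists_start hlt.le hp _ _ (.inr ⟨rfl, rfl⟩)
    refine ⟨b, fun heavy l h => ?_⟩
    obtain ⟨l', hl', hT, hv⟩ := exec_outward h (K := k) (L.len L.st - (k + 2)) 0 (by omega)
    refine ⟨l', ?_, fun u c hu => ?_, fun v h => .inr (hv v h)⟩
    · rw [hb heavy]
      rw [add_zero, sub_self] at hl'
      exact hl'
    · exact hT u c hu

theorem tours_of_stem {t : Fin 3} (h : L.Matches t) (hst : L.st = 2) {K : ℕ} (hK : 1 ≤ K)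
    (hKl : K ≤ L.len 2) : ∃ b, ∀ heavy c, L.Completes heavy b (L.P 2 K)
      (homeList heavy (L.P 2 K) (G.observe L.J).incident (L.up 2 (L.len 2)))
        ![0, 0, L.len 2] 1 c →
      G.Tours heavy b (L.P 2 K) (L.dep 2 (L.len 2) - L.dep 2 K + (L.dep 2 (L.len 2) + c)) := by
  obtain ⟨b, hb⟩ := exec_stem (L := L) hK (hst ▸ hKl)
  refine ⟨b, fun heavy c ⟨l, hl, ht, hv⟩ => ?_⟩
  have hent := enter_stem h hst heavy (L.P 2 K)
  rw [← hent] at hl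
  obtain ⟨l', h1, h2, h3⟩ := hb heavy l (by rw [hst] at hl ⊢; exact hl)
  rw [hst] at h1 h2 h3
  have ht : G.Trek (L.P 1 0) l (L.P 2 K) c := ht
  rw [L.P_zero] at ht
  refine ⟨l', h1, h2 _ _ ((L.trek_down le_rfl).append ht), fun v hvv => h3 v ?_⟩
  have hdown : ∀ m ≤ L.len 2, L.P 2 m ∈ L.P 2 (L.len 2) :: (L.down 2 (L.len 2) ++ l) := by
    intro m hm
    rcases Nat.lt_or_eq_of_le hm with hm | rfl
    · exact List.mem_cons_of_mem _ (List.mem_append_left _ (L.mem_down.2 ⟨m, hm, rfl⟩))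
    · exact List.mem_cons_self
  rcases hv v hvv with ⟨j, m, hm, rfl⟩ | h
  · fin_cases j
    · obtain rfl : m = 0 := Nat.le_zero.1 hm
      rw [L.root _ 2]; exact hdown 0 (Nat.zero_le _)
    · obtain rfl : m = 0 := Nat.le_zero.1 hm
      rw [L.root _ 2]; exact hdown 0 (Nat.zero_le _)
    · exact hdown m hm
  · exact List.mem_cons_of_mem _ (List.mem_append_right _ h)

theorem tours_of_junction {b : Bool} (h : L.Matches (if b then 1 else 0)) {heavy : Bool} {c : ℝ}
    (hc : L.Completes heavy b L.J [] ![0, 0, 0] 1 c) : G.Tours heavy b L.J c := by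
  obtain ⟨l, hl, ht, hv⟩ := hc
  have ht : G.Trek (L.P 1 0) l L.J c := ht
  rw [L.P_zero] at ht
  refine ⟨l, ?_, ht, fun v hvv => ?_⟩
  · have : upd heavy b .start (G.observe L.J) =
        decideMain heavy L.J [] (L.arms ![0, 0, 0]) 1 := by
      rw [arms_eq_vec]
      simp only [Matrix.cons_val]
      rw [arms_eq_newArm h, arms_eq_newArm h, arms_eq_newArm h, add_zero]
      change updStart heavy b _ = _
      unfold updStart
      rw [dif_pos L.exists_lists]
      rfl
    rw [this]; exact hl
  · rcases hv v hvv with ⟨j, m, hm, rfl⟩ | h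
    · left
      have : m = 0 := by fin_cases j <;> exact Nat.le_zero.1 hm
      rw [this, L.P_zero]
    · exact .inr h

/-! ### Tours that avoid the heavy edge -/

/-- Without detours and pending moves all left-hand sides are trivial; in `second`, the explored
part of leg 0 is cancelled by `a`. -/
theorem invSide_init {n : Fin 3 → ℕ} {a : ℝ} (hn : ∀ i, n i ≤ L.len i)
    (hp : L.pend n 2 = 0) (ha : L.dep 0 (n 0) ≤ a) : L.InvSide a n 1 2 0 := by
  have h1 := sqrt_three_bounds
  have d0 := dep_facts hn 0
  have d1 := dep_facts hn 1
  have d2 := dep_facts hn 2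
  have hr : 0 ≤ L.reach n 2 := by
    unfold reach
    split_ifs
    · rw [full_eq]; linarith
    · exact d2.1
  have hf : 0 ≤ (√3 - 1) / 2 := by linarith
  have hg : 0 ≤ (3 - √3) / 2 := by linarith
  refine ⟨?_, ?_, ?_, fun _ => ?_⟩ <;> rw [hp]
  · rw [full_eq]; linarith
  · have : 0 ≤ (L.arms n 0).full + L.dep 1 (n 1) + L.reach n 2 := by rw [full_eq]; linarith
    have := mul_nonneg hf this
    linarith
  · have : 0 ≤ L.dep 0 (n 0) + L.dep 1 (n 1) + L.reach n 2 := by linarith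
    have := mul_nonneg hf this
    linarith
  · have : 0 ≤ (L.arms n 0).full := by rw [full_eq]; linarith
    have := mul_nonneg hg this
    linarith

theorem pend_eq_zero {n : Fin 3 → ℕ} {j : Fin 3} (h : n j = 0 ∨ ¬ L.Live n j) :
    L.pend n j = 0 := by
  unfold pend
  split_ifs with hl
  · rw [h.resolve_right (not_not.2 hl.1), L.dep_zero]
  · rfl

theorem tours_heavy_of_first {t : Fin 3} (h : L.Matches t) {K : ℕ} (hK : 1 ≤ K)
    (hKl : K ≤ L.len 0) (hst : L.st ≠ 0) (hh : L.Heavy) :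
    ∃ b, ∃ c ≤ (1 + √3) * L.tot L.len, G.Tours true b (L.P 0 K) c := by
  obtain ⟨b, hb⟩ := tours_of_first h hK hKl hst
  have hn : ∀ i, (![K, 0, 0] : Fin 3 → ℕ) i ≤ L.len i := by
    intro k; fin_cases k
    · exact hKl
    · exact Nat.zero_le _
    · exact Nat.zero_le _
  have hhome : homeList true (L.P 0 K) (G.observe L.J).incident (L.up 0 K) =
      cutAt (L.P 0 K) (L.up 0 K) := by simp [homeList]
  -- If the start is the tip of leg 0, that leg is finished at once and is never the last one.
  have hret : ∀ i, (i ≠ 0 ∨ K < L.len 0) → G.Trek (L.P i (L.len i))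
      (cutAt (L.P 0 K) (L.down i (L.len i) ++ cutAt (L.P 0 K) (L.up 0 K))) (L.P 0 K)
      (L.ret (L.dep 0 K) (L.dep 0 K) i (L.len i)) := by
    intro i hi
    unfold ret
    by_cases h0 : i = 0
    · subst h0
      refine (L.trek_cutAt_down (hi.resolve_left (by simp)) le_rfl _).of_eq ?_
      rw [if_pos rfl]; ring
    · refine (trek_down_home h0 hK le_rfl hKl).of_eq ?_
      rw [if_neg h0]; ring
  have ho : ∀ j, (![K, 0, 0] : Fin 3 → ℕ) j < L.len j → j ≠ 0 ∨ K < L.len 0 := by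
    intro j hj
    by_cases h0 : j = 0
    · subst h0; exact .inr hj
    · exact .inl h0
  have hC : L.CompletesIn b (L.P 0 K) (cutAt (L.P 0 K) (L.up 0 K)) ![K, 0, 0] 1
      (L.budget (L.dep 0 K) (L.dep 0 K) ![K, 0, 0] 1 0) := by
    by_cases hc : L.CycleOpen ![K, 0, 0] ∨ 1 ≠ L.st
    · exact completesIn_of_inv (L.dep_nonneg hKl) hst hh hret _ _ _ _ rfl hn (.inl (by decide)) ho hc
        (.inr ⟨2, .inl ⟨rfl, rfl⟩, invSide_init hn (pend_eq_zero (.inl rfl)) le_rfl⟩)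
    -- Exceptional case: the removed edge joins the start to the junction and leg 1 is the stem. The
    -- walk to the junction has explored the whole cycle.
    · rw [not_or, not_not] at hc
      refine completesIn_of_cycle_explored hst hret _ _ _ _ rfl hn ?_ (.inl (by decide)) ho ?_
      · intro k hk
        have h1 : ¬ _ := fun h => hc.1 (.inl h)
        have h2 : ¬ _ := fun h => hc.1 (.inr h)
        have := hn k
        by_cases h0 : k = 0
        · subst h0; omega
        · have := L.eq_oth (Ne.symm hst) hk (Ne.symm h0)
          rw [← this] at h2; omega
      · rw [if_neg (fun h => h.2 hc.2), add_zero]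
        have h1 := sqrt_three_bounds
        have := L.tot_mono hn
        have := L.dep_nonneg hKl
        refine mul_nonneg (by linarith) ?_
        unfold tot
        have := L.dep_nonneg (le_refl (L.len 0))
        have := L.dep_nonneg (le_refl (L.len 1))
        have := L.dep_nonneg (le_refl (L.len 2))
        linarith
  obtain ⟨c, hc, hC⟩ := hC
  rw [← hhome] at hC
  refine ⟨b, _, ?_, hb true c hC⟩
  have h10 : (1 : Fin 3) ≠ 0 := by decide
  simp only [budget, ret, tot, Matrix.cons_val, L.dep_zero, if_neg h10] at hc ⊢
  linarith

theorem tours_heavy_of_stem {t : Fin 3} (h : L.Matches t) {K : ℕ} (hK : 1 ≤ K)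
    (hKl : K ≤ L.len 2) (hst : L.st = 2) (hh : L.Heavy) :
    ∃ b, ∃ c ≤ (1 + √3) * L.tot L.len, G.Tours true b (L.P 2 K) c := by
  obtain ⟨b, hb⟩ := tours_of_stem h hst hK hKl
  have hst0 : L.st ≠ 0 := by rw [hst]; decide
  have hn : ∀ i, (![0, 0, L.len 2] : Fin 3 → ℕ) i ≤ L.len i := by
    intro k; fin_cases k
    · exact Nat.zero_le _
    · exact Nat.zero_le _
    · exact le_rfl
  have hhome : homeList true (L.P 2 K) (G.observe L.J).incident (L.up 2 (L.len 2)) =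
      cutAt (L.P 2 K) (L.up 2 (L.len 2)) := by simp [homeList]
  -- The stem is finished, so the tour ends on a cycle leg; the start does not lie on leg 0, whence
  -- `a` = 0.
  have hret : ∀ i, i ≠ 2 → G.Trek (L.P i (L.len i))
      (cutAt (L.P 2 K) (L.down i (L.len i) ++ cutAt (L.P 2 K) (L.up 2 (L.len 2)))) (L.P 2 K)
      (L.ret (L.dep 2 K) 0 i (L.len i)) := by
    intro i hi
    refine (trek_down_home hi hK hKl le_rfl).of_eq ?_
    simp [ret]
  have hC : L.CompletesIn b (L.P 2 K) (cutAt (L.P 2 K) (L.up 2 (L.len 2))) ![0, 0, L.len 2] 1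
      (L.budget (L.dep 2 K) 0 ![0, 0, L.len 2] 1 0) := by
    refine completesIn_of_inv le_rfl hst0 hh hret _ _ _ _ rfl hn (by decide) ?_
      (.inr (by rw [hst]; decide))
      (.inr ⟨2, .inl ⟨rfl, rfl⟩, invSide_init hn (pend_eq_zero (.inr ?_)) (L.dep_zero 0).le⟩)
    · rintro j hj rfl
      exact lt_irrefl _ hj
    · simp [Live, hst]
  obtain ⟨c, hc, hC⟩ := hC
  rw [← hhome] at hC
  refine ⟨b, _, ?_, hb true c hC⟩
  have h10 : (1 : Fin 3) ≠ 0 := by decide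
  simp only [budget, ret, tot, Matrix.cons_val, L.dep_zero, if_neg h10] at hc ⊢
  linarith

theorem tours_heavy_of_junction {b : Bool} (h : L.Matches (if b then 1 else 0))
    (hst : L.st ≠ 0) (hh : L.Heavy) :
    ∃ c ≤ (1 + √3) * L.tot L.len, G.Tours true b L.J c := by
  have hn : ∀ i, (![0, 0, 0] : Fin 3 → ℕ) i ≤ L.len i := by
    intro k; fin_cases k <;> exact Nat.zero_le _
  have hret : ∀ i, True → G.Trek (L.P i (L.len i))
      (cutAt L.J (L.down i (L.len i) ++ [])) L.J (L.ret 0 0 i (L.len i)) := by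
    intro i _
    rcases Nat.eq_zero_or_pos (L.len i) with h0 | h0
    · rw [h0, L.P_zero]
      refine (WeightedGraph.Trek.nil _).of_eq ?_
      simp [ret, L.dep_zero]
    · have := L.trek_cutAt_down h0 le_rfl []
      rw [L.P_zero] at this
      refine this.of_eq ?_
      simp [ret, L.dep_zero]
  have hC : L.CompletesIn b L.J [] ![0, 0, 0] 1 (L.budget 0 0 ![0, 0, 0] 1 0) := by
    refine completesIn_of_inv le_rfl hst hh hret _ _ _ _ rfl hn trivial (fun _ _ => trivial)
      (.inl ?_)
      (.inr ⟨2, .inl ⟨rfl, rfl⟩, invSide_init hn (pend_eq_zero (.inl rfl)) (L.dep_zero 0).le⟩)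
    have hne := L.oth_ne (Ne.symm hst)
    have h2 := L.len_cy _ _ hne.1 hne.2 (Ne.symm hst)
    rcases Nat.eq_zero_or_pos (L.len 0) with h0 | h0
    · right
      have : (![0, 0, 0] : Fin 3 → ℕ) (L.oth 0) = 0 := by
        generalize L.oth 0 = k
        fin_cases k <;> rfl
      omega
    · exact .inl h0
  obtain ⟨c, hc, hC⟩ := hC
  refine ⟨_, ?_, tours_of_junction h hC⟩
  have h10 : (1 : Fin 3) ≠ 0 := by decide
  simp only [budget, ret, tot, Matrix.cons_val, L.dep_zero, if_neg h10] at hc ⊢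
  linarith

/-! ### Tours around the cycle -/

/-- The start is the tip of leg 0, so the removed edge is the cycle edge that closes the tour. The
stem is leg 1 and thus is visited before the rest of the cycle. -/
theorem tours_around_of_cycle {t : Fin 3} (h : L.Matches t) (hst : L.st = 1) (h0 : 1 ≤ L.len 0) :
    ∃ b, G.Tours false b (L.P 0 (L.len 0)) (L.dep 0 (L.len 0) +
      (2 * L.dep 1 (L.len 1) + L.dep 2 (L.len 2) + G.weight (L.cutEdge 0))) := by
  have h0s : (0 : Fin 3) ≠ L.st := by rw [hst]; decide
  obtain ⟨b, hb⟩ := tours_of_first h h0 le_rfl (Ne.symm h0s)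
  refine ⟨b, hb _ _ (completes_of_stem_first hst rfl (fun h2 => ?_) rfl rfl rfl)⟩
  have ho : L.oth 0 = 2 := by rw [oth, hst]; decide
  have hnx := L.nx_len h0s
  rw [ho, h2, L.P_zero] at hnx
  have hadj := (L.adj_nx le_rfl hnx).symm
  rw [homeList, if_pos ⟨rfl, (_, G.weight s(L.J, L.P 0 (L.len 0))), ⟨hadj, rfl⟩, rfl⟩]

theorem tours_around_of_stem {t : Fin 3} (h : L.Matches t) (hst : L.st = 2) (h0 : L.len 0 = 0)
    {K : ℕ} (hK : 1 ≤ K) (hKl : K ≤ L.len 2) :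
    ∃ b, G.Tours false b (L.P 2 K) (2 * L.dep 2 (L.len 2) + L.dep 1 (L.len 1) +
      G.weight (L.cutEdge 0)) := by
  obtain ⟨b, hb⟩ := tours_of_stem h hst hK hKl
  have hne : L.P 2 K ≠ L.J := by
    rw [← L.P_zero 2]
    intro h
    have := L.P_inj hKl (Nat.zero_le _) h
    omega
  have hhome : G.Trek L.J (cutAt (L.P 2 K)
      (homeList false (L.P 2 K) (G.observe L.J).incident (L.up 2 (L.len 2)))) (L.P 2 K)
      (L.dep 2 K) := by
    unfold homeList
    split_ifs with hadj
    · obtain ⟨-, p, ⟨hadj, -⟩, hp⟩ := hadj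
      rw [hp] at hadj
      rw [cutAt_cons_self]
      refine (WeightedGraph.Trek.single hadj).of_eq ?_
      obtain rfl : K = 1 := by
        rcases (L.adj_P_iff hKl _).1 hadj.symm with ⟨-, h⟩ | h | h
        · rw [← L.P_zero 2] at h
          have := L.P_inj (Nat.zero_le _) (by omega) h
          omega
        · unfold nx at h
          split_ifs at h with h1 h2
          · rw [← L.P_zero 2] at h
            have := L.P_inj (by omega) (by omega) (Option.some.inj h)
            omega
          · exact absurd hst.symm h2
        · omega
      rw [L.dep_succ, L.dep_zero, zero_add, ew, L.P_zero]
    · exact trek_home hK hKl le_rfl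
  obtain ⟨l, hl, ht, hv⟩ := hb _ _ (completes_of_stem_explored hst h0 hne hhome rfl rfl rfl)
  exact ⟨b, l, hl, ht.of_eq (by ring), hv⟩

theorem tours_around_of_junction {b : Bool} (h : L.Matches (if b then 1 else 0))
    (hst : L.st = 1 ∨ L.st = 2) (h0 : L.len 0 = 0) :
    G.Tours false b L.J (2 * L.dep L.st (L.len L.st) + L.dep (L.oth 0) (L.len (L.oth 0)) +
      G.weight (L.cutEdge 0)) := by
  refine tours_of_junction h ?_
  rcases hst with hst | hst
  · have ho : L.oth 0 = 2 := by rw [oth, hst]; decide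
    rw [ho, hst]
    refine completes_of_stem_first hst (by rw [h0, L.P_zero]) (fun h2 => ?_) h0.symm rfl rfl
    have := L.len_cy 0 2 (by decide) (by rw [hst]; decide) (by rw [hst]; decide)
    omega
  · have ho : L.oth 0 = 1 := by rw [oth, hst]; decide
    rw [ho, hst]
    exact completes_of_cycle_first hst h0 rfl rfl rfl

end Layout

namespace Layout

variable {G : WeightedGraph ι} (L : Layout G)

/-! ### Renumbering the legs -/

/-- The layout with the legs renumbered. -/
def perm (π : Equiv.Perm (Fin 3)) : Layout G where
  P i := L.P (π i)
  len i := L.len (π i)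
  st := π.symm L.st
  root i j := L.root _ _
  inj i j k l hk hl h := (L.inj _ _ _ _ hk hl h).imp (fun h => ⟨π.injective h.1, h.2⟩) id
  mem_iff v := by
    rw [L.mem_iff]
    constructor
    · rintro ⟨i, k, hk, rfl⟩
      exact ⟨π.symm i, k, by simpa using hk, by simp⟩
    · rintro ⟨i, k, hk, rfl⟩
      exact ⟨π i, k, hk, rfl⟩
  adj_iff u v := by
    rw [L.adj_iff]
    constructor
    · rintro (⟨i, k, hk, h⟩ | ⟨i, j, hij, hi, hj, h⟩)
      · exact .inl ⟨π.symm i, k, by simpa using hk, by simpa using h⟩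
      · exact .inr ⟨π.symm i, π.symm j, by simpa using hij, by simpa using hi, by simpa using hj,
          by simpa using h⟩
    · rintro (⟨i, k, hk, h⟩ | ⟨i, j, hij, hi, hj, h⟩)
      · exact .inl ⟨π i, k, hk, h⟩
      · exact .inr ⟨π i, π j, by simpa using hij, fun h => hi (by rw [← h]; simp),
          fun h => hj (by rw [← h]; simp), h⟩
  len_st := by simpa using L.len_st
  len_cy i j hij hi hj := L.len_cy _ _ (by simpa using hij) (fun h => hi (by rw [← h]; simp))
    (fun h => hj (by rw [← h]; simp))

variable {L} {π : Equiv.Perm (Fin 3)}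

theorem perm_J : (L.perm π).J = L.J := L.root _ _

theorem perm_st_ne {i : Fin 3} : i ≠ (L.perm π).st ↔ π i ≠ L.st := by
  rw [not_iff_not]
  exact Equiv.eq_symm_apply π

theorem perm_oth {i : Fin 3} (h : i ≠ (L.perm π).st) : π ((L.perm π).oth i) = L.oth (π i) := by
  have h1 := (L.perm π).oth_ne h
  exact L.eq_oth (perm_st_ne.1 h) (perm_st_ne.1 h1.2) fun h2 => h1.1 (π.injective h2).symm

theorem perm_cutEdge {i : Fin 3} (h : i ≠ (L.perm π).st) :
    (L.perm π).cutEdge i = L.cutEdge (π i) := by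
  unfold cutEdge
  rw [← perm_oth h]
  rfl

theorem perm_bdAt (i : Fin 3) (k : ℕ) : (L.perm π).bdAt i k = L.bdAt (π i) k := by
  have : (L.perm π).nx i k = L.nx (π i) k := by
    unfold nx
    by_cases h : i = (L.perm π).st
    · have h' : π i = L.st := by rw [h]; exact π.apply_symm_apply _
      rw [if_pos h, if_pos h']
      rfl
    · rw [if_neg h, if_neg (perm_st_ne.1 h), ← perm_oth h]
      rfl
  rw [bdAt, this]
  rfl

theorem tot_eq_sum (n : Fin 3 → ℕ) : L.tot n = ∑ i, L.dep i (n i) := by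
  rw [Fin.sum_univ_three]; rfl

theorem perm_tot : (L.perm π).tot (L.perm π).len = L.tot L.len := by
  rw [tot_eq_sum, tot_eq_sum]
  exact Equiv.sum_comp π fun i => L.dep i (L.len i)

theorem perm_dep_st :
    (L.perm π).dep (L.perm π).st ((L.perm π).len (L.perm π).st) = L.dep L.st (L.len L.st) := by
  have : π (L.perm π).st = L.st := π.apply_symm_apply _
  change L.dep (π (L.perm π).st) (L.len (π (L.perm π).st)) = _
  rw [this]

theorem choose_congr {α : Type*} {p q : α → Prop} (h : p = q) (hp : ∃ x, p x) (hq : ∃ x, q x) :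
    hp.choose = hq.choose := by
  subst h; rfl

/-- The list of edges depends on the observation at the junction only, not on how the graph is laid
out. -/
theorem list_congr {L' : Layout G} (h : L.J = L'.J) : L.list = L'.list :=
  choose_congr (by rw [h]) _ _

/-- The edges at the junction are those that start the three legs. -/
theorem exists_order (L : Layout G) :
    ∃ σ : Equiv.Perm (Fin 3), ∀ m, L.bdAt (σ m) 0 = some (L.list m) := by
  have hex : ∀ m, ∃ i, L.bdAt i 0 = some (L.list m) := by
    intro m
    have hm : L.list m ∈ (G.observe L.J).incident := L.list_spec.2 ▸ Set.mem_range_self m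
    rw [← L.P_zero 0, L.mem_observe (Nat.zero_le _)] at hm
    obtain ⟨h | h | h, h2⟩ := hm
    · omega
    · exact ⟨0, by rw [bdAt, h, Option.map_some, ← h2]⟩
    · obtain ⟨-, j, h⟩ := h
      exact ⟨j, by rw [bdAt, h, Option.map_some, L.root j 0, ← h2]⟩
  choose σ hσ using hex
  have hinj : Function.Injective σ := fun m m' h => by
    have := (hσ m).symm.trans (h ▸ hσ m')
    exact L.list_spec.1 (Option.some.inj this)
  exact ⟨Equiv.ofBijective σ (Finite.injective_iff_bijective.1 hinj), hσ⟩

/-- The legs can be numbered in the order of the list of edges, starting at any position. -/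
theorem matches_perm {σ : Equiv.Perm (Fin 3)} (h : ∀ m, L.bdAt (σ m) 0 = some (L.list m))
    (t : Fin 3) : (L.perm ((Equiv.addLeft t).trans σ)).Matches t := by
  intro m
  rw [perm_bdAt, list_congr perm_J]
  exact h (t + m)

theorem cutEdge_congr {i j : Fin 3} (hi : i ≠ L.st) (hj : j ≠ L.st) :
    L.cutEdge i = L.cutEdge j := by
  by_cases h : i = j
  · rw [h]
  · rw [L.eq_oth hi hj h, cutEdge_oth]

variable (L)

/-- The weight of the removed edge. -/
def cutWeight : ℝ := G.weight (L.cutEdge (L.st + 1))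

/-- The length of a tour around the cycle. -/
def around : ℝ := L.tot L.len + L.dep L.st (L.len L.st) + L.cutWeight

variable {L}

theorem st_add_one_ne : L.st + 1 ≠ L.st := by simp

theorem weight_cutEdge {i : Fin 3} (h : i ≠ L.st) : G.weight (L.cutEdge i) = L.cutWeight := by
  rw [cutWeight, cutEdge_congr h st_add_one_ne]

theorem perm_cutWeight : (L.perm π).cutWeight = L.cutWeight := by
  rw [cutWeight, perm_cutEdge st_add_one_ne, weight_cutEdge (perm_st_ne.1 st_add_one_ne)]

theorem perm_around : (L.perm π).around = L.around := by
  rw [around, around, perm_tot, perm_dep_st, perm_cutWeight]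

theorem tot_len (hst : L.st ≠ 0) : L.tot L.len =
    L.dep 0 (L.len 0) + L.dep (L.oth 0) (L.len (L.oth 0)) + L.dep L.st (L.len L.st) := by
  rcases oth_zero_cases hst with ⟨h1, h2⟩ | ⟨h1, h2⟩ <;> rw [h1, h2, tot]
  ring

theorem heavy_of_lt (hst : L.st ≠ 0) (h : (1 + √3) * L.tot L.len < L.around) : L.Heavy := by
  rw [Heavy, weight_cutEdge (Ne.symm hst)]
  rw [around, tot_len hst] at h
  linarith

/-- One bit selects one of two legs at the junction, and at most one of these is the stem. -/
theorem exists_bool_ne (σ : Equiv.Perm (Fin 3)) (t : Fin 3) :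
    ∃ b : Bool, σ (if b then 1 else 0) ≠ t := by
  by_cases h : σ 0 = t
  · refine ⟨true, fun h1 => ?_⟩
    exact absurd (σ.injective (h.trans h1.symm)) (by decide)
  · exact ⟨false, h⟩

/-- If the removed edge is heavy, then the algorithm avoids it. -/
theorem tours_heavy (L : Layout G) (h : (1 + √3) * L.tot L.len < L.around) {s : ι}
    (hs : s ∈ G.verts) : ∃ b, ∃ c ≤ (1 + √3) * L.tot L.len, G.Tours true b s c := by
  obtain ⟨σ, hσ⟩ := L.exists_order
  have heavy : ∀ π : Equiv.Perm (Fin 3), (L.perm π).st ≠ 0 → (L.perm π).Heavy := fun π hπ =>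
    heavy_of_lt hπ (by rw [perm_tot, perm_around]; exact h)
  obtain ⟨i, k, hk, rfl⟩ := (L.mem_iff s).1 hs
  rcases Nat.eq_zero_or_pos k with rfl | hpos
  · obtain ⟨b, hb⟩ := exists_bool_ne σ L.st
    set π := (Equiv.addLeft (if b then (1 : Fin 3) else 0)).trans σ with hπ
    have hst : (L.perm π).st ≠ 0 := by
      rw [ne_comm, perm_st_ne, hπ]
      simpa using hb
    have := tours_heavy_of_junction (matches_perm hσ (if b then (1 : Fin 3) else 0)) hst
      (heavy _ hst)
    rw [perm_tot, perm_J, ← L.P_zero i] at this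
    exact ⟨b, this⟩
  · by_cases hi : i = L.st
    · subst hi
      -- This shift gives the stem the number 2, as in the memory of a searcher that comes from the
      -- stem.
      set t : Fin 3 := σ.symm L.st - 2 with ht
      set π := (Equiv.addLeft t).trans σ with hπ
      have h2 : π 2 = L.st := by simp [hπ, ht]
      have hst : (L.perm π).st = 2 := by
        by_contra h3
        exact perm_st_ne.1 (Ne.symm h3) h2
      have := tours_heavy_of_stem (matches_perm hσ t) (K := k) hpos
        (by change k ≤ L.len (π 2); rw [h2]; exact hk) hst
        (heavy _ (by rw [hst]; decide))
      change ∃ b, ∃ c ≤ (1 + √3) * (L.perm π).tot (L.perm π).len,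
        G.Tours true b (L.P (π 2) k) c at this
      rwa [h2, perm_tot] at this
    · set t : Fin 3 := σ.symm i with ht
      set π := (Equiv.addLeft t).trans σ with hπ
      have h0 : π 0 = i := by simp [hπ, ht]
      have hst : (L.perm π).st ≠ 0 := by
        rw [ne_comm, perm_st_ne, h0]; exact hi
      have := tours_heavy_of_first (matches_perm hσ t) (K := k) hpos
        (by change k ≤ L.len (π 0); rw [h0]; exact hk) hst (heavy _ hst)
      change ∃ b, ∃ c ≤ (1 + √3) * (L.perm π).tot (L.perm π).len,
        G.Tours true b (L.P (π 0) k) c at this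
      rwa [h0, perm_tot] at this

end Layout

/-! ### Choosing the numbering for a tour around the cycle -/

namespace Layout

variable {G : WeightedGraph ι} {L : Layout G} {σ : Equiv.Perm (Fin 3)}

/-- The hypothesis `hi` says that the stem follows leg `i` in the cyclic order at the junction, so
it becomes leg 1. -/
theorem tours_around_of_tip (hσ : ∀ m, L.bdAt (σ m) 0 = some (L.list m)) {i : Fin 3}
    (hi : σ (σ.symm i + 1) = L.st) (hl : 1 ≤ L.len i) :
    ∃ b, G.Tours false b (L.P i (L.len i)) L.around := by
  set t : Fin 3 := σ.symm i with ht
  set π := (Equiv.addLeft t).trans σ with hπ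
  have h0 : π 0 = i := by simp [hπ, ht]
  have hst : (L.perm π).st = 1 := by
    by_contra h3
    exact perm_st_ne.1 (Ne.symm h3) (by simpa [hπ] using hi)
  have h0s : (0 : Fin 3) ≠ (L.perm π).st := by rw [hst]; decide
  have ho : (L.perm π).oth 0 = 2 := by rw [oth, hst]; decide
  have := tours_around_of_cycle (matches_perm hσ t) hst
    (by change 1 ≤ L.len (π 0); rw [h0]; exact hl)
  have hc : (L.perm π).around = (L.perm π).dep 0 ((L.perm π).len 0) +
      (2 * (L.perm π).dep 1 ((L.perm π).len 1) + (L.perm π).dep 2 ((L.perm π).len 2) +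
        G.weight ((L.perm π).cutEdge 0)) := by
    rw [around, hst, weight_cutEdge h0s, tot]; ring
  rw [← hc, perm_around] at this
  change ∃ b, G.Tours false b (L.P (π 0) (L.len (π 0))) L.around at this
  rwa [h0] at this

theorem tours_around_of_mem_stem (hσ : ∀ m, L.bdAt (σ m) 0 = some (L.list m))
    (hl : L.len (σ (σ.symm L.st - 2)) = 0) {k : ℕ} (hk : 1 ≤ k) (hkl : k ≤ L.len L.st) :
    ∃ b, G.Tours false b (L.P L.st k) L.around := by
  set t : Fin 3 := σ.symm L.st - 2 with ht
  set π := (Equiv.addLeft t).trans σ with hπ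
  have h2 : π 2 = L.st := by simp [hπ, ht]
  have hst : (L.perm π).st = 2 := by
    by_contra h3
    exact perm_st_ne.1 (Ne.symm h3) h2
  have h0s : (0 : Fin 3) ≠ (L.perm π).st := by rw [hst]; decide
  have hl0 : (L.perm π).len 0 = 0 := by
    change L.len (σ (t + 0)) = 0
    rwa [add_zero]
  have := tours_around_of_stem (matches_perm hσ t) hst hl0 (K := k) hk
    (by change k ≤ L.len (π 2); rw [h2]; exact hkl)
  have hc : (L.perm π).around = 2 * (L.perm π).dep 2 ((L.perm π).len 2) +
      (L.perm π).dep 1 ((L.perm π).len 1) + G.weight ((L.perm π).cutEdge 0) := by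
    rw [around, hst, weight_cutEdge h0s, tot, hl0, dep_zero]; ring
  rw [← hc, perm_around] at this
  change ∃ b, G.Tours false b (L.P (π 2) k) L.around at this
  rwa [h2] at this

theorem tours_around_of_root (hσ : ∀ m, L.bdAt (σ m) 0 = some (L.list m)) {b : Bool}
    (hb : σ (if b then 1 else 0) ≠ L.st) (hl : L.len (σ (if b then 1 else 0)) = 0) :
    G.Tours false b L.J L.around := by
  set π := (Equiv.addLeft (if b then (1 : Fin 3) else 0)).trans σ with hπ
  have h0 : π 0 = σ (if b then 1 else 0) := by simp [hπ]
  have hst : (L.perm π).st ≠ 0 := by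
    rw [ne_comm, perm_st_ne, h0]; exact hb
  have hst' : (L.perm π).st = 1 ∨ (L.perm π).st = 2 := by
    generalize (L.perm π).st = k at hst
    revert k; decide
  have hl0 : (L.perm π).len 0 = 0 := by
    change L.len (π 0) = 0
    rwa [h0]
  have := tours_around_of_junction (matches_perm hσ (if b then (1 : Fin 3) else 0)) hst' hl0
  rw [weight_cutEdge (Ne.symm hst)] at this
  have hc : (L.perm π).around = 2 * (L.perm π).dep (L.perm π).st ((L.perm π).len (L.perm π).st) +
      (L.perm π).dep ((L.perm π).oth 0) ((L.perm π).len ((L.perm π).oth 0)) +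
        (L.perm π).cutWeight := by
    rw [around, tot_len hst, hl0, dep_zero]; ring
  rw [← hc, perm_around, perm_J] at this
  exact this

end Layout

/-! ### Enumerated tadpoles and the removal of an arbitrary cycle edge -/

/-- An enumeration of the vertices of a tadpole graph: the vertices of the cycle are `c 0`, …,
`c n = c 0`, and those of the stem are `S 1`, …, `S l`, with `S 0 = c 0`. -/
structure Tadpole (G : WeightedGraph ι) where
  /-- the number of vertices on the cycle -/
  n : ℕ
  /-- the number of vertices on the stem -/
  l : ℕ
  /-- the vertices on the cycle -/
  c : ℕ → ι
  /-- the vertices on the stem -/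
  S : ℕ → ι
  three_le : 3 ≤ n
  one_le : 1 ≤ l
  c_n : c n = c 0
  S_zero : S 0 = c 0
  c_inj : ∀ a b, a < n → b < n → c a = c b → a = b
  S_inj : ∀ a b, a ≤ l → b ≤ l → S a = S b → a = b
  c_eq_S : ∀ a b, a < n → b ≤ l → c a = S b → a = 0 ∧ b = 0
  mem_iff : ∀ v, v ∈ G.verts ↔ (∃ t < n, c t = v) ∨ ∃ t ≤ l, S t = v
  adj_iff : ∀ u v, G.graph.Adj u v ↔ (∃ t < n, s(u, v) = s(c t, c (t + 1))) ∨
    ∃ t < l, s(u, v) = s(S t, S (t + 1))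

namespace Tadpole

variable {G : WeightedGraph ι} (T : Tadpole G)

/-- The vertices on the two halves of the cycle and on the stem. -/
def leg (i : Fin 3) (t : ℕ) : ι :=
  match i with
  | 0 => T.c t
  | 1 => T.c (T.n - t)
  | 2 => T.S t

theorem leg_one_inj {k a b : ℕ} (hk : k < T.n) (ha : a ≤ k) (hb : b ≤ T.n - 1 - k)
    (h : T.c a = T.c (T.n - b)) : a = 0 ∧ b = 0 := by
  rcases Nat.eq_zero_or_pos b with rfl | hb0
  · rw [Nat.sub_zero, T.c_n] at h
    exact ⟨T.c_inj _ _ (by omega) (by omega) h, rfl⟩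
  · have := T.c_inj _ _ (by omega) (by omega) h
    omega

theorem leg_one_eq_S {a b : ℕ} (ha : a ≤ T.n - 1) (hb : b ≤ T.l)
    (h : T.c (T.n - a) = T.S b) : a = 0 ∧ b = 0 := by
  have := T.three_le
  rcases Nat.eq_zero_or_pos a with rfl | ha0
  · rw [Nat.sub_zero, T.c_n] at h
    exact ⟨rfl, (T.c_eq_S _ _ (by omega) hb h).2⟩
  · have := T.c_eq_S _ _ (by omega) hb h
    omega

/-- The layout in which the `k`-th edge of the cycle is removed. -/
def layout {k : ℕ} (hk : k < T.n) : Layout G where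
  P := T.leg
  -- Removing the edge from `c k` to `c (k+1)` leaves `k` edges counted upwards from `c 0` and
  -- `n-1-k` counted downwards from `c n = c 0`.
  len := ![k, T.n - 1 - k, T.l]
  st := 2
  root i j := by
    have : ∀ i, T.leg i 0 = T.c 0 := by
      intro i; fin_cases i
      exacts [rfl, T.c_n, T.S_zero]
    rw [this, this]
  inj i j a b ha hb h := by
    have h3 := T.three_le
    fin_cases i <;> fin_cases j
    · exact .inl ⟨rfl, T.c_inj _ _ (lt_of_le_of_lt ha hk) (lt_of_le_of_lt hb hk) h⟩
    · exact .inr (T.leg_one_inj hk ha hb h)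
    · exact .inr (T.c_eq_S _ _ (lt_of_le_of_lt ha hk) hb h)
    · exact .inr (T.leg_one_inj hk hb ha h.symm).symm
    · left
      have ha : a ≤ T.n - 1 - k := ha
      have hb : b ≤ T.n - 1 - k := hb
      have h : T.c (T.n - a) = T.c (T.n - b) := h
      refine ⟨rfl, ?_⟩
      rcases Nat.eq_zero_or_pos a with rfl | ha0
      · rw [Nat.sub_zero, T.c_n] at h
        exact (T.leg_one_inj hk (Nat.zero_le _) hb h).2.symm
      · rcases Nat.eq_zero_or_pos b with rfl | hb0
        · rw [Nat.sub_zero, T.c_n] at h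
          exact (T.leg_one_inj hk (Nat.zero_le _) ha h.symm).2
        · have := T.c_inj _ _ (by omega) (by omega) h
          omega
    · exact .inr (T.leg_one_eq_S (ha.trans (Nat.sub_le _ _)) hb h)
    · exact .inr (T.c_eq_S _ _ (lt_of_le_of_lt hb hk) ha h.symm).symm
    · exact .inr (T.leg_one_eq_S (hb.trans (Nat.sub_le _ _)) ha h.symm).symm
    · exact .inl ⟨rfl, T.S_inj _ _ ha hb h⟩
  mem_iff v := by
    rw [T.mem_iff]
    constructor
    · rintro (⟨t, ht, rfl⟩ | ⟨t, ht, rfl⟩)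
      · rcases Nat.lt_or_ge k t with h | h
        · refine ⟨1, T.n - t, ?_, ?_⟩
          · change T.n - t ≤ T.n - 1 - k
            omega
          · change T.c (T.n - (T.n - t)) = _
            congr 1; omega
        · exact ⟨0, t, h, rfl⟩
      · exact ⟨2, t, ht, rfl⟩
    · have h3 := T.three_le
      rintro ⟨i, t, ht, rfl⟩
      fin_cases i
      · exact .inl ⟨t, lt_of_le_of_lt ht hk, rfl⟩
      · have ht : t ≤ T.n - 1 - k := ht
        rcases Nat.eq_zero_or_pos t with rfl | h0
        · exact .inl ⟨0, by omega, T.c_n.symm⟩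
        · exact .inl ⟨T.n - t, by omega, rfl⟩
      · exact .inr ⟨t, ht, rfl⟩
  adj_iff u v := by
    rw [T.adj_iff]
    have hcut : T.leg 1 (T.n - 1 - k) = T.c (k + 1) := by
      change T.c (T.n - (T.n - 1 - k)) = _
      congr 1; omega
    constructor
    · rintro (⟨t, ht, h⟩ | ⟨t, ht, h⟩)
      · rcases Nat.lt_trichotomy t k with h1 | rfl | h1
        · exact .inl ⟨0, t, h1, h⟩
        · refine .inr ⟨0, 1, by decide, by decide, by decide, ?_⟩
          change s(u, v) = s(T.c t, T.leg 1 (T.n - 1 - t))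
          rw [hcut, h]
        · refine .inl ⟨1, T.n - 1 - t, ?_, ?_⟩
          · change T.n - 1 - t < T.n - 1 - k
            omega
          · change s(u, v) = s(T.c (T.n - (T.n - 1 - t)), T.c (T.n - (T.n - 1 - t + 1)))
            rw [h, Sym2.eq_swap]
            congr 3 <;> omega
      · exact .inl ⟨2, t, ht, h⟩
    · rintro (⟨i, t, ht, h⟩ | ⟨i, j, hij, hi, hj, h⟩)
      · fin_cases i
        · exact .inl ⟨t, lt_trans ht hk, h⟩
        · have ht : t < T.n - 1 - k := ht
          have h : s(u, v) = s(T.c (T.n - t), T.c (T.n - (t + 1))) := h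
          refine .inl ⟨T.n - (t + 1), by omega, ?_⟩
          rw [h, Sym2.eq_swap]
          congr 3; omega
        · exact .inr ⟨t, ht, h⟩
      · left
        refine ⟨k, hk, ?_⟩
        rw [← hcut, h]
        fin_cases i <;> fin_cases j <;> first
          | exact absurd rfl hij
          | exact absurd rfl hi
          | exact absurd rfl hj
          | rfl
          | exact Sym2.eq_swap
  len_st := T.one_le
  len_cy i j hij hi hj := by
    have h3 := T.three_le
    fin_cases i <;> fin_cases j <;> first
      | exact absurd rfl hij
      | exact absurd rfl hi
      | exact absurd rfl hj
      | skip
    · change 2 ≤ k + (T.n - 1 - k)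
      omega
    · change 2 ≤ (T.n - 1 - k) + k
      omega

/-- The weight of the `t`-th edge of the cycle. -/
def edge (t : ℕ) : ℝ := G.weight s(T.c t, T.c (t + 1))

/-- The length of the cycle. -/
def cycleLength : ℝ := ∑ t ∈ Finset.range T.n, T.edge t

/-- The length of the stem. -/
def stemLength : ℝ := ∑ t ∈ Finset.range T.l, G.weight s(T.S t, T.S (t + 1))

variable {k : ℕ} (hk : k < T.n)

theorem cutEdge_layout : (T.layout hk).cutEdge 0 = s(T.c k, T.c (k + 1)) := by
  change s(T.c k, T.c (T.n - (T.n - 1 - k))) = _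
  congr 3; omega

theorem cutWeight_layout : (T.layout hk).cutWeight = T.edge k := by
  have h : (0 : Fin 3) ≠ (T.layout hk).st := by change (0 : Fin 3) ≠ 2; decide
  rw [← Layout.weight_cutEdge h, cutEdge_layout, edge]

theorem dep_one_layout : (T.layout hk).dep 1 (T.n - 1 - k) =
    ∑ t ∈ Finset.range (T.n - 1 - k), T.edge (k + 1 + t) := by
  rw [Layout.dep, ← Finset.sum_range_reflect]
  refine Finset.sum_congr rfl fun t ht => ?_
  rw [Finset.mem_range] at ht
  change G.weight s(T.c (T.n - (T.n - 1 - k - 1 - t)), T.c (T.n - (T.n - 1 - k - 1 - t + 1))) = _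
  rw [Sym2.eq_swap, edge]
  congr 4 <;> omega

theorem cycleLength_eq {k : ℕ} (hk : k < T.n) : T.cycleLength =
    ∑ t ∈ Finset.range k, T.edge t + T.edge k +
      ∑ t ∈ Finset.range (T.n - 1 - k), T.edge (k + 1 + t) := by
  rw [← Finset.sum_range_succ, ← Finset.sum_range_add, cycleLength]
  congr 2; omega

/-- Thus the total is smallest when a heaviest cycle edge is removed. -/
theorem tot_layout :
    (T.layout hk).tot (T.layout hk).len + T.edge k = T.cycleLength + T.stemLength := by
  have h1 := T.dep_one_layout hk
  have h2 := T.cycleLength_eq hk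
  have h3 : (T.layout hk).dep 0 k = ∑ t ∈ Finset.range k, T.edge t := rfl
  have h4 : (T.layout hk).dep 2 T.l = T.stemLength := rfl
  change (T.layout hk).dep 0 k + (T.layout hk).dep 1 (T.n - 1 - k) + (T.layout hk).dep 2 T.l + _ = _
  linarith

theorem around_layout : (T.layout hk).around = T.cycleLength + 2 * T.stemLength := by
  have h1 := T.tot_layout hk
  have h4 : (T.layout hk).dep (T.layout hk).st ((T.layout hk).len (T.layout hk).st) =
    T.stemLength := rfl
  rw [Layout.around, h4, cutWeight_layout]
  linarith

/-- The edges at the junction do not depend on the removed edge, so one order `σ` serves all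
layouts, and the edge to be removed can be chosen after `σ`. -/
theorem bdAt_layout {k' : ℕ} (hk' : k' < T.n) (i : Fin 3) :
    (T.layout hk).bdAt i 0 = (T.layout hk').bdAt i 0 := by
  have key : ∀ {k : ℕ} (hk : k < T.n), (T.layout hk).nx i 0 =
      ![some (T.c 1), some (T.c (T.n - 1)), some (T.S 1)] i := by
    intro k hk
    have ho : ∀ i, (T.layout hk).oth i = -(i + 2) := fun _ => rfl
    have h3 := T.three_le
    fin_cases i
    · rcases Nat.eq_zero_or_pos k with rfl | h0
      · refine ((T.layout hk).nx_len (i := 0) (by change (0 : Fin 3) ≠ 2; decide)).trans ?_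
        change some (T.c (T.n - (T.n - 1 - 0))) = some (T.c 1)
        congr 2; omega
      · exact (T.layout hk).nx_of_lt h0
    · by_cases h0 : T.n - 1 - k = 0
      · have h := (T.layout hk).nx_len (i := 1) (by change (1 : Fin 3) ≠ 2; decide)
        have ho1 : (T.layout hk).oth 1 = 0 := by rw [ho]; decide
        rw [ho1] at h
        change (T.layout hk).nx 1 (T.n - 1 - k) = some (T.c k) at h
        rw [h0] at h
        refine h.trans ?_
        change _ = some (T.c (T.n - 1))
        congr 2; omega
      · exact (T.layout hk).nx_of_lt (i := 1) (Nat.pos_of_ne_zero h0)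
    · exact (T.layout hk).nx_of_lt T.one_le
  rw [Layout.bdAt, key hk, Layout.bdAt, key hk']
  rfl

theorem exists_order : ∃ σ : Equiv.Perm (Fin 3), ∀ {k : ℕ} (hk : k < T.n) (m : Fin 3),
    (T.layout hk).bdAt (σ m) 0 = some ((T.layout hk).list m) := by
  have h0 : 0 < T.n := by have := T.three_le; omega
  obtain ⟨σ, hσ⟩ := (T.layout h0).exists_order
  refine ⟨σ, fun hk m => ?_⟩
  rw [T.bdAt_layout hk h0, hσ m]
  exact congrArg (fun f => some (f m)) (Layout.list_congr rfl)

/-- The algorithm can go around the cycle. -/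
theorem tours_around {s : ι} (hs : s ∈ G.verts) :
    ∃ b, G.Tours false b s (T.cycleLength + 2 * T.stemLength) := by
  obtain ⟨σ, hσ⟩ := T.exists_order
  have h3 := T.three_le
  -- Either cycle leg can be made empty by removing the cycle edge with which it begins.
  have hlen : ∀ i : Fin 3, i ≠ 2 → ∃ k, ∃ hk : k < T.n, (T.layout hk).len i = 0 := by
    intro i hi
    fin_cases i
    · exact ⟨0, by omega, rfl⟩
    · exact ⟨T.n - 1, by omega, Nat.sub_self _⟩
    · exact absurd rfl hi
  have stem : ∀ k ≤ T.l, ∃ b, G.Tours false b (T.S k) (T.cycleLength + 2 * T.stemLength) := by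
    intro k hkl
    rcases Nat.eq_zero_or_pos k with rfl | hk0
    · obtain ⟨b, hb⟩ := Layout.exists_bool_ne σ 2
      obtain ⟨m, hm, hl⟩ := hlen _ hb
      have := Layout.tours_around_of_root (hσ hm) hb hl
      rw [around_layout, ← (T.layout hm).P_zero 2] at this
      exact ⟨b, this⟩
    · have hne : σ (σ.symm 2 - 2) ≠ 2 := by
        intro h
        have : σ.symm 2 - 2 = σ.symm 2 := by rw [Equiv.eq_symm_apply, h]
        revert this
        generalize σ.symm 2 = j
        revert j; decide
      obtain ⟨m, hm, hl⟩ := hlen _ hne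
      have := Layout.tours_around_of_mem_stem (hσ hm) hl hk0 hkl
      rw [around_layout] at this
      exact this
  rcases (T.mem_iff s).1 hs with ⟨k, hk, rfl⟩ | ⟨k, hk, rfl⟩
  · rcases Nat.eq_zero_or_pos k with rfl | hk0
    · rw [← T.S_zero]
      exact stem 0 (Nat.zero_le _)
    -- In the cyclic order of three edges, one of the two cycle edges immediately precedes the stem;
    -- the searcher should arrive through that one.
    · have hcase : ∀ a b c : Fin 3, a ≠ b → a ≠ c → b ≠ c → a + 1 = c ∨ b + 1 = c := by decide
      rcases hcase (σ.symm 0) (σ.symm 1) (σ.symm 2) (by simp) (by simp) (by simp) with h | h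
      · have := Layout.tours_around_of_tip (hσ hk) (i := 0)
          (by rw [h]; exact σ.apply_symm_apply 2) hk0
        rw [around_layout] at this
        exact this
      -- Removing the edge before `c k` instead of the one after it makes the start the tip of leg
      -- 1.
      · have hk' : k - 1 < T.n := by omega
        have := Layout.tours_around_of_tip (hσ hk') (i := 1)
          (by rw [h]; exact σ.apply_symm_apply 2)
          (by change 1 ≤ T.n - 1 - (k - 1); omega)
        rw [around_layout] at this
        have h2 : (T.layout hk').P 1 ((T.layout hk').len 1) = T.c k := by
          change T.c (T.n - (T.n - 1 - (k - 1))) = _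
          congr 1; omega
        rwa [h2] at this
  · exact stem k hk

end Tadpole

/-! ### The lower bound -/

section Crossings

variable {V : Type*} {H : SimpleGraph V}

/-- The edge has exactly one end in `X`. -/
def Crosses (X : V → Prop) (e : Sym2 V) : Prop := ∃ a b, e = s(a, b) ∧ X a ∧ ¬ X b

theorem crosses_mk {X : V → Prop} {a b : V} : Crosses X s(a, b) ↔ ¬ (X a ↔ X b) := by
  constructor
  · rintro ⟨x, y, h, hx, hy⟩
    rcases Sym2.eq_iff.1 h with ⟨rfl, rfl⟩ | ⟨rfl, rfl⟩ <;> tauto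
  · intro h
    by_cases ha : X a
    · exact ⟨a, b, rfl, ha, by tauto⟩
    · exact ⟨b, a, Sym2.eq_swap, by tauto, ha⟩

open Classical in
theorem even_crossings_iff (X : V → Prop) {u v : V} (p : H.Walk u v) :
    Even (p.edges.countP (Crosses X)) ↔ (X u ↔ X v) := by
  induction p with
  | nil => simp
  | @cons u w v h p ih =>
    rw [SimpleGraph.Walk.edges_cons, List.countP_cons]
    by_cases hc : X u ↔ X w
    · have : ¬ Crosses X s(u, w) := by rw [crosses_mk]; tauto
      simp only [this, decide_false, Bool.false_eq_true, if_false, add_zero, ih, hc]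
    · have : Crosses X s(u, w) := crosses_mk.2 hc
      simp only [this, decide_true, if_true, Nat.even_add_one, ih]
      tauto

theorem iff_of_forall_not_crosses (X : V → Prop) {u v : V} (p : H.Walk u v)
    (h : ∀ e ∈ p.edges, ¬ Crosses X e) : ∀ w ∈ p.support, (X u ↔ X w) := by
  induction p with
  | nil => simp
  | @cons u x v hadj p ih =>
    intro w hw
    have h1 := h s(u, x) (by simp)
    rw [crosses_mk, not_not] at h1
    rw [SimpleGraph.Walk.support_cons, List.mem_cons] at hw
    rcases hw with rfl | hw
    · exact Iff.rfl
    · exact h1.trans (ih (fun e he => h e (by simp [he])) w hw)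

open Classical in
-- A closed walk crosses a cut an even number of times, and not zero times if it meets both sides.
theorem two_le_crossings (X : V → Prop) {u : V} (p : H.Walk u u) {a b : V}
    (ha : a ∈ p.support) (hb : b ∈ p.support) (hXa : X a) (hXb : ¬ X b) :
    2 ≤ p.edges.countP (Crosses X) := by
  have h1 : Even (p.edges.countP (Crosses X)) := (even_crossings_iff X p).2 Iff.rfl
  have h2 : p.edges.countP (Crosses X) ≠ 0 := by
    intro h0
    rw [List.countP_eq_zero] at h0
    have h3 := iff_of_forall_not_crosses X p (fun e he => by simpa using h0 e he)
    exact hXb ((h3 b hb).1 ((h3 a ha).2 hXa))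
  obtain ⟨k, hk⟩ := h1
  omega

theorem countP_le_add {α : Type*} (p q r : α → Bool) (l : List α)
    (h : ∀ a ∈ l, p a → q a ∨ r a) : l.countP p ≤ l.countP q + l.countP r := by
  induction l with
  | nil => simp
  | cons a l ih =>
    have := ih fun b hb => h b (List.mem_cons_of_mem _ hb)
    have h1 := h a List.mem_cons_self
    simp only [List.countP_cons]
    by_cases hp : p a
    · rcases h1 hp with h2 | h2 <;> simp only [hp, h2, if_true] <;> omega
    · simp only [hp, Bool.false_eq_true, if_false]; omega

/-- Counting multiplicities on a set of distinct edges gives a lower bound for the cost; further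
traversed edges only add to it. -/
theorem sum_count_le {α : Type*} [DecidableEq α] (w : α → ℝ) (F : Finset α) (l : List α)
    (h : ∀ a ∈ l, 0 ≤ w a) : ∑ a ∈ F, (l.count a : ℝ) * w a ≤ (l.map w).sum := by
  induction l with
  | nil => simp
  | cons b l ih =>
    have h1 := ih fun a ha => h a (List.mem_cons_of_mem _ ha)
    have h2 : ∑ a ∈ F, ((b :: l).count a : ℝ) * w a =
        ∑ a ∈ F, (l.count a : ℝ) * w a + ∑ a ∈ F, if b = a then w a else 0 := by
      rw [← Finset.sum_add_distrib]
      refine Finset.sum_congr rfl fun a _ => ?_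
      rw [List.count_cons]
      by_cases hab : b = a
      · simp [hab, add_mul]
      · simp [hab]
    rw [h2, Finset.sum_ite_eq, List.map_cons, List.sum_cons]
    have h3 := h b List.mem_cons_self
    split_ifs <;> linarith

end Crossings

/-! ### Lower bounds for tours in a layout -/

namespace Layout

variable {G : WeightedGraph ι} {L : Layout G}

theorem edge_inj {i j : Fin 3} {t u : ℕ} (ht : t < L.len i) (hu : u < L.len j)
    (h : s(L.P i t, L.P i (t + 1)) = s(L.P j u, L.P j (u + 1))) : i = j ∧ t = u := by
  rcases Sym2.eq_iff.1 h with ⟨h1, h2⟩ | ⟨h1, h2⟩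
  · rcases L.inj _ _ _ _ ht hu h2 with h | h <;> omega
  · have a1 := L.inj _ _ _ _ ht.le hu h1
    have a2 := L.inj _ _ _ _ ht hu.le h2
    omega

theorem cutEdge_ne {i j : Fin 3} {t : ℕ} (hi : i ≠ L.st) (ht : t < L.len j) :
    L.cutEdge i ≠ s(L.P j t, L.P j (t + 1)) := by
  intro h
  have hne := L.oth_ne hi
  have hl := L.len_cy _ _ hne.1 hne.2 hi
  rcases Sym2.eq_iff.1 h with ⟨h1, h2⟩ | ⟨h1, h2⟩
  · rcases L.inj _ _ _ _ le_rfl ht.le h1 with ⟨h3, h3'⟩ | h3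
    · rcases L.inj _ _ _ _ le_rfl ht h2 with ⟨h4, -⟩ | h4
      · exact hne.1 (h4.trans h3.symm)
      · omega
    · rcases L.inj _ _ _ _ le_rfl ht h2 with ⟨h4, h4'⟩ | h4 <;> omega
  · rcases L.inj _ _ _ _ le_rfl ht.le h2 with ⟨h3, h3'⟩ | h3
    · rcases L.inj _ _ _ _ le_rfl ht h1 with ⟨h4, -⟩ | h4
      · exact hne.1 (h3.trans h4.symm)
      · omega
    · rcases L.inj _ _ _ _ le_rfl ht h1 with ⟨h4, h4'⟩ | h4 <;> omega

open Classical in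
/-- A tour uses an edge of the tree, or this edge and the removed one, at least twice. -/
theorem two_le_count {s : ι} {p : G.graph.Walk s s} (hp : G.IsTour p) {i : Fin 3} {t : ℕ}
    (ht : t < L.len i) : 2 ≤ p.edges.count s(L.P i t, L.P i (t + 1)) +
      if i = L.st then 0 else p.edges.count (L.cutEdge (L.st + 1)) := by
  -- The cut separates the outer part of the leg. Only the given tree edge crosses it and, on a
  -- cycle leg, the removed edge.
  set X : ι → Prop := fun v => ∃ m, t < m ∧ m ≤ L.len i ∧ L.P i m = v with hX
  have hmem : ∀ k ≤ L.len i, L.P i k ∈ p.support := fun k hk =>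
    hp _ ((L.mem_iff _).2 ⟨i, k, hk, rfl⟩)
  have hXb : ¬ X (L.P i 0) := by
    rintro ⟨m, h1, h2, h3⟩
    have := L.P_inj h2 (Nat.zero_le _) h3
    omega
  have h2 := two_le_crossings X p (hmem (L.len i) le_rfl) (hmem 0 (Nat.zero_le _))
    ⟨_, ht, le_rfl, rfl⟩ hXb
  have key : ∀ e ∈ p.edges, Crosses X e → e = s(L.P i t, L.P i (t + 1)) ∨
      (i ≠ L.st ∧ e = L.cutEdge (L.st + 1)) := by
    rintro e he ⟨a, b, rfl, ⟨m, h1, h2, rfl⟩, hb⟩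
    have hadj : G.graph.Adj (L.P i m) b := p.edges_subset_edgeSet he
    rcases (L.adj_P_iff h2 _).1 hadj with ⟨-, rfl⟩ | h | ⟨h, -⟩
    · left
      obtain rfl : m = t + 1 := by
        by_contra hm
        exact hb ⟨m - 1, by omega, by omega, rfl⟩
      exact Sym2.eq_swap
    · unfold nx at h
      split_ifs at h with h3 h4
      · exact absurd ⟨m + 1, by omega, h3, Option.some.inj h⟩ hb
      · right
        refine ⟨h4, ?_⟩
        rw [← cutEdge_congr h4 st_add_one_ne, cutEdge, ← Option.some.inj h]
        congr 3; omega
    · omega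
  refine h2.trans ?_
  split_ifs with h
  · rw [add_zero, List.count]
    refine List.countP_mono_left fun e he hc => ?_
    simpa [h] using key e he (by simpa using hc)
  · refine countP_le_add _ _ _ _ fun e he hc => ?_
    simpa [h] using key e he (by simpa using hc)

open Classical in
theorem sum_count_le_cost (L : Layout G) {s : ι} (p : G.graph.Walk s s) :
    ∑ i, ∑ t ∈ Finset.range (L.len i),
      (p.edges.count s(L.P i t, L.P i (t + 1)) : ℝ) * L.ew i t +
      (p.edges.count (L.cutEdge (L.st + 1)) : ℝ) * L.cutWeight ≤ G.walkCost p := by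
  set A : Finset ((_ : Fin 3) × ℕ) := Finset.univ.sigma fun i => Finset.range (L.len i) with hA
  set g : (_ : Fin 3) × ℕ → Sym2 ι := fun x => s(L.P x.1 x.2, L.P x.1 (x.2 + 1)) with hg
  have hinj : Set.InjOn g A := by
    rintro ⟨i, t⟩ ht ⟨j, u⟩ hu h
    simp only [hA, Finset.coe_sigma, Set.mem_sigma_iff, Finset.coe_univ, Set.mem_univ, true_and,
      Finset.coe_range, Set.mem_Iio] at ht hu
    obtain ⟨rfl, rfl⟩ := edge_inj ht hu h
    rfl
  have hnot : L.cutEdge (L.st + 1) ∉ A.image g := by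
    rw [Finset.mem_image]
    rintro ⟨⟨i, t⟩, ht, h⟩
    simp only [hA, Finset.mem_sigma, Finset.mem_univ, true_and, Finset.mem_range] at ht
    exact cutEdge_ne st_add_one_ne ht h.symm
  have h := sum_count_le G.weight (insert (L.cutEdge (L.st + 1)) (A.image g)) p.edges
    fun e he => (G.weight_pos e (p.edges_subset_edgeSet he)).le
  rw [Finset.sum_insert hnot, Finset.sum_image hinj, hA, Finset.sum_sigma, add_comm] at h
  exact h

theorem ew_nonneg {i : Fin 3} {t : ℕ} (h : t ∈ Finset.range (L.len i)) : 0 ≤ L.ew i t :=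
  (L.ew_pos (Finset.mem_range.1 h)).le

theorem cutWeight_nonneg : 0 ≤ L.cutWeight := by
  have h := L.oth_ne (st_add_one_ne (L := L))
  exact (G.weight_pos _ (L.adj_nx le_rfl (L.nx_len st_add_one_ne))).le

open Classical in
theorem two_mul_tot_le {s : ι} {p : G.graph.Walk s s} (hp : G.IsTour p)
    (h : p.edges.count (L.cutEdge (L.st + 1)) = 0) : 2 * L.tot L.len ≤ G.walkCost p := by
  refine le_trans ?_ (L.sum_count_le_cost p)
  rw [h, tot_eq_sum, Finset.mul_sum, Nat.cast_zero, zero_mul, add_zero]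
  refine Finset.sum_le_sum fun i _ => ?_
  rw [dep, Finset.mul_sum]
  refine Finset.sum_le_sum fun t ht => mul_le_mul_of_nonneg_right ?_ (ew_nonneg ht)
  have := two_le_count hp (Finset.mem_range.1 ht)
  rw [h, ite_self, add_zero] at this
  exact_mod_cast this

open Classical in
theorem around_le {s : ι} {p : G.graph.Walk s s} (hp : G.IsTour p)
    (h0 : L.cutEdge (L.st + 1) ∈ p.edges)
    (h : ∀ i ≠ L.st, ∀ t < L.len i, s(L.P i t, L.P i (t + 1)) ∈ p.edges) :
    L.around ≤ G.walkCost p := by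
  refine le_trans ?_ (L.sum_count_le_cost p)
  have hst : L.dep L.st (L.len L.st) = ∑ i, if i = L.st then L.dep i (L.len i) else 0 := by
    simp
  rw [around, tot_eq_sum, hst, ← Finset.sum_add_distrib]
  refine add_le_add (Finset.sum_le_sum fun i _ => ?_) ?_
  · have h1 : L.dep i (L.len i) + (if i = L.st then L.dep i (L.len i) else 0) =
        (if i = L.st then 2 else 1) * L.dep i (L.len i) := by
      split_ifs <;> ring
    rw [h1, dep, Finset.mul_sum]
    refine Finset.sum_le_sum fun t ht => mul_le_mul_of_nonneg_right ?_ (ew_nonneg ht)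
    split_ifs with hi
    · have := two_le_count hp (Finset.mem_range.1 ht)
      rw [if_pos hi, add_zero] at this
      exact_mod_cast this
    · exact_mod_cast List.count_pos_iff.2 (h i hi t (Finset.mem_range.1 ht))
  · refine le_mul_of_one_le_left cutWeight_nonneg ?_
    exact_mod_cast List.count_pos_iff.2 h0

end Layout

namespace Tadpole

variable {G : WeightedGraph ι} (T : Tadpole G)

/-- A tour goes around the cycle, or it avoids one of its edges and uses all other edges twice. -/
theorem lower_bound {s : ι} {p : G.graph.Walk s s} (hp : G.IsTour p) :
    T.cycleLength + 2 * T.stemLength ≤ G.walkCost p ∨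
      ∃ k, ∃ hk : k < T.n, 2 * (T.layout hk).tot (T.layout hk).len ≤ G.walkCost p := by
  classical
  have h3 := T.three_le
  have hcut : ∀ {k : ℕ} (hk : k < T.n),
      (T.layout hk).cutEdge ((T.layout hk).st + 1) = s(T.c k, T.c (k + 1)) := fun hk => by
    rw [← T.cutEdge_layout hk]
    exact Layout.cutEdge_congr Layout.st_add_one_ne (by change (0 : Fin 3) ≠ 2; decide)
  by_cases h : ∃ k < T.n, s(T.c k, T.c (k + 1)) ∉ p.edges
  · obtain ⟨k, hk, h⟩ := h
    right
    refine ⟨k, hk, Layout.two_mul_tot_le hp ?_⟩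
    rw [hcut hk]
    exact List.count_eq_zero.2 h
  · push Not at h
    left
    -- Every cycle edge is used, so any layout yields the bound.
    have h0 : 0 < T.n := by omega
    rw [← T.around_layout h0]
    refine Layout.around_le hp ?_ ?_
    · rw [hcut]; exact h 0 h0
    · intro i hi t ht
      fin_cases i
      · exact absurd ht (Nat.not_lt_zero t)
      · have ht : t < T.n - 1 - 0 := ht
        have := h (T.n - (t + 1)) (by omega)
        change s(T.c (T.n - t), T.c (T.n - (t + 1))) ∈ p.edges
        rw [Sym2.eq_swap]
        have he : T.n - (t + 1) + 1 = T.n - t := by omega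
        rwa [he] at this
      · exact absurd rfl hi

end Tadpole

/-! ### From the isomorphism to an enumeration, and the conclusion -/

theorem WeightedGraph.IsTadpole.exists_tadpole {G : WeightedGraph ι} (h : G.IsTadpole) :
    Nonempty (Tadpole G) := by
  obtain ⟨i, j, ⟨φ⟩⟩ := h
  have hadj : ∀ x y, G.graph.Adj (φ x).1 (φ y).1 ↔ (tadpoleGraph (i + 3) (j + 1)).Adj x y :=
    fun x y => φ.map_adj_iff
  have hinj : ∀ x y, (φ x).1 = (φ y).1 → x = y := fun x y h => φ.injective (Subtype.ext h)
  have hsurj : ∀ v ∈ G.verts, ∃ x, (φ x).1 = v := fun v hv =>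
    ⟨φ.symm ⟨v, hv⟩, by rw [φ.apply_symm_apply]⟩
  have hll : ∀ a b : Fin (i + 3), G.graph.Adj (φ (.inl a)).1 (φ (.inl b)).1 ↔
      a - b = 1 ∨ b - a = 1 := by
    intro a b
    rw [hadj, ← SimpleGraph.cycleGraph_adj]
    simp [tadpoleGraph, SimpleGraph.edge_adj]
  have hlr : ∀ (a : Fin (i + 3)) (b : Fin (j + 1)), G.graph.Adj (φ (.inl a)).1 (φ (.inr b)).1 ↔
      a = 0 ∧ b = 0 := by
    intro a b
    rw [hadj]
    simp [tadpoleGraph, SimpleGraph.edge_adj]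
  have hrr : ∀ a b : Fin (j + 1), G.graph.Adj (φ (.inr a)).1 (φ (.inr b)).1 ↔
      a.val + 1 = b.val ∨ b.val + 1 = a.val := by
    intro a b
    rw [hadj, ← SimpleGraph.pathGraph_adj]
    simp [tadpoleGraph, SimpleGraph.edge_adj]
  let c : ℕ → ι := fun t => (φ (.inl (Fin.ofNat (i + 3) t))).1
  -- The stem is shifted by one, since `S 0` is the junction; reduction modulo `i + 3` makes `c`
  -- periodic.
  let S : ℕ → ι := fun t => t.casesOn (c 0) fun t => (φ (.inr (Fin.ofNat (j + 1) t))).1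
  have hval : ∀ {n : ℕ} (a : Fin (n + 1)), Fin.ofNat (n + 1) a.val = a := fun a =>
    Fin.ext (Nat.mod_eq_of_lt a.2)
  have hsucc : ∀ t, Fin.ofNat (i + 3) (t + 1) = Fin.ofNat (i + 3) t + 1 := fun t =>
    Fin.ext (by simp [Fin.val_add])
  have hcv : ∀ a : Fin (i + 3), c a.val = (φ (.inl a)).1 := fun a => by simp only [c, hval]
  have hcv' : ∀ a : Fin (i + 3), c (a.val + 1) = (φ (.inl (a + 1))).1 := fun a => by
    simp only [c, hsucc, hval]
  have hSv : ∀ a : Fin (j + 1), S (a.val + 1) = (φ (.inr a)).1 := fun a => by simp only [S, hval]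
  have hcS : ∀ a b, a < i + 3 → b ≤ j + 1 → c a = S b → a = 0 ∧ b = 0 := by
    intro a b ha hb h
    cases b with
    | zero =>
      have := Sum.inl_injective (hinj _ _ h)
      exact ⟨by simpa [Nat.mod_eq_of_lt ha] using congrArg Fin.val this, rfl⟩
    | succ b => exact absurd (hinj _ _ h) (by simp)
  refine ⟨⟨i + 3, j + 1, c, S, by omega, by omega,
    congrArg (fun x => (φ (.inl x)).1) (Fin.ext (by simp)), rfl, ?_, ?_, hcS, ?_, ?_⟩⟩
  · intro a b ha hb h
    have := Sum.inl_injective (hinj _ _ h)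
    simpa [Nat.mod_eq_of_lt ha, Nat.mod_eq_of_lt hb] using congrArg Fin.val this
  · intro a b ha hb h
    cases a with
    | zero => exact (hcS 0 b (by omega) hb h).2.symm
    | succ a =>
      cases b with
      | zero => exact (hcS 0 _ (by omega) ha h.symm).2
      | succ b =>
        have := Sum.inr_injective (hinj _ _ h)
        have ha : a < j + 1 := ha
        have hb : b < j + 1 := hb
        simpa [Nat.mod_eq_of_lt ha, Nat.mod_eq_of_lt hb] using congrArg Fin.val this
  · intro v
    constructor
    · intro hv
      obtain ⟨a | a, rfl⟩ := hsurj v hv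
      · exact .inl ⟨a, a.2, hcv a⟩
      · exact .inr ⟨a + 1, a.2, hSv a⟩
    · rintro (⟨t, -, rfl⟩ | ⟨t, -, rfl⟩)
      · exact (φ _).2
      · cases t
        exacts [(φ _).2, (φ _).2]
  · intro u v
    constructor
    · intro huv
      obtain ⟨a | a, rfl⟩ := hsurj u (G.mem_verts_of_adj _ _ huv) <;>
        obtain ⟨b | b, rfl⟩ := hsurj v (G.mem_verts_of_adj _ _ huv.symm)
      · left
        rcases (hll a b).1 huv with h | h
        · obtain rfl : a = b + 1 := sub_eq_iff_eq_add'.1 h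
          refine ⟨b, b.2, ?_⟩
          rw [hcv, hcv', Sym2.eq_swap]
        · obtain rfl : b = a + 1 := sub_eq_iff_eq_add'.1 h
          refine ⟨a, a.2, ?_⟩
          rw [hcv, hcv']
      · obtain ⟨rfl, rfl⟩ := (hlr a b).1 huv
        exact .inr ⟨0, by omega, rfl⟩
      · obtain ⟨rfl, rfl⟩ := (hlr b a).1 huv.symm
        exact .inr ⟨0, by omega, Sym2.eq_swap⟩
      · right
        rcases (hrr a b).1 huv with h | h
        · refine ⟨a.val + 1, by omega, ?_⟩
          rw [hSv, h, hSv]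
        · refine ⟨b.val + 1, by omega, ?_⟩
          rw [hSv, h, hSv, Sym2.eq_swap]
    · have symm : ∀ {a b}, G.graph.Adj a b → s(u, v) = s(a, b) → G.graph.Adj u v := by
        intro a b hab h
        rw [← SimpleGraph.mem_edgeSet, h]
        exact hab
      rintro (⟨t, -, h⟩ | ⟨t, ht, h⟩)
      · exact symm ((hll _ _).2 (.inr (by rw [hsucc, add_sub_cancel_left]))) h
      · cases t with
        | zero => exact symm ((hlr _ _).2 ⟨rfl, rfl⟩) h
        | succ t =>
          refine symm ((hrr _ _).2 (.inl ?_)) h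
          rw [Fin.val_ofNat, Fin.val_ofNat, Nat.mod_eq_of_lt (by omega),
            Nat.mod_eq_of_lt (by omega)]

/-- With the right advice, the cost is bounded by that of a tour around the cycle, and by `1 + √3`
times the length of each spanning tree. -/
theorem Tadpole.exists_tours {G : WeightedGraph ι} (T : Tadpole G) {s : ι} (hs : s ∈ G.verts) :
    ∃ heavy b c, G.Tours heavy b s c ∧ c ≤ T.cycleLength + 2 * T.stemLength ∧
      ∀ {k} (hk : k < T.n), c ≤ (1 + √3) * (T.layout hk).tot (T.layout hk).len := by
  have h3 := T.three_le
  -- A heaviest cycle edge is the one to compare with: its removal gives the lightest spanning tree,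
  -- and the bound by this tree implies the bounds by all others.
  obtain ⟨k, hk, hmax⟩ := Finset.exists_max_image (Finset.range T.n) T.edge ⟨0, by simp; omega⟩
  rw [Finset.mem_range] at hk
  have hle : ∀ {k'} (hk' : k' < T.n), (1 + √3) * (T.layout hk).tot (T.layout hk).len ≤
      (1 + √3) * (T.layout hk').tot (T.layout hk').len := fun {k'} hk' => by
    have h1 := T.tot_layout hk
    have h2 := T.tot_layout hk'
    have h4 := hmax k' (Finset.mem_range.2 hk')
    exact mul_le_mul_of_nonneg_left (by linarith) (by positivity)
  rcases le_or_gt (T.cycleLength + 2 * T.stemLength)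
    ((1 + √3) * (T.layout hk).tot (T.layout hk).len) with h | h
  · obtain ⟨b, hb⟩ := T.tours_around hs
    exact ⟨false, b, _, hb, le_rfl, fun hk' => h.trans (hle hk')⟩
  · obtain ⟨b, c, hc, hb⟩ := (T.layout hk).tours_heavy (by rwa [T.around_layout]) hs
    exact ⟨true, b, c, hb, hc.trans h.le, fun hk' => hc.trans (hle hk')⟩

theorem WeightedGraph.walkCost_nonneg {G : WeightedGraph ι} {u v : ι} (p : G.graph.Walk u v) :
    0 ≤ G.walkCost p := by
  refine List.sum_nonneg fun x hx => ?_
  obtain ⟨e, he, rfl⟩ := List.mem_map.1 hx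
  exact (G.weight_pos e (p.edges_subset_edgeSet he)).le

theorem WeightedGraph.Tours.algCost_le {G : WeightedGraph ι} {heavy b : Bool} {s : ι} {c : ℝ}
    (h : G.Tours heavy b s c) :
    G.algCost (tadpoleAlgorithm ι ![heavy, b]) s ≤ ENNReal.ofReal c := by
  obtain ⟨l, hl, ht, hv⟩ := h
  exact WeightedGraph.algCost_le_of_exec _ _ hl ht hv

theorem competitiveRatio_tadpoleAlgorithm_le (ι : Type*) :
    competitiveRatio (tadpoleAlgorithm ι) {G : WeightedGraph ι | G.IsTadpole} ≤
      ENNReal.ofReal ((1 + √3) / 2) := by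
  refine iSup₂_le fun G hG => iSup₂_le fun s hs => ?_
  obtain ⟨T⟩ := WeightedGraph.IsTadpole.exists_tadpole hG
  obtain ⟨heavy, b, c, hT, hc, hc'⟩ := T.exists_tours hs
  have hsqrt := sqrt_three_bounds
  have hr : 0 < (1 + √3) / 2 := by linarith
  have hr0 : ENNReal.ofReal ((1 + √3) / 2) ≠ 0 := by simpa using hr
  refine ENNReal.div_le_of_le_mul ?_
  rw [mul_comm, ← ENNReal.div_le_iff hr0 ENNReal.ofReal_ne_top]
  -- It remains to compare the cost with each single tour `p`.
  refine le_iInf₂ fun p hp => ?_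
  rw [ENNReal.div_le_iff hr0 ENNReal.ofReal_ne_top,
    ← ENNReal.ofReal_mul (WeightedGraph.walkCost_nonneg p)]
  refine (iInf_le _ ![heavy, b]).trans (hT.algCost_le.trans (ENNReal.ofReal_le_ofReal ?_))
  rcases T.lower_bound hp with h | ⟨k, hk, h⟩
  · refine (hc.trans h).trans (le_mul_of_one_le_right (WeightedGraph.walkCost_nonneg p) ?_)
    linarith
  · have := mul_le_mul_of_nonneg_right h hr.le
    linarith [hc' hk]

end TadpoleExploration

theorem theorem3 (ι : Type*) :
    ∃ A : TadpoleExploration.AdviceAlgorithm ι 2,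
      TadpoleExploration.competitiveRatio A
          {G : TadpoleExploration.WeightedGraph ι | G.IsTadpole} ≤
        ENNReal.ofReal ((1 + Real.sqrt 3) / 2) :=
  ⟨_, TadpoleExploration.competitiveRatio_tadpoleAlgorithm_le ι⟩
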